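/- Let $M$ be a connected smooth manifold of dimension $n\ge 1$ (Hausdorff, second countable), let $X:M\to\mathbb{R}^{n+1}$ be a smooth immersion with smooth unit normal field $N:M\to\mathbb{R}^{n+1}$, and let $d\mu$ be the area element of the metric induced by $X$. Let $h_{ij}$ be the second fundamental form, with the sign determined by $\nabla_j\nabla_i X=h_{ij}N$, and let $H=\sum_{i,j} g^{ij}h_{ij}$ be the mean curvature. Assume that $M$ is complete in the induced metric and has polynomial area growth: there are constants $C,d$ with $\mu(\{p\in M: |X(p)|<r\})\le C r^d$ for all $r\ge 1$. Let $X_0\in\mathbb{R}^{n+1}$, $t_0>0$ and $\lambda\in\mathbb{R}$. A normal variation of $X$ is a family of immersions $X(s):M\to\mathbb{R}^{n+1}$, $s\in(-\varepsilon,\varepsilon)$, smooth in $(s,p)$, with $X(0)=X$, with $X(s)=X$ outside a compact subset of $M$ independent of $s$, and with $\frac{\partial X(s)}{\partial s}\big|_{s=0}=fN$ for some function $f:M\to\mathbb{R}$. Let $d\mu_s$ be the area element induced by $X(s)$. For smooth variations $X_s\in\mathbb{R}^{n+1}$ of $X_0$ and $t_s>0$ of $t_0$ (with value $X_0$, respectively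 $t_0$, at $s=0$), put $$\mathcal{F}_{X_s,t_s}(s)=(4\pi t_s)^{-\frac n2}\int_M e^{-\frac{|X(s)-X_s|^2}{2t_s}}\,d\mu_s+\lambda(4\pi t_0)^{-\frac n2}\Big(\frac{t_0}{t_s}\Big)^{\frac12}\int_M\langle X(s)-X_s,N\rangle e^{-\frac{|X-X_0|^2}{2t_0}}\,d\mu .$$ Call $X$ a critical point of $\mathcal{F}_{X_s,t_s}$ if $\frac{d}{ds}\big|_{s=0}\mathcal{F}_{X_s,t_s}(s)$ exists and equals $0$ for all normal variations $X(s)$ of $X$ and all variations $X_s$ of $X_0$ and $t_s$ of $t_0$; call it a critical point with respect to fixed $X_0$ and $t_0$ if this holds for all normal variations $X(s)$ with $X_s\equiv X_0$ and $t_s\equiv t_0$. Then $X$ is a critical point of $\mathcal{F}_{X_s,t_s}$ if and only if $$H+\Big\langle \frac{X-X_0}{t_0},N\Big\rangle=\lambda\quad\text{on } M .$$ Moreover, $X$ is a critical point of $\mathcal{F}_{X_s,t_s}$ if and only if it is a critical point with respect to fixed $X_0$ and $t_0$. -/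

import Mathlib

open Set Filter Topology MeasureTheory
open scoped Manifold ContDiff ENNReal

noncomputable section

namespace LambdaHypersurface

/-- Euclidean space `ℝ^k` with its standard inner product. -/
abbrev Euc (k : ℕ) : Type := EuclideanSpace ℝ (Fin k)

/-- `X : M → ℝ^{n+1}` is a smooth immersion of the `n`-dimensional manifold `M`: it is `C^∞` and
its differential is injective at every point. -/
structure IsImmersedHypersurface {n : ℕ} {M : Type*} [TopologicalSpace M]
    [ChartedSpace (Euc n) M] (X : M → Euc (n + 1)) : Prop where
  smooth : ContMDiff (𝓡 n) 𝓘(ℝ, Euc (n + 1)) ∞ X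
  injective_mfderiv : ∀ p : M, Function.Injective (mfderiv (𝓡 n) 𝓘(ℝ, Euc (n + 1)) X p)

/-- The differential `dX_p(v)`, as a vector of `ℝ^{n+1}`. -/
def differential {n : ℕ} {M : Type*} [TopologicalSpace M] [ChartedSpace (Euc n) M]
    (X : M → Euc (n + 1)) (p : M) (v : TangentSpace (𝓡 n) p) : Euc (n + 1) :=
  mfderiv (𝓡 n) 𝓘(ℝ, Euc (n + 1)) X p v

/-- `N` is a smooth unit normal vector field along `X`. -/
structure IsUnitNormal {n : ℕ} {M : Type*} [TopologicalSpace M] [ChartedSpace (Euc n) M]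
    (X N : M → Euc (n + 1)) : Prop where
  smooth : ContMDiff (𝓡 n) 𝓘(ℝ, Euc (n + 1)) ∞ N
  norm_eq_one : ∀ p : M, ‖N p‖ = 1
  orthogonal : ∀ (p : M) (v : TangentSpace (𝓡 n) p), inner ℝ (differential X p v) (N p) = 0

/-- The map `X` read in the preferred chart `φ` at `p`, that is `X ∘ φ⁻¹`. -/
def localRep {n : ℕ} {M : Type*} [TopologicalSpace M] [ChartedSpace (Euc n) M]
    (X : M → Euc (n + 1)) (p : M) : Euc n → Euc (n + 1) :=
  X ∘ (chartAt (Euc n) p).symm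

/-- The coordinate vector `∂_i (X ∘ φ⁻¹)(u)`, where `φ` is the preferred chart at `p`. -/
def coordVector {n : ℕ} {M : Type*} [TopologicalSpace M] [ChartedSpace (Euc n) M]
    (X : M → Euc (n + 1)) (p : M) (i : Fin n) (u : Euc n) : Euc (n + 1) :=
  fderiv ℝ (localRep X p) u (EuclideanSpace.single i 1)

/-- The matrix `g_{ij}(u) = ⟨∂_i X, ∂_j X⟩` of the induced metric in the preferred chart
at `p`. -/
def metricMatrix {n : ℕ} {M : Type*} [TopologicalSpace M] [ChartedSpace (Euc n) M]
    (X : M → Euc (n + 1)) (p : M) (u : Euc n) : Matrix (Fin n) (Fin n) ℝ :=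
  Matrix.gram ℝ (fun i => coordVector X p i u)

/-- The mean curvature `H = ∑ g^{ij} h_{ij}` with respect to the unit normal `N`, where
`h_{ij} = ⟨∂_i ∂_j X, N⟩`; a round sphere of radius `r` with inner unit normal has `H = n / r`. -/
def meanCurvature {n : ℕ} {M : Type*} [TopologicalSpace M] [ChartedSpace (Euc n) M]
    (X N : M → Euc (n + 1)) (p : M) : ℝ :=
  ∑ i : Fin n, ∑ j : Fin n,
    (metricMatrix X p (chartAt (Euc n) p p))⁻¹ i j *
      inner ℝ
        (fderiv ℝ (coordVector X p j) (chartAt (Euc n) p p) (EuclideanSpace.single i 1)) (N p)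

/-- The contribution of the preferred chart `φ` at `p` to the area element induced by `X`:
the image under `φ⁻¹` of the measure `√(det g) du` on the target of `φ`. -/
def chartArea {n : ℕ} {M : Type*} [TopologicalSpace M] [ChartedSpace (Euc n) M]
    [MeasurableSpace M] (X : M → Euc (n + 1)) (p : M) : Measure M :=
  Measure.map (chartAt (Euc n) p).symm
    ((volume.restrict (chartAt (Euc n) p).target).withDensity
      (fun u => ENNReal.ofReal (Real.sqrt (metricMatrix X p u).det)))

/-- The area element `dμ` induced by `X`. The measures `√(det g) du` of two charts agree on the
overlap of the charts, so the supremum of the chart contributions in the lattice of measures is the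
measure which restricts on every chart domain to `√(det g) du`. -/
def area {n : ℕ} {M : Type*} [TopologicalSpace M] [ChartedSpace (Euc n) M]
    [MeasurableSpace M] (X : M → Euc (n + 1)) : Measure M :=
  ⨆ p : M, chartArea X p

/-- The distance on `M` of the metric induced by `X`: the infimum of the lengths of the `C^1` paths
from `p` to `q`, where a tangent vector `v` has length `‖dX(v)‖`. -/
def inducedEDist {n : ℕ} {M : Type*} [TopologicalSpace M] [ChartedSpace (Euc n) M]
    (X : M → Euc (n + 1)) (p q : M) : ℝ≥0∞ :=
  letI : ∀ x : M, ENorm (TangentSpace (𝓡 n) x) := fun x => ⟨fun v => ‖differential X x v‖ₑ⟩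
  Manifold.riemannianEDist (𝓡 n) p q

/-- The hypersurface is complete: every Cauchy sequence for the induced distance converges. -/
def IsCompleteHypersurface {n : ℕ} {M : Type*} [TopologicalSpace M] [ChartedSpace (Euc n) M]
    (X : M → Euc (n + 1)) : Prop :=
  ∀ u : ℕ → M,
    (∀ ε : ℝ≥0∞, 0 < ε → ∃ k₀ : ℕ, ∀ k ≥ k₀, ∀ l ≥ k₀, inducedEDist X (u k) (u l) < ε) →
    ∃ p : M, Tendsto (fun k => inducedEDist X (u k) p) atTop (𝓝 0)

/-- Polynomial area growth: the area of the part of the hypersurface in the ball of radius `r ≥ 1`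
about the origin is at most `C r^d`. -/
def HasPolynomialAreaGrowth {n : ℕ} {M : Type*} [TopologicalSpace M] [ChartedSpace (Euc n) M]
    [MeasurableSpace M] (X : M → Euc (n + 1)) : Prop :=
  ∃ C d : ℝ, ∀ r : ℝ, 1 ≤ r → area X (X ⁻¹' Metric.ball 0 r) ≤ ENNReal.ofReal (C * r ^ d)

/-- The value of the `𝓕`-functional of the hypersurface `X` with unit normal `N` and base values
`X₀`, `t₀`, at the varied immersion `Y` and the varied values `x` of `X₀` and `t` of `t₀`:
`(4πt)^{-n/2} ∫ e^{-|Y-x|²/(2t)} dμ_Y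
  + λ (4πt₀)^{-n/2} (t₀/t)^{1/2} ∫ ⟨Y-x, N⟩ e^{-|X-X₀|²/(2t₀)} dμ_X`. -/
def functionalF {n : ℕ} {M : Type*} [TopologicalSpace M] [ChartedSpace (Euc n) M]
    [MeasurableSpace M] (lam : ℝ) (X N : M → Euc (n + 1)) (X₀ : Euc (n + 1)) (t₀ : ℝ)
    (Y : M → Euc (n + 1)) (x : Euc (n + 1)) (t : ℝ) : ℝ :=
  (4 * Real.pi * t) ^ (-(n : ℝ) / 2) *
      ∫ p, Real.exp (-‖Y p - x‖ ^ 2 / (2 * t)) ∂(area Y)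
    + lam * (4 * Real.pi * t₀) ^ (-(n : ℝ) / 2) * (t₀ / t) ^ (1 / 2 : ℝ) *
      ∫ p, inner ℝ (Y p - x) (N p) * Real.exp (-‖X p - X₀‖ ^ 2 / (2 * t₀)) ∂(area X)

/-- `Y s`, `s ∈ (-ε, ε)`, is a compactly supported variation of `X` through immersions, smooth in
`(s, p)`, whose variation vector field `∂Y/∂s` at `s = 0` is normal, of the form `f N`. (Such an `f`
is automatically smooth with compact support.) -/
structure IsNormalVariation {n : ℕ} {M : Type*} [TopologicalSpace M] [ChartedSpace (Euc n) M]
    (X N : M → Euc (n + 1)) (ε : ℝ) (Y : ℝ → M → Euc (n + 1)) : Prop where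
  pos : 0 < ε
  smooth : ContMDiffOn (𝓘(ℝ, ℝ).prod (𝓡 n)) 𝓘(ℝ, Euc (n + 1)) ∞
    (fun q : ℝ × M => Y q.1 q.2) (Ioo (-ε) ε ×ˢ univ)
  immersed : ∀ s ∈ Ioo (-ε) ε, IsImmersedHypersurface (Y s)
  initial : Y 0 = X
  compact_support : ∃ K : Set M, IsCompact K ∧ ∀ s ∈ Ioo (-ε) ε, ∀ p ∉ K, Y s p = X p
  normal : ∃ f : M → ℝ, ∀ p : M, HasDerivAt (fun s => Y s p) (f p • N p) 0

/-- `X` is a critical point of the `𝓕`-functional: the derivative at `s = 0` of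
`𝓕_{X_s, t_s}(Y s)` exists and vanishes for all normal variations `Y s` of `X` and all smooth
variations `x s` of `X₀` and `t s > 0` of `t₀`. -/
def IsCriticalPoint {n : ℕ} {M : Type*} [TopologicalSpace M] [ChartedSpace (Euc n) M]
    [MeasurableSpace M] (lam : ℝ) (X N : M → Euc (n + 1)) (X₀ : Euc (n + 1)) (t₀ : ℝ) : Prop :=
  ∀ (ε : ℝ) (Y : ℝ → M → Euc (n + 1)) (x : ℝ → Euc (n + 1)) (t : ℝ → ℝ),
    IsNormalVariation X N ε Y →
    ContDiffOn ℝ ∞ x (Ioo (-ε) ε) → x 0 = X₀ →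
    ContDiffOn ℝ ∞ t (Ioo (-ε) ε) → t 0 = t₀ → (∀ s ∈ Ioo (-ε) ε, 0 < t s) →
    HasDerivAt (fun s => functionalF lam X N X₀ t₀ (Y s) (x s) (t s)) 0 0

/-- `X` is a critical point of the `𝓕`-functional with `X₀` and `t₀` kept fixed: only normal
variations of `X` are considered. -/
def IsCriticalPointFixed {n : ℕ} {M : Type*} [TopologicalSpace M] [ChartedSpace (Euc n) M]
    [MeasurableSpace M] (lam : ℝ) (X N : M → Euc (n + 1)) (X₀ : Euc (n + 1)) (t₀ : ℝ) : Prop :=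
  ∀ (ε : ℝ) (Y : ℝ → M → Euc (n + 1)),
    IsNormalVariation X N ε Y →
    HasDerivAt (fun s => functionalF lam X N X₀ t₀ (Y s) X₀ t₀) 0 0

end LambdaHypersurface

end

open LambdaHypersurface

/-! Write `w = e^{-|X-X₀|²/(2t₀)}`, `a = -x'(0)`, `c = -t'(0)/(2t₀)` and `Z = a + c(X-X₀)`. A normal
variation with speed `f` changes the area element at the rate `-H f` (`hasDerivAt_areaRatio`).
Differentiating the Gaussians and the powers of `t` as well, the derivative of the functional at `s
= 0` is a positive constant times the integral of `w` times `f (λ - H - ⟨(X-X₀)/t₀, N⟩) + (n c -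
⟨X-X₀, Z⟩/t₀ + λ⟨Z, N⟩)` (`hasDerivAt_functionalF`). The logarithmic derivatives of `t^{-n/2}` and
`t^{-1/2}` at `s = 0` are exactly `n c` and `c`, so moving `(X₀, t₀)` acts like moving the
hypersurface by the translation and dilation field `Z`.

If `X` is critical with `X₀` and `t₀` fixed, only the first term is present. Every compactly
supported smooth `f` occurs as a speed (`exists_isNormalVariation`), so the fundamental lemma of the
calculus of variations gives `H + ⟨(X-X₀)/t₀, N⟩ = λ`.

Conversely, the equation kills the first term, and the second must be shown to integrate to zero.
The divergence of the tangential part of `w Z` is `w (n c - ⟨X-X₀, Z⟩/t₀ + (H + ⟨(X-X₀)/t₀, N⟩)⟨Z,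
N⟩)` (`normalDivergence_gaussWeight_smul`). On a solution this is exactly the second term, and the
divergence theorem applies. It holds for compactly supported Lipschitz fields by a partition of
unity and integration by parts in charts (`integral_normalDivergence`).

To pass to the noncompact field `w Z`, it is multiplied by cutoffs of the intrinsic distance with
gradient at most `1/(k+1)`. Completeness makes their supports compact, by a Hopf–Rinow argument for
the induced length distance (`exists_isCompact_of_complete`, `exists_cutoff`). Polynomial area
growth makes polynomials in `|X|` integrable against `w`, so the cutoff error tends to zero
(`integral_normalDivergence_eq_zero_of_complete`). The same growth gives the domination needed to
differentiate under the integral when `X₀` and `t₀` move, since then the integrand changes outside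
every compact set. -/

noncomputable section

namespace LambdaHypersurface

/-! ### Linear algebra of the induced metric -/

section LinearAlgebra

variable {n : ℕ} {F : Type*} [NormedAddCommGroup F] [InnerProductSpace ℝ F]

/-- The `i`-th standard basis vector. -/
abbrev stdVec {n : ℕ} (i : Fin n) : Euc n := EuclideanSpace.single i 1

lemma sum_coord_smul_stdVec (v : Euc n) : ∑ i, v i • stdVec i = v := by
  ext j
  simp [Finset.sum_apply, Pi.single_apply]

/-- The matrix of inner products `⟨A eᵢ, B eⱼ⟩`. -/
def crossGram (A B : Euc n →L[ℝ] F) : Matrix (Fin n) (Fin n) ℝ :=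
  Matrix.of fun i j => inner ℝ (A (stdVec i)) (B (stdVec j))

/-- The volume distortion `√det(AᵀA)` of a linear map. -/
def areaFactor (A : Euc n →L[ℝ] F) : ℝ := Real.sqrt (crossGram A A).det

/-- The matrix `(AᵀA)⁻¹`. -/
def gramInv (A : Euc n →L[ℝ] F) : Matrix (Fin n) (Fin n) ℝ := (crossGram A A)⁻¹

/-- The trace `∑ gⁱʲ ⟨A eᵢ, B eⱼ⟩` with respect to the metric induced by `A`. -/
def metricTrace (A B : Euc n →L[ℝ] F) : ℝ :=
  ∑ i, ∑ j, gramInv A i j * inner ℝ (A (stdVec i)) (B (stdVec j))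

/-- The preimage under `A` of the orthogonal projection of `v` on the range of `A`. -/
def tangPart (A : Euc n →L[ℝ] F) (v : F) : Euc n :=
  ∑ k, (∑ j, gramInv A k j * inner ℝ (A (stdVec j)) v) • stdVec k

/-- The matrix of a linear endomorphism in the standard basis. -/
def stdMatrix (T : Euc n →L[ℝ] Euc n) : Matrix (Fin n) (Fin n) ℝ :=
  Matrix.of fun k j => T (stdVec j) k

lemma crossGram_comm (A B : Euc n →L[ℝ] F) : (crossGram A B).transpose = crossGram B A := by
  ext i j; simp [crossGram, real_inner_comm]

lemma gramInv_symm (A : Euc n →L[ℝ] F) (i j : Fin n) : gramInv A i j = gramInv A j i := by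
  have : (gramInv A).transpose = gramInv A := by
    rw [gramInv, Matrix.transpose_nonsing_inv, crossGram_comm]
  exact congrFun (congrFun this.symm i) j

lemma linearIndependent_of_injective {A : Euc n →L[ℝ] F} (hA : Function.Injective A) :
    LinearIndependent ℝ (fun i => A (stdVec i)) := by
  rw [Fintype.linearIndependent_iff]
  intro g hg i
  have h1 : A (∑ i, g i • stdVec i) = 0 := by simpa using hg
  have h2 : ∑ i, g i • stdVec i = (0 : Euc n) := hA (by simpa using h1)
  have := congrArg (fun v : Euc n => v i) h2
  simpa [Finset.sum_apply, Pi.single_apply] using this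

lemma det_crossGram_pos {A : Euc n →L[ℝ] F} (hA : Function.Injective A) :
    0 < (crossGram A A).det :=
  (Matrix.posDef_gram_of_linearIndependent (𝕜 := ℝ) (linearIndependent_of_injective hA)).det_pos

lemma injective_of_det_crossGram_ne_zero {A : Euc n →L[ℝ] F} (hA : (crossGram A A).det ≠ 0) :
    Function.Injective A := by
  have h := Matrix.linearIndependent_of_det_gram_ne_zero (𝕜 := ℝ)
    (v := fun i => A (stdVec i)) hA
  rw [Fintype.linearIndependent_iff] at h
  rw [injective_iff_map_eq_zero]
  intro v hv
  have h1 := h (fun i => v i) (by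
    have := congrArg A (sum_coord_smul_stdVec v)
    simpa [hv] using this)
  ext i
  exact h1 i

lemma areaFactor_pos {A : Euc n →L[ℝ] F} (hA : Function.Injective A) : 0 < areaFactor A :=
  Real.sqrt_pos.2 (det_crossGram_pos hA)

lemma gramInv_mul {A : Euc n →L[ℝ] F} (hA : Function.Injective A) :
    gramInv A * crossGram A A = 1 :=
  Matrix.nonsing_inv_mul _ (det_crossGram_pos hA).ne'.isUnit

lemma mul_gramInv {A : Euc n →L[ℝ] F} (hA : Function.Injective A) :
    crossGram A A * gramInv A = 1 :=
  Matrix.mul_nonsing_inv _ (det_crossGram_pos hA).ne'.isUnit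

lemma metricTrace_eq_trace (A B : Euc n →L[ℝ] F) :
    metricTrace A B = (gramInv A * crossGram A B).trace := by
  simp only [metricTrace, Matrix.trace, Matrix.diag, Matrix.mul_apply]
  rw [Finset.sum_comm]
  refine Finset.sum_congr rfl fun i _ => Finset.sum_congr rfl fun j _ => ?_
  rw [gramInv_symm A j i]
  rfl

lemma metricTrace_add (A B C : Euc n →L[ℝ] F) :
    metricTrace A (B + C) = metricTrace A B + metricTrace A C := by
  simp [metricTrace, inner_add_right, mul_add, Finset.sum_add_distrib]

lemma metricTrace_smul (A B : Euc n →L[ℝ] F) (c : ℝ) :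
    metricTrace A (c • B) = c * metricTrace A B := by
  simp only [metricTrace, _root_.smul_apply, inner_smul_right, Finset.mul_sum]
  exact Finset.sum_congr rfl fun i _ => Finset.sum_congr rfl fun j _ => by ring

lemma metricTrace_self {A : Euc n →L[ℝ] F} (hA : Function.Injective A) :
    metricTrace A A = n := by
  rw [metricTrace_eq_trace, gramInv_mul hA]; simp

/-- This is how the gradient of a scalar factor enters a divergence: the trace of `dρ ⊗ v` is the
derivative of `ρ` along the tangential part of `v`, so a normal `v` contributes nothing. -/
lemma metricTrace_smulRight (A : Euc n →L[ℝ] F) (l : Euc n →L[ℝ] ℝ) (v : F) :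
    metricTrace A (l.smulRight v) = l (tangPart A v) := by
  simp only [metricTrace, tangPart, map_sum, map_smul, ContinuousLinearMap.smulRight_apply,
    inner_smul_right, smul_eq_mul, Finset.sum_mul]
  rw [Finset.sum_comm]
  refine Finset.sum_congr rfl fun i _ => Finset.sum_congr rfl fun j _ => ?_
  rw [gramInv_symm A j i]; ring

/-- The coefficients of `tangPart A v` solve the normal equations of the projection: the Gram matrix
cancels its inverse. -/
lemma inner_map_tangPart {A : Euc n →L[ℝ] F} (hA : Function.Injective A) (v : F) (w : Euc n) :
    inner ℝ (A w) (A (tangPart A v)) = inner ℝ (A w) v := by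
  have key : ∀ i, inner ℝ (A (stdVec i)) (A (tangPart A v)) = inner ℝ (A (stdVec i)) v := by
    intro i
    simp only [tangPart, map_sum, map_smul, inner_sum, inner_smul_right]
    have h := mul_gramInv hA
    calc ∑ k, (∑ j, gramInv A k j * inner ℝ (A (stdVec j)) v) *
            inner ℝ (A (stdVec i)) (A (stdVec k))
        = ∑ j, (crossGram A A * gramInv A) i j * inner ℝ (A (stdVec j)) v := by
          simp only [Matrix.mul_apply, Finset.sum_mul]
          rw [Finset.sum_comm]
          refine Finset.sum_congr rfl fun j _ => Finset.sum_congr rfl fun k _ => ?_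
          simp only [crossGram, Matrix.of_apply]; ring
      _ = _ := by simp [h, Matrix.one_apply]
  rw [← sum_coord_smul_stdVec w]
  simp [sum_inner, inner_smul_left, key]

lemma norm_map_tangPart_le {A : Euc n →L[ℝ] F} (hA : Function.Injective A) (v : F) :
    ‖A (tangPart A v)‖ ≤ ‖v‖ := by
  have h1 : ‖A (tangPart A v)‖ ^ 2 = inner ℝ (A (tangPart A v)) v := by
    rw [← inner_map_tangPart hA, real_inner_self_eq_norm_sq]
  have h2 := real_inner_le_norm (A (tangPart A v)) v
  by_contra! h
  nlinarith [norm_nonneg v, norm_nonneg (A (tangPart A v))]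

/-- Bounds the error of multiplying a field by a cutoff: projecting onto the range of `A` does not
increase the norm, and `l` is controlled by the metric of `A` rather than by the coordinate norm. -/
lemma abs_metricTrace_smulRight_le {A : Euc n →L[ℝ] F} (hA : Function.Injective A)
    {l : Euc n →L[ℝ] ℝ} {κ : ℝ} (hκ : 0 ≤ κ) (hl : ∀ w, |l w| ≤ κ * ‖A w‖) (v : F) :
    |metricTrace A (l.smulRight v)| ≤ κ * ‖v‖ := by
  rw [metricTrace_smulRight]
  exact (hl _).trans (mul_le_mul_of_nonneg_left (norm_map_tangPart_le hA v) hκ)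

/-- A unit normal to a hyperplane spans its orthogonal complement. -/
lemma eq_map_tangPart_add_normal {A : Euc n →L[ℝ] Euc (n + 1)} (hA : Function.Injective A)
    {ν : Euc (n + 1)} (hν : ‖ν‖ = 1) (hAν : ∀ w, inner ℝ (A w) ν = 0) (v : Euc (n + 1)) :
    v = A (tangPart A v) + inner ℝ v ν • ν := by
  set R : Submodule ℝ (Euc (n + 1)) := LinearMap.range (A : Euc n →ₗ[ℝ] Euc (n + 1)) with hR
  have hfr : Module.finrank ℝ R = n := by
    rw [hR, LinearMap.finrank_range_of_inj hA]; simp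
  have hfo : Module.finrank ℝ Rᗮ = 1 := by
    have := R.finrank_add_finrank_orthogonal
    rw [hfr] at this
    simp at this
    omega
  have hνR : ν ∈ Rᗮ := by
    rw [Submodule.mem_orthogonal]
    rintro _ ⟨w, rfl⟩
    exact hAν w
  have hν0 : ν ≠ 0 := by rintro rfl; simp at hν
  have hvR : v - A (tangPart A v) ∈ Rᗮ := by
    rw [Submodule.mem_orthogonal]
    rintro _ ⟨w, rfl⟩
    change inner ℝ (A w) _ = 0
    rw [inner_sub_right, inner_map_tangPart hA, sub_self]
  obtain ⟨c, hc⟩ := (finrank_eq_one_iff_of_nonzero' (⟨ν, hνR⟩ : Rᗮ)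
    (by simpa [Subtype.ext_iff] using hν0)).1 hfo ⟨_, hvR⟩
  have hc' : c • ν = v - A (tangPart A v) := congrArg Subtype.val hc
  have hcv : inner ℝ v ν = c := by
    have h1 : inner ℝ (c • ν) ν = inner ℝ v ν := by
      rw [hc', inner_sub_left, hAν, sub_zero]
    rw [← h1, inner_smul_left, real_inner_self_eq_norm_sq, hν]; simp
  rw [hcv, hc']; abel

lemma map_stdVec_eq_sum (T : Euc n →L[ℝ] Euc n) (j : Fin n) :
    T (stdVec j) = ∑ k, stdMatrix T k j • stdVec k := by
  rw [← sum_coord_smul_stdVec (T (stdVec j))]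
  simp [stdMatrix]

lemma crossGram_comp (A B : Euc n →L[ℝ] F) (T : Euc n →L[ℝ] Euc n) :
    crossGram (A ∘L T) (B ∘L T) =
      (stdMatrix T).transpose * crossGram A B * stdMatrix T := by
  ext i j
  simp only [crossGram, Matrix.of_apply, ContinuousLinearMap.comp_apply, map_stdVec_eq_sum T,
    map_sum, map_smul, sum_inner, inner_sum, inner_smul_left, inner_smul_right, Matrix.mul_apply,
    Matrix.transpose_apply, Finset.sum_mul, Finset.mul_sum]
  refine Finset.sum_congr rfl fun k _ => Finset.sum_congr rfl fun l _ => ?_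
  simp only [conj_trivial]; ring

lemma det_stdMatrix (T : Euc n →L[ℝ] Euc n) : (stdMatrix T).det = T.det := by
  rw [ContinuousLinearMap.det, ← LinearMap.det_toMatrix (EuclideanSpace.basisFun (Fin n) ℝ).toBasis]
  congr 1

lemma areaFactor_comp (A : Euc n →L[ℝ] F) (T : Euc n →L[ℝ] Euc n) :
    areaFactor (A ∘L T) = |T.det| * areaFactor A := by
  have : (crossGram (A ∘L T) (A ∘L T)).det = T.det ^ 2 * (crossGram A A).det := by
    rw [crossGram_comp, Matrix.det_mul, Matrix.det_mul, Matrix.det_transpose, det_stdMatrix]; ring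
  rw [areaFactor, this, Real.sqrt_mul (sq_nonneg _), Real.sqrt_sq_eq_abs]; rfl

/-- Invariance under change of coordinates: `gramInv A * crossGram A B` is conjugated by the matrix
of `T`, which leaves its trace unchanged. -/
lemma metricTrace_comp (A B : Euc n →L[ℝ] F) {T : Euc n →L[ℝ] Euc n} (hT : T.det ≠ 0) :
    metricTrace (A ∘L T) (B ∘L T) = metricTrace A B := by
  rw [metricTrace_eq_trace, metricTrace_eq_trace, gramInv, crossGram_comp, crossGram_comp,
    Matrix.mul_inv_rev, Matrix.mul_inv_rev]
  set t := stdMatrix T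
  have ht : IsUnit t.det := by rw [det_stdMatrix]; exact hT.isUnit
  have ht' : IsUnit t.transpose.det := by rwa [Matrix.det_transpose]
  have : t⁻¹ * ((crossGram A A)⁻¹ * t.transpose⁻¹) * (t.transpose * crossGram A B * t)
      = t⁻¹ * ((gramInv A * crossGram A B) * t) := by
    simp only [gramInv, Matrix.mul_assoc]
    rw [Matrix.nonsing_inv_mul_cancel_left _ _ ht']
  rw [this, Matrix.trace_mul_comm, Matrix.mul_assoc, Matrix.mul_nonsing_inv _ ht, Matrix.mul_one]

/-- Differentiating the Leibniz expansion replaces one column of `G` at a time by that of `G'`, and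
Cramer's rule identifies each resulting determinant with a diagonal entry of `adj(G) G'`. -/
lemma hasDerivAt_det {G : ℝ → Matrix (Fin n) (Fin n) ℝ} {G' : Matrix (Fin n) (Fin n) ℝ} {s : ℝ}
    (h : ∀ i j, HasDerivAt (fun τ => G τ i j) (G' i j) s) :
    HasDerivAt (fun τ => (G τ).det) ((G s).adjugate * G').trace s := by
  have h1 : HasDerivAt (fun τ => ∑ σ : Equiv.Perm (Fin n), ((Equiv.Perm.sign σ : ℤ) : ℝ) *
      ∏ i, G τ (σ i) i)
      (∑ σ : Equiv.Perm (Fin n), ((Equiv.Perm.sign σ : ℤ) : ℝ) *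
        ∑ i, (∏ j ∈ Finset.univ.erase i, G s (σ j) j) • G' (σ i) i) s := by
    refine HasDerivAt.fun_sum fun σ _ => HasDerivAt.const_mul _ ?_
    exact HasDerivAt.fun_finsetProd fun i _ => h (σ i) i
  simp only [Matrix.det_apply']
  convert h1 using 1
  have h2 : ∀ i, ((G s).adjugate * G') i i = ((G s).updateCol i fun k => G' k i).det := by
    intro i
    rw [← Matrix.cramer_apply, Matrix.cramer_eq_adjugate_mulVec]
    rfl
  simp only [Matrix.trace, Matrix.diag, h2, Matrix.det_apply', Finset.mul_sum]
  rw [Finset.sum_comm]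
  refine Finset.sum_congr rfl fun σ _ => Finset.sum_congr rfl fun i _ => ?_
  rw [← Finset.mul_prod_erase _ _ (Finset.mem_univ i)]
  have h3 : ∏ j ∈ Finset.univ.erase i, (G s).updateCol i (fun k => G' k i) (σ j) j
      = ∏ j ∈ Finset.univ.erase i, G s (σ j) j :=
    Finset.prod_congr rfl fun j hj => by
      rw [Matrix.updateCol_ne (Finset.ne_of_mem_erase hj)]
  rw [h3, Matrix.updateCol_self]
  simp only [smul_eq_mul]; ring

/-- Jacobi's formula for the area factor. -/
lemma hasDerivAt_areaFactor {A : ℝ → Euc n →L[ℝ] F} {B : Euc n →L[ℝ] F} {s : ℝ}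
    (hA : Function.Injective (A s)) (h : HasDerivAt A B s) :
    HasDerivAt (fun τ => areaFactor (A τ)) (areaFactor (A s) * metricTrace (A s) B) s := by
  have h1 : ∀ i j, HasDerivAt (fun τ => crossGram (A τ) (A τ) i j)
      ((crossGram (A s) B + crossGram B (A s)) i j) s := by
    intro i j
    have hv : ∀ v, HasDerivAt (fun τ => A τ v) (B v) s := fun v => by
      simpa using h.clm_apply (hasDerivAt_const s v)
    exact (hv _).inner ℝ (hv _)
  have h2 := (hasDerivAt_det h1).sqrt (det_crossGram_pos hA).ne'
  convert! h2 using 1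
  set G := crossGram (A s) (A s) with hG
  have hdet : 0 < G.det := det_crossGram_pos hA
  have h3 : G.adjugate = G.det • gramInv (A s) := by
    rw [gramInv, ← hG, Matrix.inv_def, Ring.inverse_eq_inv', smul_smul,
      mul_inv_cancel₀ hdet.ne', one_smul]
  -- The two halves of the derivative of the Gram matrix are transposes of each other and have the
  -- same trace against `gramInv`. Their sum cancels the `1/2` coming from the square root.
  have h4 : (gramInv (A s) * crossGram B (A s)).trace = metricTrace (A s) B := by
    rw [metricTrace_eq_trace, ← Matrix.trace_transpose, Matrix.transpose_mul, crossGram_comm,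
      gramInv, Matrix.transpose_nonsing_inv, crossGram_comm, Matrix.trace_mul_comm]
  rw [h3, Matrix.smul_mul, Matrix.mul_add, Matrix.trace_smul, Matrix.trace_add, h4,
    ← metricTrace_eq_trace, areaFactor, ← hG, smul_eq_mul]
  have h5 : Real.sqrt G.det ≠ 0 := (Real.sqrt_pos.2 hdet).ne'
  field_simp
  rw [Real.sq_sqrt hdet.le]; ring


end LinearAlgebra

/-! ### Smooth dependence on the differential and the divergence identity in coordinates -/

section Calculus

variable {n : ℕ} {F : Type*} [NormedAddCommGroup F] [InnerProductSpace ℝ F]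
  {P : Type*} [NormedAddCommGroup P] [NormedSpace ℝ P]

lemma ContDiffAt.matrix_det {k : WithTop ℕ∞} {G : P → Matrix (Fin n) (Fin n) ℝ} {x : P}
    (h : ∀ i j, ContDiffAt ℝ k (fun y => G y i j) x) : ContDiffAt ℝ k (fun y => (G y).det) x := by
  simp only [Matrix.det_apply']
  exact ContDiffAt.sum fun σ _ => contDiffAt_const.mul (contDiffAt_prod fun i _ => h _ _)

lemma contDiffAt_crossGram {k : WithTop ℕ∞} {A B : P → Euc n →L[ℝ] F} {x : P}
    (hA : ContDiffAt ℝ k A x) (hB : ContDiffAt ℝ k B x) (i j : Fin n) :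
    ContDiffAt ℝ k (fun y => crossGram (A y) (B y) i j) x :=
  (hA.clm_apply contDiffAt_const).inner ℝ (hB.clm_apply contDiffAt_const)

lemma contDiffAt_areaFactor {k : WithTop ℕ∞} {A : P → Euc n →L[ℝ] F} {x : P}
    (hA : ContDiffAt ℝ k A x) (hinj : Function.Injective (A x)) :
    ContDiffAt ℝ k (fun y => areaFactor (A y)) x :=
  (ContDiffAt.matrix_det (contDiffAt_crossGram hA hA)).sqrt (det_crossGram_pos hinj).ne'

lemma contDiffAt_gramInv {k : WithTop ℕ∞} {A : P → Euc n →L[ℝ] F} {x : P}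
    (hA : ContDiffAt ℝ k A x) (hinj : Function.Injective (A x)) (i j : Fin n) :
    ContDiffAt ℝ k (fun y => gramInv (A y) i j) x := by
  -- Cramer's rule turns an entry of the inverse into a quotient of determinants, whose smoothness
  -- is visible.
  have h1 : (fun y => gramInv (A y) i j) = fun y =>
      (crossGram (A y) (A y)).det⁻¹ *
        ((crossGram (A y) (A y)).updateRow j (Pi.single i 1)).det := by
    ext y
    rw [gramInv, Matrix.inv_def, Ring.inverse_eq_inv', Matrix.smul_apply, Matrix.adjugate_apply,
      smul_eq_mul]
  rw [h1]
  refine ((ContDiffAt.matrix_det (contDiffAt_crossGram hA hA)).inv (det_crossGram_pos hinj).ne').mul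
    (ContDiffAt.matrix_det fun a b => ?_)
  by_cases h : a = j
  · subst h
    simp only [Matrix.updateRow_self]
    exact contDiffAt_const
  · simp only [Matrix.updateRow_ne h]
    exact contDiffAt_crossGram hA hA a b

lemma contDiffAt_metricTrace {k : WithTop ℕ∞} {A B : P → Euc n →L[ℝ] F} {x : P}
    (hA : ContDiffAt ℝ k A x) (hinj : Function.Injective (A x)) (hB : ContDiffAt ℝ k B x) :
    ContDiffAt ℝ k (fun y => metricTrace (A y) (B y)) x :=
  ContDiffAt.sum fun i _ => ContDiffAt.sum fun j _ =>
    (contDiffAt_gramInv hA hinj i j).mul (contDiffAt_crossGram hA hB i j)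

lemma tangPart_apply (A : Euc n →L[ℝ] F) (v : F) (k : Fin n) :
    tangPart A v k = ∑ j, gramInv A k j * inner ℝ (A (stdVec j)) v := by
  simp [tangPart, Finset.sum_apply, Pi.single_apply]

lemma contDiffAt_tangPart {k : WithTop ℕ∞} {A : P → Euc n →L[ℝ] F} {v : P → F} {x : P}
    (hA : ContDiffAt ℝ k A x) (hinj : Function.Injective (A x)) (hv : ContDiffAt ℝ k v x) :
    ContDiffAt ℝ k (fun y => tangPart (A y) (v y)) x :=
  ContDiffAt.sum fun i _ => (ContDiffAt.sum fun j _ => (contDiffAt_gramInv hA hinj i j).mul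
    ((hA.clm_apply contDiffAt_const).inner ℝ hv)).smul contDiffAt_const

/-- Asks only pointwise differentiability of `v`: it will be applied to a smooth field times a
Lipschitz cutoff, which is differentiable only almost everywhere. -/
lemma differentiableAt_tangPart {A : P → Euc n →L[ℝ] F} {v : P → F} {x : P}
    (hA : ContDiffAt ℝ 1 A x) (hinj : Function.Injective (A x)) (hv : DifferentiableAt ℝ v x) :
    DifferentiableAt ℝ (fun y => tangPart (A y) (v y)) x := by
  refine DifferentiableAt.fun_sum fun i _ => (DifferentiableAt.fun_sum fun j _ =>
    ((contDiffAt_gramInv hA hinj i j).differentiableAt one_ne_zero).mul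
    (((hA.differentiableAt one_ne_zero).clm_apply (differentiableAt_const _)).inner ℝ hv)).smul
      (differentiableAt_const _)

lemma tangPart_eq_zero {A : Euc n →L[ℝ] F} {v : F} (h : ∀ w, inner ℝ (A w) v = 0) :
    tangPart A v = 0 := by
  simp [tangPart, h]

lemma metricTrace_comp_right {A : Euc n →L[ℝ] F} (hA : Function.Injective A)
    (T : Euc n →L[ℝ] Euc n) : metricTrace A (A ∘L T) = ∑ k, T (stdVec k) k := by
  have : crossGram A (A ∘L T) = crossGram A A * stdMatrix T := by
    ext i j
    simp only [crossGram, Matrix.of_apply, ContinuousLinearMap.comp_apply, map_stdVec_eq_sum T,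
      map_sum, map_smul, inner_sum, inner_smul_right, Matrix.mul_apply]
    exact Finset.sum_congr rfl fun k _ => mul_comm _ _
  rw [metricTrace_eq_trace, this, ← Matrix.mul_assoc, gramInv_mul hA, Matrix.one_mul]
  rfl

/-- Injectivity is the nonvanishing of the Gram determinant, an open condition. -/
lemma eventually_injective {T : Type*} [TopologicalSpace T] {A : T → Euc n →L[ℝ] F} {x : T}
    (hA : ContinuousAt A x)
    (hinj : Function.Injective (A x)) : ∀ᶠ y in 𝓝 x, Function.Injective (A y) := by
  have h1 : ContinuousAt (fun y => (crossGram (A y) (A y)).det) x := by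
    have : ContinuousAt (fun B : Euc n →L[ℝ] F => (crossGram B B).det) (A x) :=
      (ContDiffAt.matrix_det (k := 0) (contDiffAt_crossGram contDiffAt_id contDiffAt_id)).continuousAt
    exact ContinuousAt.comp (f := A) this hA
  filter_upwards [h1.eventually_ne (det_crossGram_pos hinj).ne'] with y hy
  exact injective_of_det_crossGram_ne_zero hy

/-- In coordinates, the divergence of the tangential part of a vector field `U` along an immersion
`X` is the trace of its differential corrected by the mean curvature term. -/
lemma sum_fderiv_areaFactor_mul_tangPart {X N U : Euc n → Euc (n + 1)} {u : Euc n}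
    (hX : ContDiffAt ℝ 2 X u) (hinj : Function.Injective (fderiv ℝ X u))
    (hN : DifferentiableAt ℝ N u) (hN1 : ∀ᶠ w in 𝓝 u, ‖N w‖ = 1)
    (hXN : ∀ᶠ w in 𝓝 u, ∀ v, inner ℝ (fderiv ℝ X w v) (N w) = 0) (hU : DifferentiableAt ℝ U u) :
    ∑ k, fderiv ℝ (fun w => areaFactor (fderiv ℝ X w) * tangPart (fderiv ℝ X w) (U w) k) u
      (stdVec k) = areaFactor (fderiv ℝ X u) * (metricTrace (fderiv ℝ X u) (fderiv ℝ U u)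
        - metricTrace (fderiv ℝ X u) (fderiv ℝ N u) * inner ℝ (U u) (N u)) := by
  set A : Euc n → Euc n →L[ℝ] Euc (n + 1) := fderiv ℝ X with hAdef
  have hA : ContDiffAt ℝ 1 A u := hX.fderiv_right le_rfl
  have hAd : HasFDerivAt A (fderiv ℝ A u) u := (hA.differentiableAt one_ne_zero).hasFDerivAt
  set W : Euc n → Euc n := fun w => tangPart (A w) (U w) with hWdef
  have hWd : HasFDerivAt W (fderiv ℝ W u) u :=
    (differentiableAt_tangPart hA hinj hU).hasFDerivAt
  set a : Euc n → ℝ := fun w => areaFactor (A w) with hadef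
  have had : HasFDerivAt a (fderiv ℝ a u) u :=
    ((contDiffAt_areaFactor hA hinj).differentiableAt one_ne_zero).hasFDerivAt
  -- Jacobi's formula along the line `u + s v`.
  have hda : ∀ v, fderiv ℝ a u v = a u * metricTrace (A u) (fderiv ℝ A u v) := by
    intro v
    have hl : HasDerivAt (fun s : ℝ => u + s • v) v 0 := by
      simpa using ((hasDerivAt_id (0 : ℝ)).smul_const v).const_add u
    have e1 : HasDerivAt (fun s : ℝ => A (u + s • v)) (fderiv ℝ A u v) 0 :=
      HasFDerivAt.comp_hasDerivAt (f := fun s : ℝ => u + s • v) (0 : ℝ) (by simpa using hAd) hl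
    have e2 : HasDerivAt (fun s : ℝ => a (u + s • v)) (fderiv ℝ a u v) 0 :=
      HasFDerivAt.comp_hasDerivAt (l := a) (f := fun s : ℝ => u + s • v) (0 : ℝ)
        (by simpa using had) hl
    have e3 := hasDerivAt_areaFactor (by simpa using hinj) e1
    have := e2.unique e3
    simpa using this
  set c : Euc n → ℝ := fun w => inner ℝ (U w) (N w) with hcdef
  have hcd : HasFDerivAt c (fderiv ℝ c u) u := (hU.inner ℝ hN).hasFDerivAt
  -- Split `U` into tangential and normal parts near `u`. Differentiating this splitting and taking
  -- the trace yields the identity.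
  have hdec : U =ᶠ[𝓝 u] fun w => A w (W w) + c w • N w := by
    filter_upwards [hN1, hXN, eventually_injective hA.continuousAt hinj] with w h1 h2 h3
    exact eq_map_tangPart_add_normal h3 h1 h2 _
  have hU' : fderiv ℝ U u = A u ∘L fderiv ℝ W u + (fderiv ℝ A u (W u)) +
      ((fderiv ℝ c u).smulRight (N u) + c u • fderiv ℝ N u) := by
    have h1 := ((hAd.clm_apply hWd).add (hcd.smul hN.hasFDerivAt)).congr_of_eventuallyEq hdec
    rw [h1.fderiv]
    ext1 v
    -- Symmetry of the second derivative of `X` lets the term with `dA` be traced as the derivative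
    -- of `A` in the direction `W u`, which by `hda` is the logarithmic derivative of the area
    -- factor along `W u`.
    have hs : fderiv ℝ A u v (W u) = fderiv ℝ A u (W u) v :=
      (hX.isSymmSndFDerivAt (by simp)) v (W u)
    simp [hs]
    abel
  have hN0 : ∀ w, inner ℝ (A u w) (N u) = 0 := hXN.self_of_nhds
  -- The term with the gradient of `c` is a multiple of the normal and has no trace.
  have hR : metricTrace (A u) (fderiv ℝ U u) = ∑ k, fderiv ℝ W u (stdVec k) k
      + metricTrace (A u) (fderiv ℝ A u (W u)) + c u * metricTrace (A u) (fderiv ℝ N u) := by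
    rw [hU', metricTrace_add, metricTrace_add, metricTrace_add, metricTrace_comp_right hinj,
      metricTrace_smulRight, tangPart_eq_zero hN0, map_zero, metricTrace_smul]
    ring
  have hL : ∀ k, fderiv ℝ (fun w => a w * W w k) u (stdVec k)
      = a u * fderiv ℝ W u (stdVec k) k + W u k * fderiv ℝ a u (stdVec k) := by
    intro k
    have h1 : HasFDerivAt (fun w => W w k)
        ((EuclideanSpace.proj k : Euc n →L[ℝ] ℝ) ∘L fderiv ℝ W u) u :=
      (EuclideanSpace.proj k : Euc n →L[ℝ] ℝ).hasFDerivAt.comp u hWd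
    rw [(had.fun_mul h1).fderiv]
    simp
  have hsum : ∑ k, W u k * fderiv ℝ a u (stdVec k) = fderiv ℝ a u (W u) := by
    conv_rhs => rw [← sum_coord_smul_stdVec (W u)]
    simp
  change ∑ k, fderiv ℝ (fun w => a w * W w k) u (stdVec k) = a u * (_ - _ * c u)
  rw [Finset.sum_congr rfl fun k _ => hL k, Finset.sum_add_distrib, hsum, hda, hR,
    ← Finset.mul_sum]
  ring

end Calculus

/-! ### The divergence theorem in a chart -/

section Lipschitz

variable {E F : Type*} [NormedAddCommGroup E] [NormedAddCommGroup F]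

/-- `f` is Lipschitz in a neighbourhood of `x`. -/
def LipschitzNear (f : E → F) (x : E) : Prop :=
  ∃ K, ∃ t ∈ 𝓝 x, LipschitzOnWith K f t

lemma LipschitzNear.continuousAt {f : E → F} {x : E} (h : LipschitzNear f x) :
    ContinuousAt f x := by
  obtain ⟨K, t, ht, hf⟩ := h
  exact hf.continuousOn.continuousAt ht

lemma LipschitzNear.congr {f g : E → F} {x : E} (h : LipschitzNear f x) (hfg : f =ᶠ[𝓝 x] g) :
    LipschitzNear g x := by
  obtain ⟨K, t, ht, hf⟩ := h
  refine ⟨K, t ∩ {y | f y = g y}, inter_mem ht hfg, ?_⟩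
  intro y hy z hz
  have h1 : f y = g y := hy.2
  have h2 : f z = g z := hz.2
  rw [← h1, ← h2]
  exact hf hy.1 hz.1

lemma lipschitzNear_const (c : F) (x : E) : LipschitzNear (fun _ => c) x :=
  ⟨0, univ, univ_mem, (LipschitzWith.const c).lipschitzOnWith⟩

lemma ContDiffAt.lipschitzNear [NormedSpace ℝ E] [NormedSpace ℝ F] {f : E → F} {x : E}
    (hf : ContDiffAt ℝ 1 f x) : LipschitzNear f x := by
  obtain ⟨K, t, ht, h⟩ := hf.exists_lipschitzOnWith
  exact ⟨K, t, ht, h⟩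

lemma LipschitzNear.comp {G : Type*} [NormedAddCommGroup G] {g : F → G} {f : E → F} {x : E}
    (hg : LipschitzNear g (f x)) (hf : LipschitzNear f x) : LipschitzNear (fun y => g (f y)) x := by
  obtain ⟨K', s, hs, hg⟩ := hg
  obtain ⟨K, t, ht, hft⟩ := id hf
  refine ⟨K' * K, t ∩ f ⁻¹' s, inter_mem ht (hf.continuousAt hs), ?_⟩
  exact hg.comp (hft.mono inter_subset_left) fun y hy => hy.2

lemma LipschitzNear.mul {f g : E → ℝ} {x : E} (hf : LipschitzNear f x) (hg : LipschitzNear g x) :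
    LipschitzNear (fun y => f y * g y) x := by
  have h1 : LipschitzNear (fun q : ℝ × ℝ => q.1 * q.2) (f x, g x) :=
    ContDiffAt.lipschitzNear (contDiff_fst.mul contDiff_snd).contDiffAt
  have h2 : LipschitzNear (fun y => (f y, g y)) x := by
    obtain ⟨K, t, ht, h⟩ := hf
    obtain ⟨K', t', ht', h'⟩ := hg
    exact ⟨_, t ∩ t', inter_mem ht ht',
      (h.mono inter_subset_left).prodMk (h'.mono inter_subset_right)⟩
  exact LipschitzNear.comp (f := fun y => (f y, g y)) h1 h2

/-- For a point of the support and a second point near the support, compactness of the closed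
1-thickening of the support gives a Lipschitz constant. A second point outside the thickening is at
distance at least `1`, so the sup bound of `f` serves as constant. -/
lemma exists_lipschitzWith_of_lipschitzNear [NormedSpace ℝ E] [ProperSpace E] {f : E → F}
    (hf : ∀ x, LipschitzNear f x) (hcs : HasCompactSupport f) : ∃ C, LipschitzWith C f := by
  have hcont : Continuous f := continuous_iff_continuousAt.2 fun x => (hf x).continuousAt
  have hK : IsCompact (Metric.cthickening 1 (tsupport f)) := hcs.isCompact.cthickening
  have hloc : LocallyLipschitz f := fun x => hf x
  obtain ⟨K, hKf⟩ := hloc.locallyLipschitzOn.exists_lipschitzOnWith_of_compact hK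
  obtain ⟨B, hB⟩ := hcs.exists_bound_of_continuous hcont
  have hB0 : 0 ≤ B := (norm_nonneg _).trans (hB 0)
  have key : ∀ x ∈ tsupport f, ∀ y, ‖f x - f y‖ ≤ max (K : ℝ) B * ‖x - y‖ := by
    intro x hx y
    by_cases hy : y ∈ Metric.cthickening 1 (tsupport f)
    · have h1 := hKf.norm_sub_le (Metric.self_subset_cthickening _ hx) hy
      exact h1.trans (mul_le_mul_of_nonneg_right (le_max_left _ _) (norm_nonneg _))
    · have hy0 : f y = 0 := by
        by_contra h
        exact hy (Metric.self_subset_cthickening _ (subset_tsupport _ h))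
      have hd : 1 ≤ ‖x - y‖ := by
        by_contra! h
        refine hy (Metric.mem_cthickening_of_dist_le y x 1 _ hx ?_)
        rw [dist_comm, dist_eq_norm]; exact h.le
      rw [hy0, sub_zero]
      calc ‖f x‖ ≤ B * 1 := by simpa using hB x
        _ ≤ _ := mul_le_mul (le_max_right _ _) hd zero_le_one (hB0.trans (le_max_right _ _))
  refine ⟨⟨max (K : ℝ) B, hB0.trans (le_max_right _ _)⟩, LipschitzWith.of_dist_le_mul fun x y => ?_⟩
  rw [dist_eq_norm, dist_eq_norm]
  by_cases hx : x ∈ tsupport f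
  · exact key x hx y
  · by_cases hy : y ∈ tsupport f
    · rw [norm_sub_rev, norm_sub_rev x]; exact key y hy x
    · rw [image_eq_zero_of_notMem_tsupport hx, image_eq_zero_of_notMem_tsupport hy, sub_zero,
        norm_zero]
      exact mul_nonneg (hB0.trans (le_max_right _ _)) (norm_nonneg _)

end Lipschitz

/-! ### Integration by parts for Lipschitz functions and the coordinate divergence -/

section Divergence

variable {n : ℕ}

lemma integrable_fderiv_of_lipschitz {f : Euc n → ℝ} {C : NNReal} (hf : LipschitzWith C f)
    (hcs : HasCompactSupport f) (v : Euc n) : Integrable (fun w => fderiv ℝ f w v) := by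
  have hcs' : HasCompactSupport (fun w => fderiv ℝ f w v) := hcs.fderiv_apply ℝ v
  rw [← integrableOn_iff_integrable_of_support_subset (subset_tsupport _)]
  refine Measure.integrableOn_of_bounded (M := C * ‖v‖) hcs'.isCompact.measure_lt_top.ne
    (measurable_fderiv_apply_const ℝ f v).aestronglyMeasurable (Eventually.of_forall fun w => ?_)
  exact (ContinuousLinearMap.le_opNorm _ _).trans
    (mul_le_mul_of_nonneg_right (norm_fderiv_le_of_lipschitz ℝ hf) (norm_nonneg _))

lemma integral_fderiv_eq_zero_of_lipschitz {f : Euc n → ℝ} {C : NNReal} (hf : LipschitzWith C f)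
    (hcs : HasCompactSupport f) (v : Euc n) : ∫ w, fderiv ℝ f w v = 0 := by
  -- Integration by parts against the constant `1`. The formula reverses the direction when it moves
  -- the derivative to the other factor, hence `-v`.
  have h1 := LipschitzWith.integral_lineDeriv_mul_eq (μ := (volume : Measure (Euc n)))
    (LipschitzWith.const (α := Euc n) (1 : ℝ)) hf hcs (-v)
  have h2 : ∀ w, lineDeriv ℝ (fun _ : Euc n => (1 : ℝ)) w (-v) = 0 := fun w => by
    simp [lineDeriv]
  simp only [h2, zero_mul, integral_zero, neg_neg, mul_one] at h1
  rw [h1]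
  refine integral_congr_ae ?_
  filter_upwards [hf.ae_differentiableAt] with w hw
  exact hw.lineDeriv_eq_fderiv.symm

/-- Rademacher's theorem for a function which is locally Lipschitz on a set. -/
lemma ae_differentiableAt_of_lipschitzNear {f : Euc n → ℝ} {T : Set (Euc n)}
    (hf : ∀ u ∈ T, LipschitzNear f u) : ∀ᵐ u : Euc n, u ∈ T → DifferentiableAt ℝ f u := by
  rw [ae_iff]
  refine measure_null_of_locally_null _ fun u hu => ?_
  simp only [Classical.not_imp, mem_ofPred_eq] at hu
  obtain ⟨K, t, ht, hft⟩ := hf u hu.1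
  refine ⟨interior t ∩ {v | ¬(v ∈ T → DifferentiableAt ℝ f v)},
    inter_mem (mem_nhdsWithin_of_mem_nhds (interior_mem_nhds.2 ht)) self_mem_nhdsWithin, ?_⟩
  have h1 := (hft.mono interior_subset).ae_differentiableWithinAt_of_mem
    (μ := (volume : Measure (Euc n)))
  refine measure_mono_null (fun v hv => ?_) (ae_iff.1 h1)
  obtain ⟨hv1, hv2⟩ := hv
  simp only [Classical.not_imp, mem_ofPred_eq] at hv2 ⊢
  exact ⟨hv1, fun h => hv2.2 (h.differentiableAt (isOpen_interior.mem_nhds hv1))⟩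

/-- The integrand of the first variation formula for the field `U` in coordinates. -/
def localDivergence (X N U : Euc n → Euc (n + 1)) (u : Euc n) : ℝ :=
  areaFactor (fderiv ℝ X u) * (metricTrace (fderiv ℝ X u) (fderiv ℝ U u)
    - metricTrace (fderiv ℝ X u) (fderiv ℝ N u) * inner ℝ (U u) (N u))

/-- Almost everywhere the integrand is the Euclidean divergence of `√(det g)` times the tangential
part of `ρ V`. Its components are `ρ` times `C¹` functions, hence globally Lipschitz with compact
support in `T`, and the derivatives of such functions are integrable with integral zero. -/
lemma integrableOn_localDivergence {X N V : Euc n → Euc (n + 1)} {T : Set (Euc n)} (hT : IsOpen T)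
    (hX : ∀ u ∈ T, ContDiffAt ℝ 2 X u) (hinj : ∀ u ∈ T, Function.Injective (fderiv ℝ X u))
    (hN : ∀ u ∈ T, ContDiffAt ℝ 1 N u) (hN1 : ∀ u ∈ T, ‖N u‖ = 1)
    (hXN : ∀ u ∈ T, ∀ v, inner ℝ (fderiv ℝ X u v) (N u) = 0) (hV : ∀ u ∈ T, ContDiffAt ℝ 1 V u)
    {ρ : Euc n → ℝ} (hρ : ∀ u ∈ T, LipschitzNear ρ u) (hcs : HasCompactSupport ρ)
    (hsupp : tsupport ρ ⊆ T) :
    IntegrableOn (localDivergence X N (fun u => ρ u • V u)) T ∧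
      ∫ u in T, localDivergence X N (fun u => ρ u • V u) u = 0 := by
  set h : Fin n → Euc n → ℝ := fun k w =>
    areaFactor (fderiv ℝ X w) * tangPart (fderiv ℝ X w) (ρ w • V w) k with hdef
  have hh : ∀ k, h k = fun w =>
      ρ w * (areaFactor (fderiv ℝ X w) * tangPart (fderiv ℝ X w) (V w) k) := by
    intro k; ext w
    simp only [hdef, tangPart_apply, inner_smul_right, Finset.mul_sum]
    exact Finset.sum_congr rfl fun j _ => by ring
  have hsub : ∀ k, Function.support (h k) ⊆ Function.support ρ := by
    intro k w hw hw0
    exact hw (by rw [hh]; simp [hw0])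
  have hcsk : ∀ k, HasCompactSupport (h k) := fun k => hcs.mono (hsub k)
  have hlip : ∀ k, ∃ C, LipschitzWith C (h k) := by
    intro k
    refine exists_lipschitzWith_of_lipschitzNear (fun u => ?_) (hcsk k)
    by_cases hu : u ∈ T
    · rw [hh]
      have hA : ContDiffAt ℝ 1 (fderiv ℝ X) u := (hX u hu).fderiv_right le_rfl
      refine (hρ u hu).mul (ContDiffAt.lipschitzNear ?_)
      refine (contDiffAt_areaFactor hA (hinj u hu)).mul ?_
      exact (EuclideanSpace.proj k : Euc n →L[ℝ] ℝ).contDiff.contDiffAt.comp u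
        (contDiffAt_tangPart hA (hinj u hu) (hV u hu))
    · refine (lipschitzNear_const 0 u).congr ?_
      have : u ∉ tsupport (h k) := fun hu' => hu (hsupp (closure_mono (hsub k) hu'))
      exact (notMem_tsupport_iff_eventuallyEq.1 this).symm
  choose C hC using hlip
  have hint : Integrable fun w => ∑ k, fderiv ℝ (h k) w (stdVec k) :=
    integrable_finsetSum _ fun k _ => integrable_fderiv_of_lipschitz (hC k) (hcsk k) _
  have hzero : ∫ w, ∑ k, fderiv ℝ (h k) w (stdVec k) = 0 := by
    rw [integral_finsetSum _ fun k _ => integrable_fderiv_of_lipschitz (hC k) (hcsk k) _]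
    exact Finset.sum_eq_zero fun k _ => integral_fderiv_eq_zero_of_lipschitz (hC k) (hcsk k) _
  have hρd := ae_differentiableAt_of_lipschitzNear hρ
  have hae : (fun w => ∑ k, fderiv ℝ (h k) w (stdVec k)) =ᵐ[volume.restrict T]
      localDivergence X N (fun u => ρ u • V u) := by
    filter_upwards [ae_restrict_mem hT.measurableSet, ae_restrict_of_ae hρd] with u hu hd
    have hTn : T ∈ 𝓝 u := hT.mem_nhds hu
    exact sum_fderiv_areaFactor_mul_tangPart (hX u hu) (hinj u hu)
      ((hN u hu).differentiableAt one_ne_zero) (by filter_upwards [hTn] using hN1)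
      (by filter_upwards [hTn] using hXN)
      ((hd hu).smul ((hV u hu).differentiableAt one_ne_zero))
  refine ⟨(hint.integrableOn (s := T)).congr hae, ?_⟩
  rw [← integral_congr_ae hae, ← hzero]
  refine setIntegral_eq_integral_of_forall_compl_eq_zero fun w hw => ?_
  refine Finset.sum_eq_zero fun k _ => ?_
  have : w ∉ tsupport (h k) := fun hu' => hw (hsupp (closure_mono (hsub k) hu'))
  rw [(notMem_tsupport_iff_eventuallyEq.1 this).fderiv_eq]
  simp

end Divergence

/-! ### Reading maps on the manifold in charts -/

section Charts

variable {M : Type*} [TopologicalSpace M] {F : Type*} [NormedAddCommGroup F] [NormedSpace ℝ F]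

/-- The map `V` read in the preferred chart at `p`. -/
def chartRep (n : ℕ) [ChartedSpace (Euc n) M] (V : M → F) (p : M) : Euc n → F := V ∘ (chartAt (Euc n) p).symm

/-- The differential of `V` at `p`, read in the preferred chart at `p`. -/
def chartDeriv (n : ℕ) [ChartedSpace (Euc n) M] (V : M → F) (p : M) : Euc n →L[ℝ] F :=
  fderiv ℝ (chartRep n V p) (chartAt (Euc n) p p)

variable {n : ℕ} [ChartedSpace (Euc n) M]

/-- The differential at `u` of the transition from the preferred chart at `p` to the preferred
chart at the point with coordinates `u`. -/
def transDeriv (p : M) (u : Euc n) : Euc n →L[ℝ] Euc n :=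
  fderiv ℝ (chartAt (Euc n) ((chartAt (Euc n) p).symm u) ∘ (chartAt (Euc n) p).symm) u

omit [NormedAddCommGroup F] [NormedSpace ℝ F] in
lemma chartRep_chartAt (V : M → F) {p q : M} (hq : q ∈ (chartAt (Euc n) p).source) :
    chartRep n V p (chartAt (Euc n) p q) = V q := by
  simp [chartRep, (chartAt (Euc n) p).left_inv hq]

omit [NormedAddCommGroup F] [NormedSpace ℝ F] in
lemma chartRep_self (V : M → F) (p : M) : chartRep n V p (chartAt (Euc n) p p) = V p :=
  chartRep_chartAt V (mem_chart_source _ p)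

lemma chart_target_mem_nhds' (p : M) {u : Euc n} (hu : u ∈ (chartAt (Euc n) p).target) :
    (chartAt (Euc n) p).target ∈ 𝓝 u :=
  (chartAt (Euc n) p).open_target.mem_nhds hu

omit [NormedAddCommGroup F] [NormedSpace ℝ F] in
lemma chartRep_eventuallyEq (V : M → F) {p q : M} {u : Euc n}
    (hu : u ∈ (chartAt (Euc n) p).target)
    (hq : (chartAt (Euc n) p).symm u ∈ (chartAt (Euc n) q).source) :
    chartRep n V p =ᶠ[𝓝 u] fun w => chartRep n V q
      ((chartAt (Euc n) q ∘ (chartAt (Euc n) p).symm) w) := by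
  have h1 : ContinuousAt (chartAt (Euc n) p).symm u :=
    (chartAt (Euc n) p).continuousAt_symm hu
  filter_upwards [h1.preimage_mem_nhds ((chartAt (Euc n) q).open_source.mem_nhds hq)] with w hw
  exact (chartRep_chartAt V hw).symm

variable [IsManifold (𝓡 n) ∞ M]

lemma contDiffAt_chartRep {V : M → F} (hV : ContMDiff (𝓡 n) 𝓘(ℝ, F) ∞ V) {p : M} {u : Euc n}
    (hu : u ∈ (chartAt (Euc n) p).target) : ContDiffAt ℝ ∞ (chartRep n V p) u := by
  have h1 : ContMDiffAt (𝓡 n) (𝓡 n) ∞ (chartAt (Euc n) p).symm u :=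
    (contMDiffOn_chart_symm (I := 𝓡 n) (x := p)).contMDiffAt (chart_target_mem_nhds' p hu)
  exact contMDiffAt_iff_contDiffAt.1 (hV.contMDiffAt.comp u h1)

lemma contDiffAt_transition {p q : M} {u : Euc n} (hu : u ∈ (chartAt (Euc n) p).target)
    (hq : (chartAt (Euc n) p).symm u ∈ (chartAt (Euc n) q).source) :
    ContDiffAt ℝ ∞ (chartAt (Euc n) q ∘ (chartAt (Euc n) p).symm) u := by
  have h1 : ContMDiffAt (𝓡 n) (𝓡 n) ∞ (chartAt (Euc n) p).symm u :=
    (contMDiffOn_chart_symm (I := 𝓡 n) (x := p)).contMDiffAt (chart_target_mem_nhds' p hu)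
  have h2 : ContMDiffAt (𝓡 n) (𝓡 n) ∞ (chartAt (Euc n) q) ((chartAt (Euc n) p).symm u) :=
    (contMDiffOn_chart (I := 𝓡 n) (x := q)).contMDiffAt
      ((chartAt (Euc n) q).open_source.mem_nhds hq)
  exact contMDiffAt_iff_contDiffAt.1 (h2.comp u h1)

lemma fderiv_chartRep_eq_comp {V : M → F} {p q : M} {u : Euc n}
    (hu : u ∈ (chartAt (Euc n) p).target)
    (hq : (chartAt (Euc n) p).symm u ∈ (chartAt (Euc n) q).source)
    (hV : DifferentiableAt ℝ (chartRep n V q) (chartAt (Euc n) q ((chartAt (Euc n) p).symm u))) :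
    HasFDerivAt (chartRep n V p)
      (fderiv ℝ (chartRep n V q) (chartAt (Euc n) q ((chartAt (Euc n) p).symm u)) ∘L
        fderiv ℝ (chartAt (Euc n) q ∘ (chartAt (Euc n) p).symm) u) u := by
  have h1 := ((contDiffAt_transition hu hq).differentiableAt (by simp)).hasFDerivAt
  exact (HasFDerivAt.comp (f := chartAt (Euc n) q ∘ (chartAt (Euc n) p).symm) u
    hV.hasFDerivAt h1).congr_of_eventuallyEq (chartRep_eventuallyEq V hu hq)

lemma differentiableAt_chartRep_iff {V : M → F} {p q : M} {u : Euc n}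
    (hu : u ∈ (chartAt (Euc n) p).target)
    (hq : (chartAt (Euc n) p).symm u ∈ (chartAt (Euc n) q).source) :
    DifferentiableAt ℝ (chartRep n V q) (chartAt (Euc n) q ((chartAt (Euc n) p).symm u)) ↔
      DifferentiableAt ℝ (chartRep n V p) u := by
  refine ⟨fun h => (fderiv_chartRep_eq_comp hu hq h).differentiableAt, fun h => ?_⟩
  have h1 : (chartAt (Euc n) q).symm (chartAt (Euc n) q ((chartAt (Euc n) p).symm u)) =
      (chartAt (Euc n) p).symm u := (chartAt (Euc n) q).left_inv hq
  refine (fderiv_chartRep_eq_comp (q := p) ((chartAt (Euc n) q).map_source hq) ?_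
    ?_).differentiableAt
  · rw [h1]; exact (chartAt (Euc n) p).map_target hu
  · rw [h1, (chartAt (Euc n) p).right_inv hu]; exact h

/-- Applying the chain rule to the chart at `p` itself factors the identity through the differential
of the transition map. -/
lemma det_fderiv_transition_ne_zero {p q : M} {u : Euc n} (hu : u ∈ (chartAt (Euc n) p).target)
    (hq : (chartAt (Euc n) p).symm u ∈ (chartAt (Euc n) q).source) :
    (fderiv ℝ (chartAt (Euc n) q ∘ (chartAt (Euc n) p).symm) u).det ≠ 0 := by
  set z := (chartAt (Euc n) p).symm u with hz
  have h1 : (chartAt (Euc n) q).symm (chartAt (Euc n) q z) = z := (chartAt (Euc n) q).left_inv hq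
  have h2 : HasFDerivAt (chartRep n (chartAt (Euc n) p : M → Euc n) p)
      (ContinuousLinearMap.id ℝ (Euc n)) u := by
    refine (hasFDerivAt_id u).congr_of_eventuallyEq ?_
    filter_upwards [chart_target_mem_nhds' p hu] with w hw
    exact (chartAt (Euc n) p).right_inv hw
  have h3 : DifferentiableAt ℝ (chartRep n (chartAt (Euc n) p : M → Euc n) q)
      (chartAt (Euc n) q z) :=
    (differentiableAt_chartRep_iff hu hq).2 h2.differentiableAt
  have h4 := (fderiv_chartRep_eq_comp hu hq h3).unique h2
  intro h0
  have h6 : ((ContinuousLinearMap.id ℝ (Euc n) : Euc n →L[ℝ] Euc n) : Euc n →ₗ[ℝ] Euc n) =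
    LinearMap.id := rfl
  have h5 := congrArg (fun L : Euc n →L[ℝ] Euc n => LinearMap.det (L : Euc n →ₗ[ℝ] Euc n)) h4
  simp only [ContinuousLinearMap.toLinearMap_comp, LinearMap.det_comp,
    h6, LinearMap.det_id] at h5
  rw [ContinuousLinearMap.det] at h0
  rw [h0, mul_zero] at h5
  exact zero_ne_one h5

lemma det_transDeriv_ne_zero {p : M} {u : Euc n} (hu : u ∈ (chartAt (Euc n) p).target) :
    (transDeriv p u).det ≠ 0 :=
  det_fderiv_transition_ne_zero hu (mem_chart_source _ _)

/-- No regularity of `V` is needed: differentiability does not depend on the chart, and where it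
fails both sides are zero by convention. -/
lemma fderiv_chartRep (V : M → F) {p : M} {u : Euc n} (hu : u ∈ (chartAt (Euc n) p).target) :
    fderiv ℝ (chartRep n V p) u =
      chartDeriv n V ((chartAt (Euc n) p).symm u) ∘L transDeriv p u := by
  have hiff := differentiableAt_chartRep_iff (V := V) hu (mem_chart_source (Euc n) _)
  by_cases hV : DifferentiableAt ℝ (chartRep n V p) u
  · exact (fderiv_chartRep_eq_comp hu (mem_chart_source _ _) (hiff.2 hV)).fderiv
  · rw [fderiv_zero_of_not_differentiableAt hV, chartDeriv,
      fderiv_zero_of_not_differentiableAt (mt hiff.1 hV), ContinuousLinearMap.zero_comp]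

omit [IsManifold (𝓡 n) ∞ M] in
lemma mfderiv_eq_chartDeriv {V : M → F} (hV : ContMDiff (𝓡 n) 𝓘(ℝ, F) ∞ V) (p : M) :
    mfderiv (𝓡 n) 𝓘(ℝ, F) V p = chartDeriv n V p := by
  have := (hV.contMDiffAt (x := p)).mdifferentiableAt (by simp)
  refine this.mfderiv.trans ?_
  simp only [chartDeriv, chartRep, writtenInExtChartAt, extChartAt, mfld_simps, fderivWithin_univ]
  rfl

lemma differentiableAt_chartRep {V : M → F} (hV : ContMDiff (𝓡 n) 𝓘(ℝ, F) ∞ V) {p : M} {u : Euc n}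
    (hu : u ∈ (chartAt (Euc n) p).target) : DifferentiableAt ℝ (chartRep n V p) u :=
  (contDiffAt_chartRep hV hu).differentiableAt (by simp)

lemma exists_map_eq_of_det_ne_zero {T : Euc n →L[ℝ] Euc n} (hT : T.det ≠ 0) (v : Euc n) :
    ∃ w, T w = v := by
  have h1 : IsUnit (T : Euc n →ₗ[ℝ] Euc n) := by
    rw [LinearMap.isUnit_iff_isUnit_det]; exact hT.isUnit
  exact (Module.End.isUnit_iff _).1 h1 |>.2 v

lemma injective_of_det_ne_zero {T : Euc n →L[ℝ] Euc n} (hT : T.det ≠ 0) :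
    Function.Injective T := by
  have h1 : IsUnit (T : Euc n →ₗ[ℝ] Euc n) := by
    rw [LinearMap.isUnit_iff_isUnit_det]; exact hT.isUnit
  exact (Module.End.isUnit_iff _).1 h1 |>.1

end Charts

/-! ### Immersions, unit normals and mean curvature in charts -/

section Immersions

variable {n : ℕ} {M : Type*} [TopologicalSpace M] [ChartedSpace (Euc n) M]
  [IsManifold (𝓡 n) ∞ M] {X N : M → Euc (n + 1)}

omit [IsManifold (𝓡 n) ∞ M] in
lemma IsImmersedHypersurface.injective_chartDeriv (hX : IsImmersedHypersurface X) (p : M) :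
    Function.Injective (chartDeriv n X p) := by
  have := hX.injective_mfderiv p
  rwa [mfderiv_eq_chartDeriv hX.smooth p] at this

lemma IsImmersedHypersurface.injective_fderiv (hX : IsImmersedHypersurface X) {p : M} {u : Euc n}
    (hu : u ∈ (chartAt (Euc n) p).target) : Function.Injective (fderiv ℝ (chartRep n X p) u) := by
  rw [fderiv_chartRep _ hu]
  exact (hX.injective_chartDeriv _).comp (injective_of_det_ne_zero (det_transDeriv_ne_zero hu))

omit [IsManifold (𝓡 n) ∞ M] in
lemma differential_eq_chartDeriv (hX : IsImmersedHypersurface X) (p : M)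
    (v : TangentSpace (𝓡 n) p) : differential X p v = chartDeriv n X p v := by
  rw [differential, mfderiv_eq_chartDeriv hX.smooth p]
  rfl

omit [IsManifold (𝓡 n) ∞ M] in
lemma IsUnitNormal.inner_chartDeriv (hN : IsUnitNormal X N) (hX : IsImmersedHypersurface X)
    (p : M) (v : Euc n) : inner ℝ (chartDeriv n X p v) (N p) = 0 := by
  rw [← differential_eq_chartDeriv hX p v]
  exact hN.orthogonal p v

lemma IsUnitNormal.inner_fderiv (hN : IsUnitNormal X N) (hX : IsImmersedHypersurface X)
    {p : M} {u : Euc n} (hu : u ∈ (chartAt (Euc n) p).target) (v : Euc n) :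
    inner ℝ (fderiv ℝ (chartRep n X p) u v) (chartRep n N p u) = 0 := by
  rw [fderiv_chartRep _ hu]
  exact hN.inner_chartDeriv hX _ _

lemma areaFactor_fderiv_chartRep (Y : M → Euc (n + 1)) {p : M} {u : Euc n}
    (hu : u ∈ (chartAt (Euc n) p).target) :
    areaFactor (fderiv ℝ (chartRep n Y p) u) =
      |(transDeriv p u).det| * areaFactor (chartDeriv n Y ((chartAt (Euc n) p).symm u)) := by
  rw [fderiv_chartRep _ hu, areaFactor_comp]

lemma metricTrace_fderiv_chartRep (X V : M → Euc (n + 1)) {p : M} {u : Euc n}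
    (hu : u ∈ (chartAt (Euc n) p).target) :
    metricTrace (fderiv ℝ (chartRep n X p) u) (fderiv ℝ (chartRep n V p) u) =
      metricTrace (chartDeriv n X ((chartAt (Euc n) p).symm u))
        (chartDeriv n V ((chartAt (Euc n) p).symm u)) := by
  rw [fderiv_chartRep _ hu, fderiv_chartRep _ hu, metricTrace_comp _ _ (det_transDeriv_ne_zero hu)]

/-- The mean curvature is minus the divergence of the unit normal. -/
lemma meanCurvature_eq (hX : IsImmersedHypersurface X) (hN : IsUnitNormal X N) (p : M) :
    meanCurvature X N p = -metricTrace (chartDeriv n X p) (chartDeriv n N p) := by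
  set u := chartAt (Euc n) p p with hu
  have hut : u ∈ (chartAt (Euc n) p).target := mem_chart_target _ p
  have hA : DifferentiableAt ℝ (fderiv ℝ (chartRep n X p)) u :=
    ((contDiffAt_chartRep hX.smooth hut).fderiv_right (m := 1) (by norm_cast)).differentiableAt
      one_ne_zero
  have hNd := differentiableAt_chartRep hN.smooth hut
  have key : ∀ i j : Fin n,
      inner ℝ (fderiv ℝ (coordVector X p j) u (stdVec i)) (N p) =
        -inner ℝ (chartDeriv n X p (stdVec j)) (chartDeriv n N p (stdVec i)) := by
    intro i j
    have h1 : DifferentiableAt ℝ (coordVector X p j) u := hA.clm_apply (differentiableAt_const _)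
    -- Differentiating `⟨∂ⱼX, N⟩ = 0` in the direction `i` expresses the second fundamental form
    -- through `dN`.
    have h2 : (fun w => inner ℝ (coordVector X p j w) (chartRep n N p w)) =ᶠ[𝓝 u] fun _ => (0 : ℝ) := by
      filter_upwards [chart_target_mem_nhds' p hut] with w hw
      exact hN.inner_fderiv hX hw _
    have h3 := (h1.hasFDerivAt.inner ℝ hNd.hasFDerivAt).fderiv
    rw [h2.fderiv_eq] at h3
    have h4 := congrArg (fun L : Euc n →L[ℝ] ℝ => L (stdVec i)) h3
    simp [fderivInnerCLM_apply] at h4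
    rw [hu, chartRep_self, ← hu] at h4
    change 0 = inner ℝ (chartDeriv n X p (stdVec j)) (chartDeriv n N p (stdVec i)) + _ at h4
    linarith
  simp only [meanCurvature, metricTrace]
  rw [← Finset.sum_neg_distrib, Finset.sum_comm]
  refine Finset.sum_congr rfl fun i _ => ?_
  rw [← Finset.sum_neg_distrib]
  refine Finset.sum_congr rfl fun j _ => ?_
  rw [← hu, key, gramInv_symm]
  change gramInv (chartDeriv n X p) j i * _ = _
  ring

end Immersions

/-! ### The area element in charts -/

section Area

variable {n : ℕ} {M : Type*} [TopologicalSpace M] [ChartedSpace (Euc n) M]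
  [MeasurableSpace M] [BorelSpace M]

/-- The coordinate density of the area element, as an extended nonnegative number. -/
def areaDensity (X : M → Euc (n + 1)) (p : M) (u : Euc n) : ℝ≥0∞ :=
  ENNReal.ofReal (areaFactor (fderiv ℝ (chartRep n X p) u))

lemma continuous_areaFactor {F : Type*} [NormedAddCommGroup F] [InnerProductSpace ℝ F] :
    Continuous (areaFactor : (Euc n →L[ℝ] F) → ℝ) := by
  refine Real.continuous_sqrt.comp (continuous_iff_continuousAt.2 fun A => ?_)
  exact (ContDiffAt.matrix_det (k := 0)
    (contDiffAt_crossGram contDiffAt_id contDiffAt_id)).continuousAt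

omit [MeasurableSpace M] [BorelSpace M] in
lemma measurable_areaDensity (X : M → Euc (n + 1)) (p : M) : Measurable (areaDensity X p) :=
  (continuous_areaFactor.measurable.comp (measurable_fderiv ℝ _)).ennreal_ofReal

lemma measurableEmbedding_chart_symm (p : M) :
    MeasurableEmbedding ((chartAt (Euc n) p).target.domRestrict (chartAt (Euc n) p).symm) :=
  (chartAt (Euc n) p).symm.isOpenEmbedding_restrict.measurableEmbedding

lemma measurableSet_target_inter_preimage (p : M) {s : Set M} (hs : MeasurableSet s) :
    MeasurableSet ((chartAt (Euc n) p).target ∩ (chartAt (Euc n) p).symm ⁻¹' s) := by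
  have h2 := (MeasurableEmbedding.subtype_coe
    (chartAt (Euc n) p).open_target.measurableSet).measurableSet_image.2
      ((measurableEmbedding_chart_symm (n := n) p).measurable hs)
  convert h2 using 1
  ext u
  simp [Set.domRestrict, and_comm]

/-- The area element read in the preferred chart, as a measure on the chart target. -/
def targetArea (X : M → Euc (n + 1)) (p : M) : Measure (chartAt (Euc n) p).target :=
  Measure.comap Subtype.val (volume.withDensity (areaDensity X p))

omit [MeasurableSpace M] [BorelSpace M] in
lemma map_targetArea (X : M → Euc (n + 1)) (p : M) :
    (targetArea X p).map Subtype.val =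
      (volume.restrict (chartAt (Euc n) p).target).withDensity (areaDensity X p) := by
  rw [targetArea, map_comap_subtype_coe (chartAt (Euc n) p).open_target.measurableSet,
    restrict_withDensity (chartAt (Euc n) p).open_target.measurableSet]

/-- The inverse chart behaves well only on its target, where it is an open embedding. Factoring
through the subtype makes it a measurable embedding, so the integral formulas that follow hold for
arbitrary integrands. -/
lemma chartArea_eq_map (X : M → Euc (n + 1)) (p : M) :
    chartArea X p = (targetArea X p).map
      ((chartAt (Euc n) p).target.domRestrict (chartAt (Euc n) p).symm) := by
  change Measure.map _ ((volume.restrict (chartAt (Euc n) p).target).withDensity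
    (areaDensity X p)) = _
  have hT := (chartAt (Euc n) p).open_target.measurableSet
  rw [← map_targetArea, AEMeasurable.map_map_of_aemeasurable _ measurable_subtype_coe.aemeasurable]
  · rfl
  · rw [map_targetArea]
    exact ((chartAt (Euc n) p).continuousOn_symm.aemeasurable hT).mono_ac
      (withDensity_absolutelyContinuous _ _)

lemma lintegral_chartArea (X : M → Euc (n + 1)) (p : M) (f : M → ℝ≥0∞) :
    ∫⁻ x, f x ∂(chartArea X p) = ∫⁻ u in (chartAt (Euc n) p).target,
      areaDensity X p u * f ((chartAt (Euc n) p).symm u) := by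
  have hT := (chartAt (Euc n) p).open_target.measurableSet
  rw [chartArea_eq_map, (measurableEmbedding_chart_symm p).lintegral_map]
  refine ((MeasurableEmbedding.subtype_coe hT).lintegral_map (μ := targetArea X p)
    (fun w => f ((chartAt (Euc n) p).symm w))).symm.trans ?_
  rw [map_targetArea,
    lintegral_withDensity_eq_lintegral_mul_non_measurable _ (measurable_areaDensity X p)
      (Eventually.of_forall fun u => ENNReal.ofReal_lt_top)]
  rfl

lemma chartArea_apply (X : M → Euc (n + 1)) (p : M) {s : Set M} (hs : MeasurableSet s) :
    chartArea X p s = ∫⁻ u in (chartAt (Euc n) p).target ∩ (chartAt (Euc n) p).symm ⁻¹' s,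
      areaDensity X p u := by
  have hT := (chartAt (Euc n) p).open_target.measurableSet
  have hA := measurableSet_target_inter_preimage (n := n) p hs
  rw [← lintegral_indicator_one hs, lintegral_chartArea, ← lintegral_indicator hT,
    ← lintegral_indicator hA]
  congr 1
  ext u
  by_cases h1 : u ∈ (chartAt (Euc n) p).target <;>
  by_cases h2 : (chartAt (Euc n) p).symm u ∈ s <;> simp [Set.indicator, h1, h2]

lemma chartArea_compl_source (X : M → Euc (n + 1)) (p : M) :
    chartArea X p (chartAt (Euc n) p).sourceᶜ = 0 := by
  rw [chartArea_apply X p (chartAt (Euc n) p).open_source.measurableSet.compl]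
  have : (chartAt (Euc n) p).target ∩ (chartAt (Euc n) p).symm ⁻¹'
      (chartAt (Euc n) p).sourceᶜ = ∅ := by
    ext u
    simp only [mem_inter_iff, mem_preimage, mem_compl_iff, mem_empty_iff_false, iff_false,
      not_and, not_not]
    exact (chartAt (Euc n) p).map_target
  rw [this]; simp

lemma chartArea_inter_source (X : M → Euc (n + 1)) (p : M) (s : Set M) :
    chartArea X p (s ∩ (chartAt (Euc n) p).source) = chartArea X p s :=
  measure_inter_conull (chartArea_compl_source X p)

variable [IsManifold (𝓡 n) ∞ M] {X : M → Euc (n + 1)}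

/-- The area elements of two charts agree on the overlap. -/
lemma chartArea_eq_of_subset (hX : ContMDiff (𝓡 n) 𝓘(ℝ, Euc (n + 1)) ∞ X) {p q : M} {s : Set M}
    (hs : MeasurableSet s) (hp : s ⊆ (chartAt (Euc n) p).source)
    (hq : s ⊆ (chartAt (Euc n) q).source) : chartArea X p s = chartArea X q s := by
  rw [chartArea_apply X p hs, chartArea_apply X q hs]
  set τ : Euc n → Euc n := chartAt (Euc n) q ∘ (chartAt (Euc n) p).symm with hτ
  set A := (chartAt (Euc n) p).target ∩ (chartAt (Euc n) p).symm ⁻¹' s with hA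
  have hAm : MeasurableSet A := measurableSet_target_inter_preimage p hs
  have himage : (chartAt (Euc n) q).target ∩ (chartAt (Euc n) q).symm ⁻¹' s = τ '' A := by
    ext w
    constructor
    · rintro ⟨hw, hws⟩
      refine ⟨chartAt (Euc n) p ((chartAt (Euc n) q).symm w),
        ⟨(chartAt (Euc n) p).map_source (hp hws), ?_⟩, ?_⟩
      · simpa [(chartAt (Euc n) p).left_inv (hp hws)] using hws
      · simp [hτ, (chartAt (Euc n) p).left_inv (hp hws), (chartAt (Euc n) q).right_inv hw]
    · rintro ⟨u, ⟨hu, hus⟩, rfl⟩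
      refine ⟨(chartAt (Euc n) q).map_source (hq hus), ?_⟩
      simpa [hτ, (chartAt (Euc n) q).left_inv (hq hus)] using hus
  have hinj : InjOn τ A := by
    intro u hu w hw h
    have h1 := (chartAt (Euc n) q).injOn (hq hu.2) (hq hw.2) h
    exact (chartAt (Euc n) p).symm.injOn hu.1 hw.1 h1
  have hder : ∀ u ∈ A, HasFDerivWithinAt τ (fderiv ℝ τ u) A u := fun u hu =>
    ((contDiffAt_transition hu.1 (hq hu.2)).differentiableAt (by simp)).hasFDerivAt.hasFDerivWithinAt
  rw [himage, lintegral_image_eq_lintegral_abs_det_fderiv_mul _ hAm hder hinj]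
  refine setLIntegral_congr_fun hAm fun u hu => ?_
  have hτu : τ u ∈ (chartAt (Euc n) q).target := (chartAt (Euc n) q).map_source (hq hu.2)
  have h1 := (fderiv_chartRep_eq_comp (V := X) hu.1 (hq hu.2)
    (differentiableAt_chartRep hX hτu)).fderiv
  simp only [areaDensity]
  rw [h1, areaFactor_comp, ENNReal.ofReal_mul (abs_nonneg _)]
  rfl

omit [MeasurableSpace M] [BorelSpace M] [IsManifold (𝓡 n) ∞ M] in
lemma exists_seq_chart_cover (n : ℕ) [ChartedSpace (Euc n) M] [SecondCountableTopology M]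
    [Nonempty M] :
    ∃ f : ℕ → M, ⋃ k, (chartAt (Euc n) (f k)).source = univ := by
  obtain ⟨c, hc, hcu⟩ := TopologicalSpace.countable_cover_nhds
    (fun x : M => (chartAt (Euc n) x).open_source.mem_nhds (mem_chart_source (Euc n) x))
  have hne : c.Nonempty := by
    by_contra h
    rw [not_nonempty_iff_eq_empty] at h
    simp [h] at hcu
    exact (univ_nonempty (α := M)).ne_empty hcu.symm
  obtain ⟨f, rfl⟩ := hc.exists_eq_range hne
  exact ⟨f, by simpa using hcu⟩

variable [SecondCountableTopology M] [Nonempty M]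

omit [IsManifold (𝓡 n) ∞ M] in
/-- Two measures which agree on the measurable subsets of all chart domains are equal. -/
lemma measure_ext_of_charts (n : ℕ) [ChartedSpace (Euc n) M] {μ ν : Measure M}
    (h : ∀ (p : M) (s : Set M), MeasurableSet s → s ⊆ (chartAt (Euc n) p).source → μ s = ν s) :
    μ = ν := by
  obtain ⟨f, hf⟩ := exists_seq_chart_cover (M := M) n
  set D := disjointed fun k => (chartAt (Euc n) (f k)).source with hD
  have hDm : ∀ k, MeasurableSet (D k) :=
    MeasurableSet.disjointed fun k => (chartAt (Euc n) (f k)).open_source.measurableSet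
  have hDU : ⋃ k, D k = univ := by rw [hD, iUnion_disjointed, hf]
  have hDd : Pairwise fun i j => Disjoint (D i) (D j) := disjoint_disjointed _
  ext s hs
  have hsu : s = ⋃ k, s ∩ D k := by rw [← inter_iUnion, hDU, inter_univ]
  have hd : Pairwise fun i j => Disjoint (s ∩ D i) (s ∩ D j) := fun i j hij =>
    (hDd hij).mono inter_subset_right inter_subset_right
  rw [hsu, measure_iUnion hd fun k => hs.inter (hDm k),
    measure_iUnion hd fun k => hs.inter (hDm k)]
  congr 1
  ext k
  exact h (f k) _ (hs.inter (hDm k)) (inter_subset_right.trans (disjointed_subset _ _))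

/-- Glue the chart measures along a countable disjoint partition subordinate to the charts.
Agreement on overlaps shows that the glued measure restricts to every chart measure, so it is an
upper bound of them all and dominates the supremum `area X`. The reverse inequality is that a
supremum dominates each member. -/
lemma area_apply_of_subset (hX : ContMDiff (𝓡 n) 𝓘(ℝ, Euc (n + 1)) ∞ X) {p : M} {s : Set M}
    (hs : MeasurableSet s) (hp : s ⊆ (chartAt (Euc n) p).source) :
    area X s = chartArea X p s := by
  obtain ⟨f, hf⟩ := exists_seq_chart_cover (M := M) n
  set D := disjointed fun k => (chartAt (Euc n) (f k)).source with hD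
  have hDm : ∀ k, MeasurableSet (D k) :=
    MeasurableSet.disjointed fun k => (chartAt (Euc n) (f k)).open_source.measurableSet
  have hDU : ⋃ k, D k = univ := by rw [hD, iUnion_disjointed, hf]
  have hDd : Pairwise fun i j => Disjoint (D i) (D j) := disjoint_disjointed _
  set ν : Measure M := Measure.sum fun k => (chartArea X (f k)).restrict (D k) with hν
  have hνs : ∀ (q : M) (s : Set M), MeasurableSet s → s ⊆ (chartAt (Euc n) q).source →
      ν s = chartArea X q s := by
    intro q s hs hq
    have hsu : s = ⋃ k, s ∩ D k := by rw [← inter_iUnion, hDU, inter_univ]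
    have hd : Pairwise fun i j => Disjoint (s ∩ D i) (s ∩ D j) := fun i j hij =>
      (hDd hij).mono inter_subset_right inter_subset_right
    rw [hν, Measure.sum_apply _ hs]
    conv_rhs => rw [hsu, measure_iUnion hd fun k => hs.inter (hDm k)]
    congr 1
    ext k
    rw [Measure.restrict_apply hs]
    exact chartArea_eq_of_subset hX (hs.inter (hDm k))
      (inter_subset_right.trans (disjointed_subset _ _)) (inter_subset_left.trans hq)
  have hle : area X ≤ ν := by
    refine iSup_le fun q => Measure.le_iff.2 fun t ht => ?_
    rw [← chartArea_inter_source, ← hνs q _ (ht.inter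
      (chartAt (Euc n) q).open_source.measurableSet) inter_subset_right]
    exact measure_mono inter_subset_left
  refine le_antisymm ((hle s).trans_eq (hνs p s hs hp)) ?_
  exact (le_iSup (fun q => chartArea X q) p : chartArea X p ≤ area X) s

lemma area_restrict_source (hX : ContMDiff (𝓡 n) 𝓘(ℝ, Euc (n + 1)) ∞ X) (p : M) :
    (area X).restrict (chartAt (Euc n) p).source = chartArea X p := by
  ext s hs
  rw [Measure.restrict_apply hs, area_apply_of_subset hX
    (hs.inter (chartAt (Euc n) p).open_source.measurableSet) inter_subset_right,
    chartArea_inter_source]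

lemma setIntegral_source (hX : ContMDiff (𝓡 n) 𝓘(ℝ, Euc (n + 1)) ∞ X) (p : M) (f : M → ℝ) :
    ∫ x in (chartAt (Euc n) p).source, f x ∂(area X) = ∫ u in (chartAt (Euc n) p).target,
      areaFactor (fderiv ℝ (chartRep n X p) u) * f ((chartAt (Euc n) p).symm u) := by
  have hT := (chartAt (Euc n) p).open_target.measurableSet
  rw [area_restrict_source hX, chartArea_eq_map, (measurableEmbedding_chart_symm p).integral_map]
  refine ((MeasurableEmbedding.subtype_coe hT).integral_map (μ := targetArea X p)
    (fun w => f ((chartAt (Euc n) p).symm w))).symm.trans ?_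
  rw [map_targetArea,
    integral_withDensity_eq_integral_toReal_smul (measurable_areaDensity X p)
      (Eventually.of_forall fun u => ENNReal.ofReal_lt_top)]
  simp only [areaDensity, ENNReal.toReal_ofReal (Real.sqrt_nonneg _), areaFactor, smul_eq_mul]

lemma integrableOn_source_iff (hX : ContMDiff (𝓡 n) 𝓘(ℝ, Euc (n + 1)) ∞ X) (p : M) (f : M → ℝ) :
    IntegrableOn f (chartAt (Euc n) p).source (area X) ↔
      IntegrableOn (fun u => areaFactor (fderiv ℝ (chartRep n X p) u) *
        f ((chartAt (Euc n) p).symm u)) (chartAt (Euc n) p).target := by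
  have hT := (chartAt (Euc n) p).open_target.measurableSet
  rw [IntegrableOn, area_restrict_source hX, chartArea_eq_map,
    (measurableEmbedding_chart_symm p).integrable_map_iff]
  change Integrable ((fun w => f ((chartAt (Euc n) p).symm w)) ∘ Subtype.val) _ ↔ _
  rw [← (MeasurableEmbedding.subtype_coe hT).integrable_map_iff, map_targetArea,
    integrable_withDensity_iff_integrable_smul' (measurable_areaDensity X p)
      (Eventually.of_forall fun u => ENNReal.ofReal_lt_top)]
  simp only [areaDensity, ENNReal.toReal_ofReal (Real.sqrt_nonneg _), areaFactor, smul_eq_mul]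
  rfl

lemma ae_area_of_charts (hX : ContMDiff (𝓡 n) 𝓘(ℝ, Euc (n + 1)) ∞ X) {P : M → Prop}
    (h : ∀ p : M, ∀ᵐ u ∂(volume.restrict (chartAt (Euc n) p).target),
      P ((chartAt (Euc n) p).symm u)) : ∀ᵐ x ∂(area X), P x := by
  obtain ⟨f, hf⟩ := exists_seq_chart_cover (M := M) n
  have hloc : ∀ p : M, ∀ᵐ x ∂((area X).restrict (chartAt (Euc n) p).source), P x := by
    intro p
    have hT := (chartAt (Euc n) p).open_target.measurableSet
    rw [area_restrict_source hX, chartArea_eq_map, (measurableEmbedding_chart_symm p).ae_map_iff]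
    refine ((MeasurableEmbedding.subtype_coe hT).ae_map_iff (μ := targetArea X p)
      (p := fun w => P ((chartAt (Euc n) p).symm w))).1 ?_
    rw [map_targetArea]
    exact (withDensity_absolutelyContinuous _ _).ae_le (h p)
  have := (ae_restrict_iUnion_iff (μ := area X)
    (fun k => (chartAt (Euc n) (f k)).source) P).2 fun k => hloc (f k)
  rwa [hf, Measure.restrict_univ] at this

omit [SecondCountableTopology M] [Nonempty M] in
/-- The area element of an immersion charges nonempty open sets. -/
lemma area_pos_of_isOpen (hX : IsImmersedHypersurface X) {U : Set M} (hU : IsOpen U)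
    (hne : U.Nonempty) : area X U ≠ 0 := by
  obtain ⟨p, hp⟩ := hne
  have h1 : chartArea X p U ≤ area X U :=
    (le_iSup (fun q => chartArea X q) p : chartArea X p ≤ area X) U
  refine ((lt_of_lt_of_le ?_ h1).ne' :)
  rw [chartArea_apply X p hU.measurableSet, setLIntegral_pos_iff (measurable_areaDensity X p)]
  have hopen : IsOpen ((chartAt (Euc n) p).target ∩ (chartAt (Euc n) p).symm ⁻¹' U) :=
    (chartAt (Euc n) p).continuousOn_symm.isOpen_inter_preimage (chartAt (Euc n) p).open_target hU
  have hsub : (chartAt (Euc n) p).target ∩ (chartAt (Euc n) p).symm ⁻¹' U ⊆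
      Function.support (areaDensity X p) := by
    intro u hu
    exact (ENNReal.ofReal_pos.2 (areaFactor_pos (hX.injective_fderiv hu.1))).ne'
  rw [inter_eq_right.2 hsub]
  refine hopen.measure_pos _ ⟨chartAt (Euc n) p p, mem_chart_target _ p, ?_⟩
  simpa using hp

/-- The ratio of the area elements of two immersions. -/
def areaRatio (X Y : M → Euc (n + 1)) (p : M) : ℝ :=
  areaFactor (chartDeriv n Y p) / areaFactor (chartDeriv n X p)

omit [MeasurableSpace M] [BorelSpace M] [SecondCountableTopology M] [Nonempty M] in
lemma areaRatio_symm (X Y : M → Euc (n + 1)) {p : M} {u : Euc n} (hu : u ∈ (chartAt (Euc n) p).target) :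
    areaRatio X Y ((chartAt (Euc n) p).symm u) =
      areaFactor (fderiv ℝ (chartRep n Y p) u) / areaFactor (fderiv ℝ (chartRep n X p) u) := by
  have h := abs_ne_zero.2 (det_transDeriv_ne_zero hu)
  rw [areaFactor_fderiv_chartRep _ hu, areaFactor_fderiv_chartRep _ hu,
    mul_div_mul_left _ _ h]
  rfl

omit [MeasurableSpace M] [BorelSpace M] [IsManifold (𝓡 n) ∞ M] [SecondCountableTopology M]
  [Nonempty M] in
lemma areaRatio_nonneg (X Y : M → Euc (n + 1)) (p : M) : 0 ≤ areaRatio X Y p :=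
  div_nonneg (Real.sqrt_nonneg _) (Real.sqrt_nonneg _)

omit [MeasurableSpace M] [BorelSpace M] [SecondCountableTopology M] [Nonempty M]
  [IsManifold (𝓡 n) ∞ M] in
/-- A function on the manifold is continuous if it is so in all charts. -/
lemma continuous_of_charts (n : ℕ) [ChartedSpace (Euc n) M] {G : Type*} [TopologicalSpace G]
    {f : M → G} (h : ∀ p : M, ∃ g : Euc n → G, ContinuousAt g (chartAt (Euc n) p p) ∧
      ∀ u ∈ (chartAt (Euc n) p).target, f ((chartAt (Euc n) p).symm u) = g u) :
    Continuous f := by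
  refine continuous_iff_continuousAt.2 fun p => ?_
  obtain ⟨g, hg, hfg⟩ := h p
  have h1 : ContinuousAt (fun x => g (chartAt (Euc n) p x)) p :=
    ContinuousAt.comp (f := chartAt (Euc n) p) hg
      ((chartAt (Euc n) p).continuousAt (mem_chart_source _ p))
  refine h1.congr ?_
  filter_upwards [(chartAt (Euc n) p).open_source.mem_nhds (mem_chart_source _ p)] with x hx
  rw [← hfg _ ((chartAt (Euc n) p).map_source hx), (chartAt (Euc n) p).left_inv hx]

omit [MeasurableSpace M] [BorelSpace M] [SecondCountableTopology M] [Nonempty M] in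
lemma contDiffAt_fderiv_chartRep {F : Type*} [NormedAddCommGroup F] [NormedSpace ℝ F] {V : M → F}
    (hV : ContMDiff (𝓡 n) 𝓘(ℝ, F) ∞ V) {p : M} {u : Euc n}
    (hu : u ∈ (chartAt (Euc n) p).target) :
    ContDiffAt ℝ ∞ (fderiv ℝ (chartRep n V p)) u :=
  (contDiffAt_chartRep hV hu).fderiv_right (by norm_cast)

omit [MeasurableSpace M] [BorelSpace M] [SecondCountableTopology M] [Nonempty M] in
lemma continuous_areaRatio {Y : M → Euc (n + 1)} (hX : IsImmersedHypersurface X)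
    (hY : IsImmersedHypersurface Y) : Continuous (areaRatio X Y) := by
  refine continuous_of_charts n fun p => ⟨_, ?_, fun u hu => areaRatio_symm X Y hu⟩
  have hu := mem_chart_target (Euc n) p
  refine ContinuousAt.div ?_ ?_ (areaFactor_pos (hX.injective_fderiv hu)).ne'
  · exact continuous_areaFactor.continuousAt.comp (contDiffAt_fderiv_chartRep hY.smooth hu).continuousAt
  · exact continuous_areaFactor.continuousAt.comp (contDiffAt_fderiv_chartRep hX.smooth hu).continuousAt

omit [MeasurableSpace M] [BorelSpace M] [SecondCountableTopology M] [Nonempty M] in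
lemma continuous_metricTrace {V : M → Euc (n + 1)} (hX : IsImmersedHypersurface X)
    (hV : ContMDiff (𝓡 n) 𝓘(ℝ, Euc (n + 1)) ∞ V) :
    Continuous fun p => metricTrace (chartDeriv n X p) (chartDeriv n V p) := by
  refine continuous_of_charts n fun p => ⟨_, ?_, fun u hu =>
    (metricTrace_fderiv_chartRep X V hu).symm⟩
  have hu := mem_chart_target (Euc n) p
  exact (contDiffAt_metricTrace (contDiffAt_fderiv_chartRep hX.smooth hu) (hX.injective_fderiv hu)
    (contDiffAt_fderiv_chartRep hV hu)).continuousAt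

/-- Replaces the moving area element by a density against a single measure, so that the weighted
area can be differentiated under the integral sign. -/
lemma area_eq_withDensity {Y : M → Euc (n + 1)} (hX : IsImmersedHypersurface X)
    (hY : IsImmersedHypersurface Y) :
    area Y = (area X).withDensity fun p => ENNReal.ofReal (areaRatio X Y p) := by
  refine measure_ext_of_charts n fun p s hs hp => ?_
  have hT := (chartAt (Euc n) p).open_target.measurableSet
  rw [area_apply_of_subset hY.smooth hs hp, withDensity_apply _ hs,
    ← inter_eq_left.2 hp, ← Measure.restrict_restrict hs, area_restrict_source hX.smooth,
    inter_eq_left.2 hp,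
    ← lintegral_indicator_one hs, ← lintegral_indicator hs, lintegral_chartArea,
    lintegral_chartArea]
  refine setLIntegral_congr_fun hT fun u hu => ?_
  by_cases h : (chartAt (Euc n) p).symm u ∈ s
  · have hpos := areaFactor_pos (hX.injective_fderiv hu)
    simp only [indicator_of_mem h, Pi.one_apply, mul_one, areaDensity, areaRatio_symm X Y hu]
    rw [← ENNReal.ofReal_mul hpos.le, mul_div_cancel₀ _ hpos.ne']
  · simp [h]

lemma integral_area {Y : M → Euc (n + 1)} (hX : IsImmersedHypersurface X)
    (hY : IsImmersedHypersurface Y) (f : M → ℝ) :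
    ∫ p, f p ∂(area Y) = ∫ p, areaRatio X Y p * f p ∂(area X) := by
  rw [area_eq_withDensity hX hY, integral_withDensity_eq_integral_toReal_smul
    (continuous_areaRatio hX hY).measurable.ennreal_ofReal
    (Eventually.of_forall fun u => ENNReal.ofReal_lt_top)]
  simp only [ENNReal.toReal_ofReal (areaRatio_nonneg X Y _), smul_eq_mul]

end Area

/-! ### The divergence theorem on the hypersurface -/

section DivergenceTheorem

variable {n : ℕ} {M : Type*} [TopologicalSpace M] [ChartedSpace (Euc n) M]
  {X N : M → Euc (n + 1)}

/-- The integrand `div V + H ⟨V, N⟩` of the first variation formula. -/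
def normalDivergence (X N V : M → Euc (n + 1)) (p : M) : ℝ :=
  metricTrace (chartDeriv n X p) (chartDeriv n V p)
    - metricTrace (chartDeriv n X p) (chartDeriv n N p) * inner ℝ (V p) (N p)

/-- `ρ` is locally Lipschitz in all charts. -/
def LocallyLipschitzInCharts (n : ℕ) [ChartedSpace (Euc n) M] (ρ : M → ℝ) : Prop :=
  ∀ (p : M), ∀ u ∈ (chartAt (Euc n) p).target, LipschitzNear (chartRep n ρ p) u

lemma chartRep_eventuallyEq_of_eventuallyEq {F : Type*} {V W : M → F} {p : M}
    (h : V =ᶠ[𝓝 p] W) :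
    chartRep n V p =ᶠ[𝓝 (chartAt (Euc n) p p)] chartRep n W p := by
  have h1 : ContinuousAt (chartAt (Euc n) p).symm (chartAt (Euc n) p p) :=
    (chartAt (Euc n) p).continuousAt_symm (mem_chart_target _ p)
  have h2 : Tendsto (chartAt (Euc n) p).symm (𝓝 (chartAt (Euc n) p p)) (𝓝 p) := by
    have := h1.tendsto
    rwa [(chartAt (Euc n) p).left_inv (mem_chart_source _ p)] at this
  exact h2.eventually h

lemma chartDeriv_congr {F : Type*} [NormedAddCommGroup F] [NormedSpace ℝ F] {V W : M → F} {p : M}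
    (h : V =ᶠ[𝓝 p] W) : chartDeriv n V p = chartDeriv n W p :=
  (chartRep_eventuallyEq_of_eventuallyEq h).fderiv_eq

lemma chartDeriv_zero_of_notMem_tsupport {F : Type*} [NormedAddCommGroup F] [NormedSpace ℝ F]
    {V : M → F} {p : M} (h : p ∉ tsupport V) : chartDeriv n V p = 0 := by
  rw [chartDeriv_congr (notMem_tsupport_iff_eventuallyEq.1 h)]
  exact fderiv_const_apply 0

/-- Leibniz rule: the curvature term contains no derivative of the field, so the only correction is
the derivative of `ρ` along the tangential part of `V`. -/
lemma normalDivergence_smul {ρ : M → ℝ} {V : M → Euc (n + 1)} {p : M}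
    (hρ : DifferentiableAt ℝ (chartRep n ρ p) (chartAt (Euc n) p p))
    (hV : DifferentiableAt ℝ (chartRep n V p) (chartAt (Euc n) p p)) :
    normalDivergence X N (fun x => ρ x • V x) p = ρ p * normalDivergence X N V p +
      metricTrace (chartDeriv n X p) ((chartDeriv n ρ p).smulRight (V p)) := by
  have h1 : chartDeriv n (fun x => ρ x • V x) p =
      ρ p • chartDeriv n V p + (chartDeriv n ρ p).smulRight (V p) := by
    have := (hρ.hasFDerivAt.smul hV.hasFDerivAt).fderiv
    rw [chartRep_self, chartRep_self] at this
    exact this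
  simp only [normalDivergence, h1, metricTrace_add, metricTrace_smul, inner_smul_left]
  simp
  ring

variable [IsManifold (𝓡 n) ∞ M] [MeasurableSpace M] [BorelSpace M] [SecondCountableTopology M]
  [Nonempty M] [T2Space M]

omit [T2Space M] in
lemma integral_normalDivergence_of_subset_source (hX : IsImmersedHypersurface X)
    (hN : IsUnitNormal X N) {V : M → Euc (n + 1)}
    (hV : ContMDiff (𝓡 n) 𝓘(ℝ, Euc (n + 1)) ∞ V) {ρ : M → ℝ}
    (hρ : LocallyLipschitzInCharts n ρ) (hcs : HasCompactSupport ρ) {p : M}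
    (hp : tsupport ρ ⊆ (chartAt (Euc n) p).source) :
    Integrable (normalDivergence X N fun x => ρ x • V x) (area X) ∧
      ∫ x, normalDivergence X N (fun x => ρ x • V x) x ∂(area X) = 0 := by
  set e := chartAt (Euc n) p with he
  have hzero : ∀ x ∉ e.source, normalDivergence X N (fun x => ρ x • V x) x = 0 := by
    intro x hx
    have hx' : x ∉ tsupport ρ := fun h => hx (hp h)
    have h1 : x ∉ tsupport fun x => ρ x • V x := fun h => hx' (tsupport_smul_subset_left ρ V h)
    have h2 : ρ x = 0 := image_eq_zero_of_notMem_tsupport hx'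
    simp [normalDivergence, chartDeriv_zero_of_notMem_tsupport h1, h2, metricTrace]
  -- The coordinate expression of `ρ` is meaningless off the chart target, so it is replaced by its
  -- extension by zero, which has compact support.
  set r : Euc n → ℝ := e.target.indicator (chartRep n ρ p) with hr
  have hr_eq : ∀ u ∈ e.target, r =ᶠ[𝓝 u] chartRep n ρ p := fun u hu => by
    filter_upwards [chart_target_mem_nhds' p hu] with w hw
    exact indicator_of_mem hw _
  have hcomp : IsCompact (e '' tsupport ρ) :=
    hcs.isCompact.image_of_continuousOn (e.continuousOn.mono hp)
  have hsub : Function.support r ⊆ e '' tsupport ρ := by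
    intro u hu
    have hut : u ∈ e.target := by
      by_contra h
      exact hu (indicator_of_notMem h _)
    refine ⟨e.symm u, subset_tsupport _ ?_, e.right_inv hut⟩
    rw [Function.mem_support, hr, indicator_of_mem hut] at hu
    exact hu
  have hts : tsupport r ⊆ e '' tsupport ρ := closure_minimal hsub hcomp.isClosed
  have hrT : tsupport r ⊆ e.target := by
    refine hts.trans ?_
    rintro _ ⟨x, hx, rfl⟩
    exact e.map_source (hp hx)
  have hrcs : HasCompactSupport r := hcomp.of_isClosed_subset (isClosed_tsupport _) hts
  have hrlip : ∀ u ∈ e.target, LipschitzNear r u := fun u hu =>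
    (hρ p u hu).congr (hr_eq u hu).symm
  obtain ⟨hint, hval⟩ := integrableOn_localDivergence e.open_target (X := chartRep n X p)
    (N := chartRep n N p) (V := chartRep n V p)
    (fun u hu => (contDiffAt_chartRep hX.smooth hu).of_le (by norm_cast))
    (fun u hu => hX.injective_fderiv hu)
    (fun u hu => (contDiffAt_chartRep hN.smooth hu).of_le (by norm_cast))
    (fun u _ => hN.norm_eq_one _) (fun u hu v => hN.inner_fderiv hX hu v)
    (fun u hu => (contDiffAt_chartRep hV hu).of_le (by norm_cast)) hrlip hrcs hrT
  have hlocal : EqOn (localDivergence (chartRep n X p) (chartRep n N p)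
      fun u => r u • chartRep n V p u) (fun u => areaFactor (fderiv ℝ (chartRep n X p) u) *
        normalDivergence X N (fun x => ρ x • V x) (e.symm u)) e.target := by
    intro u hu
    have h1 : (fun u => r u • chartRep n V p u) =ᶠ[𝓝 u]
        chartRep n (fun x => ρ x • V x) p := by
      filter_upwards [hr_eq u hu] with w hw
      rw [hw]; rfl
    simp only [localDivergence, normalDivergence]
    have h2 : r u • chartRep n V p u = chartRep n (fun x => ρ x • V x) p u := h1.self_of_nhds
    rw [h1.fderiv_eq, h2, metricTrace_fderiv_chartRep _ _ hu,
      metricTrace_fderiv_chartRep _ _ hu]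
    rfl
  have hsupp : Function.support (normalDivergence X N fun x => ρ x • V x) ⊆ e.source := by
    intro x hx
    by_contra h
    exact hx (hzero x h)
  constructor
  · rw [← integrableOn_iff_integrable_of_support_subset hsupp, integrableOn_source_iff hX.smooth]
    exact hint.congr_fun hlocal e.open_target.measurableSet
  · rw [← setIntegral_eq_integral_of_forall_compl_eq_zero hzero, setIntegral_source hX.smooth,
      ← hval]
    exact (setIntegral_congr_fun e.open_target.measurableSet hlocal).symm

omit [T2Space M] in
lemma ae_differentiableAt_chartRep (hX : IsImmersedHypersurface X) {ρ : M → ℝ}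
    (hρ : LocallyLipschitzInCharts n ρ) :
    ∀ᵐ x ∂(area X), DifferentiableAt ℝ (chartRep n ρ x) (chartAt (Euc n) x x) := by
  refine ae_area_of_charts hX.smooth fun p => ?_
  filter_upwards [ae_restrict_mem (chartAt (Euc n) p).open_target.measurableSet,
    ae_restrict_of_ae (ae_differentiableAt_of_lipschitzNear (hρ p))] with u hu hd
  exact (differentiableAt_chartRep_iff hu (mem_chart_source _ _)).2 (hd hu)

/-- The first variation formula: `∫ div V = -∫ H ⟨V, N⟩` for compactly supported Lipschitz
fields. -/
theorem integral_normalDivergence (hX : IsImmersedHypersurface X)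
    (hN : IsUnitNormal X N) {V : M → Euc (n + 1)}
    (hV : ContMDiff (𝓡 n) 𝓘(ℝ, Euc (n + 1)) ∞ V) {ρ : M → ℝ}
    (hρ : LocallyLipschitzInCharts n ρ) (hcs : HasCompactSupport ρ) :
    Integrable (normalDivergence X N fun x => ρ x • V x) (area X) ∧
      ∫ x, normalDivergence X N (fun x => ρ x • V x) x ∂(area X) = 0 := by
  have : LocallyCompactSpace M := Manifold.locallyCompact_of_finiteDimensional (𝓡 n)
  obtain ⟨t, ht⟩ := hcs.isCompact.elim_finite_subcover
    (fun x : M => (chartAt (Euc n) x).source) (fun x => (chartAt (Euc n) x).open_source)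
    fun x _ => mem_iUnion.2 ⟨x, mem_chart_source _ x⟩
  -- A partition of unity on the support of `ρ` reduces to cutoffs supported in one chart. The
  -- summed identity `hae` needs `ρ` differentiable, hence holds only almost everywhere.
  obtain ⟨f, hf⟩ := SmoothPartitionOfUnity.exists_isSubordinate (𝓡 n)
    (isClosed_tsupport ρ) (fun i : t => (chartAt (Euc n) (i : M)).source)
    (fun i => (chartAt (Euc n) (i : M)).open_source) (by
      intro x hx
      obtain ⟨i, hi, hx⟩ := mem_iUnion₂.1 (ht hx)
      exact mem_iUnion.2 ⟨⟨i, hi⟩, hx⟩)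
  have hfs : ∀ i, ContMDiff (𝓡 n) 𝓘(ℝ, ℝ) ∞ (f i) := fun i => (f i).contMDiff
  have hsum : ∀ x, ρ x = ∑ i, f i x * ρ x := by
    intro x
    by_cases hx : x ∈ tsupport ρ
    · have := f.sum_eq_one hx
      rw [finsum_eq_sum_of_fintype] at this
      rw [← Finset.sum_mul, this, one_mul]
    · simp [image_eq_zero_of_notMem_tsupport hx]
  have hloc : ∀ i, LocallyLipschitzInCharts n fun x => f i x * ρ x := fun i p u hu =>
    (((contDiffAt_chartRep (hfs i) hu).of_le
      (by norm_cast)).lipschitzNear).mul (hρ p u hu)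
  have hmain : ∀ i, _ := fun i => integral_normalDivergence_of_subset_source hX hN hV (hloc i)
    hcs.mul_left ((tsupport_mul_subset_left).trans (hf i))
  have hae : (fun x => ∑ i, normalDivergence X N (fun x => (f i x * ρ x) • V x) x) =ᵐ[area X]
      normalDivergence X N fun x => ρ x • V x := by
    filter_upwards [ae_differentiableAt_chartRep hX hρ] with x hx
    have hx' := mem_chart_target (Euc n) x
    have hVd := differentiableAt_chartRep hV hx'
    have hd : ∀ i, DifferentiableAt ℝ (chartRep n (fun x => (f i x * ρ x) • V x) x)
        (chartAt (Euc n) x x) := fun i =>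
      ((differentiableAt_chartRep (hfs i) hx').mul hx).smul hVd
    have hfun : (fun x => ρ x • V x) = fun x => ∑ i, (f i x * ρ x) • V x := by
      ext1 y
      rw [← Finset.sum_smul, ← hsum]
    have hD : chartDeriv n (fun x => ρ x • V x) x =
        ∑ i, chartDeriv n (fun x => (f i x * ρ x) • V x) x := by
      rw [hfun]
      exact fderiv_fun_sum fun i _ => hd i
    have hT : ∀ B : t → (Euc n →L[ℝ] Euc (n + 1)), metricTrace (chartDeriv n X x) (∑ i, B i) =
        ∑ i, metricTrace (chartDeriv n X x) (B i) := fun B =>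
      map_sum (⟨⟨metricTrace (chartDeriv n X x), by simp [metricTrace]⟩, metricTrace_add _⟩ :
        (Euc n →L[ℝ] Euc (n + 1)) →+ ℝ) B Finset.univ
    simp only [normalDivergence]
    rw [hD, hT, Finset.sum_sub_distrib, ← Finset.mul_sum, ← sum_inner, ← Finset.sum_smul, ← hsum]
  refine ⟨(integrable_finsetSum _ fun i _ => (hmain i).1).congr hae, ?_⟩
  rw [← integral_congr_ae hae, integral_finsetSum _ fun i _ => (hmain i).1]
  exact Finset.sum_eq_zero fun i _ => (hmain i).2

end DivergenceTheorem

/-! ### Bounded sets of a complete length space are relatively compact -/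

section HopfRinow

variable {M : Type*} [TopologicalSpace M] {d : M → M → ℝ≥0∞}

/-- If all balls of radius `ε` centred in the ball of radius `r` are relatively compact, then so is
the ball of radius `r`. -/
lemma exists_isCompact_ball_of_uniform (hself : ∀ p, d p p = 0)
    (htri : ∀ p q x, d p x ≤ d p q + d q x) (hcomm : ∀ p q, d p q = d q p)
    (hnhds : ∀ p, ∀ ε > 0, ∀ᶠ q in 𝓝 p, d p q < ε)
    (hmid : ∀ p q a b, 0 < a → 0 < b → d p q < a + b → ∃ m, d p m < a ∧ d m q < b)
    {p : M} {r ε : ℝ≥0∞} (hr : r ≠ ⊤) (hε : 0 < ε)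
    (h : ∀ q, d p q < r → ∃ K, IsCompact K ∧ {x | d q x < ε} ⊆ K) :
    ∃ K, IsCompact K ∧ {x | d p x < r} ⊆ K := by
  rcases eq_or_ne r 0 with rfl | hr0
  · exact ⟨∅, isCompact_empty, by simp⟩
  have hr0' : 0 < r := pos_iff_ne_zero.2 hr0
  set η := ε / 2 with hη
  have hη0 : 0 < η := ENNReal.div_pos hε.ne' (by simp)
  have hηη : η + η = ε := ENNReal.add_halves ε
  have hη2 : 0 < η / 2 := ENNReal.div_pos hη0.ne' (by simp)
  -- Enlarge the ball by `η = ε/2` at each step, never beyond radius `r`.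
  have key : ∀ k : ℕ, ∃ K, IsCompact K ∧ {x | d p x < min ((k + 1 : ℕ) * η) r} ⊆ K := by
    intro k
    induction k with
    | zero =>
      obtain ⟨K, hK, hKs⟩ := h p (by rwa [hself])
      refine ⟨K, hK, fun x hx => hKs ?_⟩
      have hx1 : d p x < min ((0 + 1 : ℕ) * η) r := hx
      refine (hx1.trans_le (min_le_left _ _)).trans_le ?_
      simp only [zero_add, Nat.cast_one, one_mul]
      rw [← hηη]; exact le_self_add
    | succ k ih =>
      obtain ⟨K, hK, hKs⟩ := ih
      set s := min ((k + 1 : ℕ) * η) r with hs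
      have hs0 : 0 < s := lt_min (ENNReal.mul_pos (by simp) hη0.ne') hr0'
      obtain ⟨t, -, htK⟩ := hK.elim_nhds_subcover (fun y => {x | d y x < η / 2})
        fun y _ => hnhds y _ hη2
      -- The centres `y` lie in `K` but possibly outside the ball of radius `r`, where `h` gives
      -- nothing. A point `m₀` of the smaller ball close to `y` replaces `y`: anything within `η` of
      -- another such point `m` is within `2η = ε` of `m₀`.
      have hC : ∀ y, ∃ C, IsCompact C ∧
          ∀ m x, d p m < s → d y m < η / 2 → d m x < η → x ∈ C := by
        intro y
        by_cases hy : ∃ m, d p m < s ∧ d y m < η / 2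
        · obtain ⟨m₀, hm₀, hym₀⟩ := hy
          obtain ⟨C, hC, hCs⟩ := h m₀ (hm₀.trans_le (min_le_right _ _))
          refine ⟨C, hC, fun m x _ hym hmx => hCs ?_⟩
          have h1 : d m₀ m < η := by
            calc d m₀ m ≤ d m₀ y + d y m := htri _ _ _
              _ < η / 2 + η / 2 := ENNReal.add_lt_add (by rwa [hcomm]) hym
              _ = η := ENNReal.add_halves η
          calc d m₀ x ≤ d m₀ m + d m x := htri _ _ _
            _ < η + η := ENNReal.add_lt_add h1 hmx
            _ = ε := hηη
        · exact ⟨∅, isCompact_empty, fun m x h1 h2 _ => hy ⟨m, h1, h2⟩⟩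
      choose C hC hCs using hC
      refine ⟨⋃ y ∈ t, C y, t.isCompact_biUnion fun y _ => hC y, fun x hx => ?_⟩
      have hx' : d p x < s + η := by
        refine (show d p x < _ from hx).trans_le ?_
        rw [hs, min_add]
        refine min_le_min ?_ le_self_add
        push_cast; rw [add_mul _ 1, one_mul]
      obtain ⟨m, hpm, hmx⟩ := hmid p x s η hs0 hη0 hx'
      obtain ⟨y, hy, hym⟩ := mem_iUnion₂.1 (htK (hKs hpm))
      exact mem_iUnion₂.2 ⟨y, hy, hCs y m x hpm hym hmx⟩
  obtain ⟨k, hk⟩ := ENNReal.exists_nat_mul_gt hη0.ne' hr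
  obtain ⟨K, hK, hKs⟩ := key k
  refine ⟨K, hK, fun x hx => hKs ?_⟩
  refine lt_min ((show d p x < r from hx).trans (hk.trans_le ?_)) hx
  gcongr
  exact Nat.le_succ k

/-- The Hopf–Rinow argument by halving. If a ball of radius `R k` is not relatively compact, it
contains the centre of a ball of radius `R (k+1) = R k / 2` that is not either. These centres form a
Cauchy sequence, and its limit has a relatively compact ball, which swallows the late balls of the
sequence: a contradiction. -/
theorem exists_isCompact_ball_of_complete (hself : ∀ p, d p p = 0)
    (htri : ∀ p q x, d p x ≤ d p q + d q x) (hcomm : ∀ p q, d p q = d q p)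
    (hnhds : ∀ p, ∀ ε > 0, ∀ᶠ q in 𝓝 p, d p q < ε)
    (hmid : ∀ p q a b, 0 < a → 0 < b → d p q < a + b → ∃ m, d p m < a ∧ d m q < b)
    (hcpt : ∀ p, ∃ δ > 0, ∃ K, IsCompact K ∧ {x | d p x < δ} ⊆ K)
    (hcomplete : ∀ u : ℕ → M,
      (∀ ε : ℝ≥0∞, 0 < ε → ∃ k₀ : ℕ, ∀ k ≥ k₀, ∀ l ≥ k₀, d (u k) (u l) < ε) →
      ∃ p : M, Tendsto (fun k => d (u k) p) atTop (𝓝 0))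
    (p : M) {r : ℝ≥0∞} (hr : r ≠ ⊤) : ∃ K, IsCompact K ∧ {x | d p x < r} ⊆ K := by
  by_contra hbad
  set R : ℕ → ℝ≥0∞ := fun k => r * 2⁻¹ ^ k with hR
  have hRtop : ∀ k, R k ≠ ⊤ := fun k => ENNReal.mul_ne_top hr (by simp)
  have hr0 : 0 < r := by
    rw [pos_iff_ne_zero]
    rintro rfl
    exact hbad ⟨∅, isCompact_empty, by simp⟩
  have hRpos : ∀ k, 0 < R k := fun k => ENNReal.mul_pos hr0.ne' (by simp)
  have hRadd : ∀ k, R (k + 1) + R (k + 1) = R k := fun k => by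
    simp only [hR, pow_succ]
    rw [← mul_add, ← mul_add, ENNReal.inv_two_add_inv_two, mul_one]
  let Bad : ℕ → M → Prop := fun k q => ¬∃ K, IsCompact K ∧ {x | d q x < R k} ⊆ K
  have hnext : ∀ k q, Bad k q → ∃ q', d q q' < R k ∧ Bad (k + 1) q' := by
    intro k q hq
    by_contra! hcon
    refine hq (exists_isCompact_ball_of_uniform hself htri hcomm hnhds hmid (hRtop k)
      (hRpos (k + 1)) fun q' hq' => ?_)
    have := hcon q' hq'
    exact not_not.1 this
  choose! next hnext1 hnext2 using hnext
  have hb0 : Bad 0 p := by simpa [Bad, hR] using hbad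
  let u : ℕ → M := fun k => Nat.rec p (fun k q => next k q) k
  have hu : ∀ k, Bad k (u k) := by
    intro k
    induction k with
    | zero => exact hb0
    | succ k ih => exact hnext2 k _ ih
  have hstep : ∀ k, d (u k) (u (k + 1)) < R k := fun k => hnext1 k _ (hu k)
  have hdist : ∀ m k, d (u k) (u (k + m)) ≤ R k + R k := by
    intro m
    induction m with
    | zero => intro k; simp [hself]
    | succ m ih =>
      intro k
      calc d (u k) (u (k + (m + 1))) ≤ d (u k) (u (k + 1)) + d (u (k + 1)) (u (k + (m + 1))) :=
            htri _ _ _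
        _ ≤ R k + R k := by
            refine add_le_add (hstep k).le ?_
            -- The tail is a geometric series: the induction bound `2 R (k+1)` is exactly `R k`.
            rw [← hRadd k, show k + (m + 1) = k + 1 + m by ring]
            exact ih (k + 1)
  have hRlim : Tendsto R atTop (𝓝 0) := by
    have h1 := ENNReal.Tendsto.const_mul (a := r)
      (ENNReal.tendsto_pow_atTop_nhds_zero_of_lt_one (r := 2⁻¹) (by simp)) (Or.inr hr)
    simpa using h1
  obtain ⟨q, hq⟩ := hcomplete u fun ε hε => by
    have hε2 : 0 < ε / 2 := ENNReal.div_pos hε.ne' (by simp)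
    obtain ⟨k₀, hk₀⟩ := eventually_atTop.1 (hRlim.eventually (gt_mem_nhds hε2))
    have h1 : ∀ k l, k₀ ≤ k → k ≤ l → d (u k) (u l) < ε := by
      intro k l hk hl
      obtain ⟨m, rfl⟩ := Nat.exists_eq_add_of_le hl
      calc d (u k) (u (k + m)) ≤ R k + R k := hdist m k
        _ < ε / 2 + ε / 2 := ENNReal.add_lt_add (hk₀ k hk) (hk₀ k hk)
        _ = ε := ENNReal.add_halves ε
    refine ⟨k₀, fun k hk l hl => ?_⟩
    rcases le_total k l with h | h
    · exact h1 k l hk h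
    · rw [hcomm]; exact h1 l k hl h
  obtain ⟨δ, hδ, K, hK, hKs⟩ := hcpt q
  have hδ2 : 0 < δ / 2 := ENNReal.div_pos hδ.ne' (by simp)
  obtain ⟨k, hk1, hk2⟩ := ((hq.eventually (gt_mem_nhds hδ2)).and
    (hRlim.eventually (gt_mem_nhds hδ2))).exists
  refine hu k ⟨K, hK, fun x hx => hKs ?_⟩
  calc d q x ≤ d q (u k) + d (u k) x := htri _ _ _
    _ < δ / 2 + δ / 2 := ENNReal.add_lt_add (by rwa [hcomm]) ((show d (u k) x < R k from hx).trans hk2)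
    _ = δ := ENNReal.add_halves δ

end HopfRinow

/-! ### The distance induced by an immersion -/

section InducedDistance

variable {n : ℕ} {M : Type*} [TopologicalSpace M] [ChartedSpace (Euc n) M]
  {X : M → Euc (n + 1)}

/-- The length of tangent vectors in the metric induced by `X`. -/
@[reducible] def tangentENorm (X : M → Euc (n + 1)) (x : M) : ENorm (TangentSpace (𝓡 n) x) :=
  ⟨fun v => ‖differential X x v‖ₑ⟩

lemma inducedEDist_eq (X : M → Euc (n + 1)) (p q : M) :
    inducedEDist X p q = (letI := tangentENorm X; Manifold.riemannianEDist (𝓡 n) p q) := rfl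

lemma enormSMulClass_tangentENorm (X : M → Euc (n + 1)) (x : M) :
    letI := tangentENorm X
    ENormSMulClass ℝ (TangentSpace (𝓡 n) x) := by
  let _ := tangentENorm X
  refine ⟨fun c v => ?_⟩
  change ‖differential X x (c • v)‖ₑ = ‖c‖ₑ * ‖differential X x v‖ₑ
  rw [← enorm_smul]
  congr 1
  exact map_smul (mfderiv (𝓡 n) 𝓘(ℝ, Euc (n + 1)) X x) c v

lemma inducedEDist_self (p : M) : inducedEDist X p p = 0 := by
  rw [inducedEDist_eq]
  let _ := tangentENorm X
  have := enormSMulClass_tangentENorm X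
  exact Manifold.riemannianEDist_self

lemma inducedEDist_comm (p q : M) : inducedEDist X p q = inducedEDist X q p := by
  rw [inducedEDist_eq, inducedEDist_eq]
  let _ := tangentENorm X
  have := enormSMulClass_tangentENorm X
  exact Manifold.riemannianEDist_comm

lemma inducedEDist_triangle (p q x : M) :
    inducedEDist X p x ≤ inducedEDist X p q + inducedEDist X q x := by
  rw [inducedEDist_eq, inducedEDist_eq, inducedEDist_eq]
  let _ := tangentENorm X
  have := enormSMulClass_tangentENorm X
  exact Manifold.riemannianEDist_triangle

lemma contDiffOn_comp_path (hX : ContMDiff (𝓡 n) 𝓘(ℝ, Euc (n + 1)) ∞ X) {γ : ℝ → M} {a b : ℝ}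
    (hγ : ContMDiffOn 𝓘(ℝ, ℝ) (𝓡 n) 1 γ (Icc a b)) : ContDiffOn ℝ 1 (X ∘ γ) (Icc a b) :=
  contMDiffOn_iff_contDiffOn.1 ((hX.of_le (by norm_cast)).comp_contMDiffOn hγ)

/-- By the chain rule the intrinsic length of a path is the Euclidean length of its image, which
reduces lengths to calculus in `ℝ^{n+1}`. -/
lemma pathELength_eq (hX : ContMDiff (𝓡 n) 𝓘(ℝ, Euc (n + 1)) ∞ X) {γ : ℝ → M} {a b : ℝ}
    (hγ : ContMDiffOn 𝓘(ℝ, ℝ) (𝓡 n) 1 γ (Icc a b)) :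
    (letI := tangentENorm X; Manifold.pathELength (𝓡 n) γ a b) =
      ∫⁻ t in Ioo a b, ‖deriv (X ∘ γ) t‖ₑ := by
  let _ := tangentENorm X
  refine Manifold.pathELength_eq_lintegral_mfderiv_Ioo.trans ?_
  refine setLIntegral_congr_fun measurableSet_Ioo fun t ht => ?_
  have h1 : MDifferentiableAt 𝓘(ℝ, ℝ) (𝓡 n) γ t :=
    (hγ.contMDiffAt (Icc_mem_nhds ht.1 ht.2)).mdifferentiableAt one_ne_zero
  have h2 : MDifferentiableAt (𝓡 n) 𝓘(ℝ, Euc (n + 1)) X (γ t) :=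
    (hX.contMDiffAt (x := γ t)).mdifferentiableAt (by simp)
  have h3 := mfderiv_comp_apply t h2 h1 (1 : ℝ)
  change ‖differential X (γ t) (mfderiv 𝓘(ℝ, ℝ) (𝓡 n) γ t (1 : ℝ))‖ₑ = _
  rw [← fderiv_apply_one_eq_deriv, ← mfderiv_eq_fderiv]
  exact congrArg (fun v : Euc (n + 1) => ‖v‖ₑ) h3.symm

lemma inducedEDist_le_lintegral (hX : ContMDiff (𝓡 n) 𝓘(ℝ, Euc (n + 1)) ∞ X) {γ : ℝ → M} {a b : ℝ}
    (hab : a ≤ b) (hγ : ContMDiffOn 𝓘(ℝ, ℝ) (𝓡 n) 1 γ (Icc a b)) :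
    inducedEDist X (γ a) (γ b) ≤ ∫⁻ t in Ioo a b, ‖deriv (X ∘ γ) t‖ₑ := by
  rw [← pathELength_eq hX hγ, inducedEDist_eq]
  let _ := tangentENorm X
  have := enormSMulClass_tangentENorm X
  exact Manifold.riemannianEDist_le_pathELength hγ rfl rfl hab

lemma exists_path_of_inducedEDist_lt (hX : ContMDiff (𝓡 n) 𝓘(ℝ, Euc (n + 1)) ∞ X) {p q : M}
    {r : ℝ≥0∞} (h : inducedEDist X p q < r) :
    ∃ γ : ℝ → M, γ 0 = p ∧ γ 1 = q ∧ ContMDiffOn 𝓘(ℝ, ℝ) (𝓡 n) 1 γ (Icc 0 1) ∧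
      ∫⁻ t in Ioo 0 1, ‖deriv (X ∘ γ) t‖ₑ < r := by
  rw [inducedEDist_eq] at h
  let _ := tangentENorm X
  have := enormSMulClass_tangentENorm X
  obtain ⟨γ, h0, h1, hγ, hl⟩ := Manifold.exists_lt_of_riemannianEDist_lt h
  refine ⟨γ, h0, h1, hγ, ?_⟩
  rw [← pathELength_eq hX hγ]
  exact hl

/-- Points at distance less than `a + b` have a point at distance less than `a` from the first and
less than `b` from the second. -/
lemma exists_between_inducedEDist (hX : ContMDiff (𝓡 n) 𝓘(ℝ, Euc (n + 1)) ∞ X) (p q : M)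
    (a b : ℝ≥0∞) (ha : 0 < a) (hb : 0 < b) (h : inducedEDist X p q < a + b) :
    ∃ m, inducedEDist X p m < a ∧ inducedEDist X m q < b := by
  obtain ⟨γ, rfl, rfl, hγ, hl⟩ := exists_path_of_inducedEDist_lt hX h
  have hc := contDiffOn_comp_path hX hγ
  set g : ℝ → ℝ := fun t => ‖derivWithin (X ∘ γ) (Icc 0 1) t‖ with hg
  have hgc : ContinuousOn g (Icc 0 1) :=
    (hc.continuousOn_derivWithin (uniqueDiffOn_Icc zero_lt_one) le_rfl).norm
  have hgi : IntegrableOn g (Icc 0 1) := hgc.integrableOn_Icc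
  -- Arc length along a path that is nearly shortest. The intermediate point is found by the
  -- intermediate value theorem for `ℓ`.
  set ℓ : ℝ → ℝ := fun t => ∫ s in (0 : ℝ)..t, g s with hℓ
  have hℓc : ContinuousOn ℓ (Icc 0 1) := by
    have := intervalIntegral.continuousOn_primitive_interval (μ := volume) (f := g) (a := 0) (b := 1)
      (by rwa [uIcc_of_le zero_le_one])
    rwa [uIcc_of_le zero_le_one] at this
  have hii : ∀ s t, 0 ≤ s → s ≤ t → t ≤ 1 → IntervalIntegrable g volume s t := by
    intro s t hs hst ht
    rw [intervalIntegrable_iff_integrableOn_Icc_of_le hst]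
    exact hgi.mono_set (Icc_subset_Icc hs ht)
  have hlen : ∀ s t, 0 ≤ s → s ≤ t → t ≤ 1 →
      ∫⁻ τ in Ioo s t, ‖deriv (X ∘ γ) τ‖ₑ = ENNReal.ofReal (ℓ t - ℓ s) := by
    intro s t hs hst ht
    have h1 : ℓ t - ℓ s = ∫ τ in s..t, g τ :=
      intervalIntegral.integral_interval_sub_left (hii 0 t le_rfl (hs.trans hst) ht)
        (hii 0 s le_rfl hs (hst.trans ht))
    rw [h1, intervalIntegral.integral_of_le hst, integral_Ioc_eq_integral_Ioo,
      ofReal_integral_eq_lintegral_ofReal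
        (hgi.mono_set (Ioo_subset_Icc_self.trans (Icc_subset_Icc hs ht)))
        (Eventually.of_forall fun τ => norm_nonneg _)]
    refine setLIntegral_congr_fun measurableSet_Ioo fun τ hτ => ?_
    have h2 : Icc (0 : ℝ) 1 ∈ 𝓝 τ := Icc_mem_nhds (hs.trans_lt hτ.1) (hτ.2.trans_le ht)
    simp only [hg]
    rw [derivWithin_of_mem_nhds h2, ofReal_norm]
  have hdist : ∀ s t, 0 ≤ s → s ≤ t → t ≤ 1 →
      inducedEDist X (γ s) (γ t) ≤ ENNReal.ofReal (ℓ t - ℓ s) := by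
    intro s t hs hst ht
    rw [← hlen s t hs hst ht]
    exact inducedEDist_le_lintegral hX hst (hγ.mono (Icc_subset_Icc hs ht))
  have hℓ0 : ℓ 0 = 0 := by simp [hℓ]
  rw [hlen 0 1 le_rfl zero_le_one le_rfl, hℓ0, sub_zero] at hl
  -- If the whole path is shorter than `a`, its endpoint already serves as the intermediate point.
  by_cases hLa : ENNReal.ofReal (ℓ 1) < a
  · refine ⟨γ 1, (hdist 0 1 le_rfl zero_le_one le_rfl).trans_lt (by rwa [hℓ0, sub_zero]), ?_⟩
    rwa [inducedEDist_self]
  push Not at hLa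
  have hatop : a ≠ ⊤ := (hLa.trans_lt ENNReal.ofReal_lt_top).ne
  lift a to NNReal using hatop
  have ha' : (0 : ℝ) < a := by exact_mod_cast ha
  have hLa' : (a : ℝ) ≤ ℓ 1 := by
    by_contra! hcon
    refine absurd hLa (not_le.2 ?_)
    rw [← ENNReal.ofReal_coe_nnreal]
    exact (ENNReal.ofReal_lt_ofReal_iff ha').2 hcon
  -- The arc length at which to cut: less than `a` before it and less than `b` after it.
  obtain ⟨c, hc0, hca, hcb⟩ : ∃ c : ℝ, 0 ≤ c ∧ c < a ∧ ENNReal.ofReal (ℓ 1 - c) < b := by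
    by_cases hbtop : b = ⊤
    · exact ⟨0, le_rfl, ha', by rw [hbtop]; exact ENNReal.ofReal_lt_top⟩
    lift b to NNReal using hbtop
    have hb' : (0 : ℝ) < b := by exact_mod_cast hb
    have hlab : ℓ 1 < a + b := by
      have : ENNReal.ofReal (ℓ 1) < ENNReal.ofReal (a + b : ℝ) := by
        rw [ENNReal.ofReal_add ha'.le hb'.le, ENNReal.ofReal_coe_nnreal, ENNReal.ofReal_coe_nnreal]
        exact hl
      exact (ENNReal.ofReal_lt_ofReal_iff (by positivity)).1 this
    obtain ⟨c, hc1, hc2⟩ := exists_between (show max 0 (ℓ 1 - b) < a from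
      max_lt ha' (by linarith))
    refine ⟨c, (le_max_left _ _).trans hc1.le, hc2, ?_⟩
    rw [← ENNReal.ofReal_coe_nnreal]
    have := (le_max_right 0 (ℓ 1 - b)).trans_lt hc1
    exact (ENNReal.ofReal_lt_ofReal_iff hb').2 (by linarith)
  obtain ⟨t, ht, htc⟩ := intermediate_value_Icc zero_le_one hℓc
    (show c ∈ Icc (ℓ 0) (ℓ 1) from ⟨by rw [hℓ0]; exact hc0, hca.le.trans hLa'⟩)
  refine ⟨γ t, ?_, ?_⟩
  · refine (hdist 0 t le_rfl ht.1 ht.2).trans_lt ?_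
    rw [htc, hℓ0, sub_zero, ← ENNReal.ofReal_coe_nnreal]
    exact (ENNReal.ofReal_lt_ofReal_iff ha').2 hca
  · refine (hdist t 1 ht.1 ht.2 le_rfl).trans_lt ?_
    rwa [htc]

variable [IsManifold (𝓡 n) ∞ M]

/-- The distance of two points in a chart is bounded by the length of the coordinate segment. -/
lemma inducedEDist_le_of_segment (hX : ContMDiff (𝓡 n) 𝓘(ℝ, Euc (n + 1)) ∞ X) {p : M}
    {u w : Euc n} (hseg : segment ℝ u w ⊆ (chartAt (Euc n) p).target) {c : ℝ}
    (hc : ∀ z ∈ segment ℝ u w, ‖fderiv ℝ (chartRep n X p) z (w - u)‖ ≤ c) :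
    inducedEDist X ((chartAt (Euc n) p).symm u) ((chartAt (Euc n) p).symm w) ≤
      ENNReal.ofReal c := by
  set γ : ℝ → Euc n := fun t => u + t • (w - u) with hγ
  have hmem : ∀ t ∈ Icc (0 : ℝ) 1, γ t ∈ segment ℝ u w := fun t ht => by
    rw [segment_eq_image']; exact ⟨t, ht, rfl⟩
  have hγd : ∀ t, HasDerivAt γ (w - u) t := fun t => by
    have := ((hasDerivAt_id t).smul_const (w - u)).const_add u
    rwa [one_smul] at this
  have hγs : ContDiff ℝ 1 γ := contDiff_const.add (contDiff_id.smul contDiff_const)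
  have h1 : ContMDiffOn 𝓘(ℝ, ℝ) (𝓡 n) 1 ((chartAt (Euc n) p).symm ∘ γ) (Icc 0 1) := by
    have h2 : ContMDiffOn (𝓡 n) (𝓡 n) 1 (chartAt (Euc n) p).symm (chartAt (Euc n) p).target :=
      (contMDiffOn_chart_symm (I := 𝓡 n) (n := ∞) (x := p)).of_le (by norm_cast)
    exact h2.comp hγs.contMDiff.contMDiffOn fun t ht => hseg (hmem t ht)
  have h3 := inducedEDist_le_lintegral hX zero_le_one h1
  simp only [Function.comp_apply, hγ, zero_smul, add_zero, one_smul, add_sub_cancel] at h3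
  refine h3.trans ?_
  calc ∫⁻ t in Ioo (0 : ℝ) 1, ‖deriv (X ∘ (chartAt (Euc n) p).symm ∘ γ) t‖ₑ
      ≤ ∫⁻ t in Ioo (0 : ℝ) 1, ENNReal.ofReal c := by
        refine setLIntegral_mono measurable_const fun t ht => ?_
        have ht' := hmem t (Ioo_subset_Icc_self ht)
        have h4 : HasDerivAt (X ∘ (chartAt (Euc n) p).symm ∘ γ)
            (fderiv ℝ (chartRep n X p) (γ t) (w - u)) t :=
          HasFDerivAt.comp_hasDerivAt (l := chartRep n X p) (f := γ) t
            (differentiableAt_chartRep hX (hseg ht')).hasFDerivAt (hγd t)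
        rw [h4.deriv, ← ofReal_norm]
        exact ENNReal.ofReal_le_ofReal (hc _ ht')
    _ = ENNReal.ofReal c := by simp

/-- In a chart the induced distance is locally bounded by a multiple of the coordinate
distance. -/
lemma exists_inducedEDist_le_mul (hX : ContMDiff (𝓡 n) 𝓘(ℝ, Euc (n + 1)) ∞ X) {p : M}
    {u₀ : Euc n} (hu₀ : u₀ ∈ (chartAt (Euc n) p).target) :
    ∃ C : NNReal, ∃ t ∈ 𝓝 u₀, ∀ u ∈ t, ∀ w ∈ t, inducedEDist X ((chartAt (Euc n) p).symm u)
      ((chartAt (Euc n) p).symm w) ≤ ENNReal.ofReal (C * ‖w - u‖) := by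
  have hcont := (contDiffAt_fderiv_chartRep hX hu₀).continuousAt.norm
  set C : NNReal := ‖fderiv ℝ (chartRep n X p) u₀‖₊ + 1 with hC
  have h1 : ∀ᶠ u in 𝓝 u₀, ‖fderiv ℝ (chartRep n X p) u‖ < C :=
    hcont.eventually (gt_mem_nhds (by simp [hC]))
  obtain ⟨r, hr, hball⟩ := Metric.mem_nhds_iff.1
    (inter_mem h1 (chart_target_mem_nhds' p hu₀))
  refine ⟨C, Metric.ball u₀ r, Metric.ball_mem_nhds _ hr, fun u hu w hw => ?_⟩
  have hseg : segment ℝ u w ⊆ Metric.ball u₀ r := (convex_ball u₀ r).segment_subset hu hw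
  refine inducedEDist_le_of_segment hX (fun z hz => (hball (hseg hz)).2) fun z hz => ?_
  have h2 : ‖fderiv ℝ (chartRep n X p) z‖ < C := (hball (hseg hz)).1
  exact (ContinuousLinearMap.le_opNorm _ _).trans
    (mul_le_mul_of_nonneg_right h2.le (norm_nonneg _))

lemma eventually_inducedEDist_lt (hX : ContMDiff (𝓡 n) 𝓘(ℝ, Euc (n + 1)) ∞ X) (p : M) (ε : ℝ≥0∞)
    (hε : ε > 0) : ∀ᶠ q in 𝓝 p, inducedEDist X p q < ε := by
  set e := chartAt (Euc n) p with he
  obtain ⟨C, t, ht, hCt⟩ := exists_inducedEDist_le_mul hX (mem_chart_target (Euc n) p)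
  have hcont : ContinuousAt e p := e.continuousAt (mem_chart_source _ p)
  have hlim : Tendsto (fun q => ENNReal.ofReal (C * ‖e q - e p‖)) (𝓝 p) (𝓝 0) := by
    have h1 : ContinuousAt (fun q => ENNReal.ofReal (C * ‖e q - e p‖)) p :=
      ENNReal.continuous_ofReal.continuousAt.comp
        (continuousAt_const.mul (hcont.sub continuousAt_const).norm)
    simpa [ContinuousAt] using h1
  filter_upwards [hcont.preimage_mem_nhds ht, hlim.eventually (gt_mem_nhds hε),
    e.open_source.mem_nhds (mem_chart_source _ p)] with q hq1 hq2 hq3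
  have h2 := hCt _ (mem_of_mem_nhds ht) _ hq1
  rw [← he, e.left_inv hq3, e.left_inv (mem_chart_source _ p)] at h2
  exact h2.trans_lt hq2

/-- Small balls of the induced distance are relatively compact. -/
lemma exists_isCompact_inducedEDist_ball [T2Space M] (hX : IsImmersedHypersurface X) (p : M) :
    ∃ δ > 0, ∃ K, IsCompact K ∧ {x | inducedEDist X p x < δ} ⊆ K := by
  set e := chartAt (Euc n) p with he
  set u₀ := e p with hu₀
  have hu₀t : u₀ ∈ e.target := mem_chart_target _ p
  -- Injectivity of the differential at `u₀` gives `‖v‖ ≤ L ‖dX v‖`. A linearization error of at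
  -- most `(2L)⁻¹ ‖u - u₀‖` leaves the lower bound `(2L)⁻¹ ‖u - u₀‖` for the displacement of `X`.
  obtain ⟨L, hL0, hL⟩ := LinearMap.exists_antilipschitzWith
    (fderiv ℝ (chartRep n X p) u₀ : Euc n →ₗ[ℝ] Euc (n + 1))
    (LinearMap.ker_eq_bot.2 (hX.injective_fderiv hu₀t))
  have hL' : ∀ v, ‖v‖ ≤ L * ‖fderiv ℝ (chartRep n X p) u₀ v‖ := fun v => by
    simpa using hL.le_mul_norm_sub v 0
  have hL0' : (0 : ℝ) < L := by exact_mod_cast hL0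
  have hdiff := (differentiableAt_chartRep hX.smooth hu₀t).hasFDerivAt
  have hsmall := hdiff.isLittleO.def (show (0 : ℝ) < (2 * L)⁻¹ by positivity)
  obtain ⟨r', hr', hball⟩ := Metric.mem_nhds_iff.1
    (inter_mem hsmall (chart_target_mem_nhds' p hu₀t))
  set r := r' / 2 with hr
  have hr0 : 0 < r := by positivity
  have hcb : Metric.closedBall u₀ r ⊆ Metric.ball u₀ r' :=
    Metric.closedBall_subset_ball (by rw [hr]; linarith)
  have hlow : ∀ u ∈ Metric.closedBall u₀ r,
      (2 * L : ℝ)⁻¹ * ‖u - u₀‖ ≤ ‖chartRep n X p u - chartRep n X p u₀‖ := by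
    intro u hu
    have h1 : ‖chartRep n X p u - chartRep n X p u₀ - fderiv ℝ (chartRep n X p) u₀ (u - u₀)‖ ≤
      (2 * L : ℝ)⁻¹ * ‖u - u₀‖ := (hball (hcb hu)).1
    have h2 := hL' (u - u₀)
    have h3 := norm_sub_norm_le (fderiv ℝ (chartRep n X p) u₀ (u - u₀))
      (chartRep n X p u - chartRep n X p u₀)
    rw [norm_sub_rev (fderiv ℝ (chartRep n X p) u₀ (u - u₀))] at h3
    have h4 : (L : ℝ)⁻¹ * ‖u - u₀‖ ≤ ‖fderiv ℝ (chartRep n X p) u₀ (u - u₀)‖ := by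
      rw [inv_mul_le_iff₀ hL0']; exact h2
    have h5 : (2 * L : ℝ)⁻¹ * ‖u - u₀‖ + (2 * L : ℝ)⁻¹ * ‖u - u₀‖ = (L : ℝ)⁻¹ * ‖u - u₀‖ := by
      field_simp; ring
    linarith
  have hcbt : Metric.closedBall u₀ r ⊆ e.target := fun u hu => (hball (hcb hu)).2
  set K := e.symm '' Metric.closedBall u₀ r with hK
  have hKc : IsCompact K := (isCompact_closedBall u₀ r).image_of_continuousOn
    (e.continuousOn_symm.mono hcbt)
  set B := e.symm '' Metric.ball u₀ r with hB
  have hBo : IsOpen B := e.symm.isOpen_image_of_subset_source Metric.isOpen_ball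
    (Metric.ball_subset_closedBall.trans hcbt)
  refine ⟨ENNReal.ofReal ((2 * L : ℝ)⁻¹ * r), ENNReal.ofReal_pos.2 (by positivity), K, hKc, ?_⟩
  intro x hx
  obtain ⟨γ, h0, h1, hγ, hl⟩ := exists_path_of_inducedEDist_lt hX.smooth (show _ < _ from hx)
  have hc := contDiffOn_comp_path hX.smooth hγ
  by_contra hxK
  -- A path leaving `K` must cross the image of the coordinate sphere, since otherwise it would be
  -- separated by the open sets `B` and `Kᶜ`. Up to the crossing, `X` has moved by at least
  -- `r/(2L)`, which bounds the length below.
  have hsphere : ∃ t ∈ Icc (0 : ℝ) 1, γ t ∈ e.symm '' Metric.sphere u₀ r := by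
    by_contra! hcon
    have hpre : IsPreconnected (γ '' Icc 0 1) := isPreconnected_Icc.image γ hγ.continuousOn
    have hcov : γ '' Icc 0 1 ⊆ B ∪ Kᶜ := by
      rintro _ ⟨t, ht, rfl⟩
      by_cases hk : γ t ∈ K
      · left
        obtain ⟨u, hu, hut⟩ := hk
        rcases (Metric.mem_closedBall.1 hu).lt_or_eq with h | h
        · exact ⟨u, h, hut⟩
        · exact absurd ⟨u, h, hut⟩ (hcon t ht)
      · exact Or.inr hk
    obtain ⟨y, -, hyB, hyK⟩ := hpre B Kᶜ hBo hKc.isClosed.isOpen_compl hcov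
      ⟨p, ⟨0, by simp, h0⟩, ⟨u₀, Metric.mem_ball_self hr0, e.left_inv (mem_chart_source _ p)⟩⟩
      ⟨x, ⟨1, by simp, h1⟩, hxK⟩
    exact hyK (image_mono Metric.ball_subset_closedBall hyB)
  obtain ⟨t, ht, u, hu, hut⟩ := hsphere
  have hu' : u ∈ Metric.closedBall u₀ r := Metric.sphere_subset_closedBall hu
  have h2 := enorm_sub_le_lintegral_deriv_of_contDiffOn_Icc (hc.mono (Icc_subset_Icc_right ht.2))
    ht.1
  have h3 : ∫⁻ s in Icc 0 t, ‖deriv (X ∘ γ) s‖ₑ ≤ ∫⁻ s in Ioo 0 1, ‖deriv (X ∘ γ) s‖ₑ := by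
    rw [← restrict_Ioo_eq_restrict_Icc]
    exact lintegral_mono_set (Ioo_subset_Ioo_right ht.2)
  have h4 : (2 * L : ℝ)⁻¹ * r ≤ ‖(X ∘ γ) t - (X ∘ γ) 0‖ := by
    have h5 := hlow u hu'
    rw [← dist_eq_norm, Metric.mem_sphere.1 hu, hu₀, he, chartRep_self] at h5
    simp only [Function.comp_apply, h0, ← hut]
    exact h5
  have h6 : ENNReal.ofReal ((2 * L : ℝ)⁻¹ * r) ≤ ‖(X ∘ γ) t - (X ∘ γ) 0‖ₑ := by
    rw [← ofReal_norm]; exact ENNReal.ofReal_le_ofReal h4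
  exact absurd ((h6.trans h2).trans h3) (not_le.2 hl)

/-- The set of points at finite distance from `p` is open and closed, and `M` is connected. -/
lemma inducedEDist_ne_top [ConnectedSpace M] (hX : ContMDiff (𝓡 n) 𝓘(ℝ, Euc (n + 1)) ∞ X)
    (p q : M) : inducedEDist X p q ≠ ⊤ := by
  have hclopen : IsClopen {x | inducedEDist X p x < ⊤} := by
    refine ⟨⟨isOpen_iff_mem_nhds.2 fun x hx => ?_⟩, isOpen_iff_mem_nhds.2 fun x hx => ?_⟩
    · filter_upwards [eventually_inducedEDist_lt hX x 1 one_pos] with y hy hy'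
      refine hx ((inducedEDist_triangle p y x).trans_lt (ENNReal.add_lt_top.2 ⟨hy', ?_⟩))
      rw [inducedEDist_comm]
      exact hy.trans ENNReal.one_lt_top
    · filter_upwards [eventually_inducedEDist_lt hX x 1 one_pos] with y hy
      exact (inducedEDist_triangle p x y).trans_lt
        (ENNReal.add_lt_top.2 ⟨hx, hy.trans ENNReal.one_lt_top⟩)
  have huniv := hclopen.eq_univ ⟨p, by simp [inducedEDist_self]⟩
  have : q ∈ {x | inducedEDist X p x < ⊤} := huniv ▸ mem_univ q
  exact this.ne

/-- Bounded sets of a complete hypersurface are relatively compact. -/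
theorem exists_isCompact_of_complete [T2Space M] (hX : IsImmersedHypersurface X)
    (hc : IsCompleteHypersurface X) (p : M) {r : ℝ≥0∞} (hr : r ≠ ⊤) :
    ∃ K, IsCompact K ∧ {x | inducedEDist X p x < r} ⊆ K :=
  exists_isCompact_ball_of_complete inducedEDist_self inducedEDist_triangle inducedEDist_comm
    (eventually_inducedEDist_lt hX.smooth) (exists_between_inducedEDist hX.smooth)
    (exists_isCompact_inducedEDist_ball hX) hc p hr

end InducedDistance

/-! ### Cutoff functions, integrability of Gaussian weights, and the global identity -/

section Cutoff

variable {n : ℕ} {M : Type*} [TopologicalSpace M] [ChartedSpace (Euc n) M]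
  [IsManifold (𝓡 n) ∞ M] {X N : M → Euc (n + 1)}

omit [IsManifold (𝓡 n) ∞ M] in
lemma abs_toReal_inducedEDist_sub_le {p x y : M} (hx : inducedEDist X p x ≠ ⊤)
    (hy : inducedEDist X p y ≠ ⊤) {c : ℝ} (hc : 0 ≤ c)
    (h : inducedEDist X x y ≤ ENNReal.ofReal c) :
    |(inducedEDist X p x).toReal - (inducedEDist X p y).toReal| ≤ c := by
  have key : ∀ a b : M, inducedEDist X p a ≠ ⊤ → inducedEDist X p b ≠ ⊤ →
      inducedEDist X a b ≤ ENNReal.ofReal c →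
      (inducedEDist X p b).toReal ≤ (inducedEDist X p a).toReal + c := by
    intro a b ha hb hab
    have h1 := (inducedEDist_triangle p a b).trans (add_le_add le_rfl hab)
    have h2 := ENNReal.toReal_mono (ENNReal.add_ne_top.2 ⟨ha, ENNReal.ofReal_ne_top⟩) h1
    rwa [ENNReal.toReal_add ha ENNReal.ofReal_ne_top, ENNReal.toReal_ofReal hc] at h2
  have h1 := key x y hx hy h
  have h2 := key y x hy hx (by rwa [inducedEDist_comm])
  rw [abs_le]
  constructor <;> linarith

lemma abs_clamp_sub_le (a b : ℝ) : |max 0 (min 1 a) - max 0 (min 1 b)| ≤ |a - b| := by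
  have h1 := abs_max_sub_max_le_abs (min 1 a) (min 1 b) 0
  have h2 := abs_min_sub_min_le_max 1 a 1 b
  rw [max_comm 0, max_comm 0]
  refine h1.trans (h2.trans ?_)
  simp

/-- If the variation of `ρ` is controlled by `κ` times the induced distance, then so is its
differential. -/
lemma abs_chartDeriv_le (hX : ContMDiff (𝓡 n) 𝓘(ℝ, Euc (n + 1)) ∞ X) {ρ : M → ℝ} {κ : ℝ}
    (hκ : 0 ≤ κ)
    (h : ∀ x y c, 0 ≤ c → inducedEDist X x y ≤ ENNReal.ofReal c → |ρ x - ρ y| ≤ κ * c)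
    (x : M) (v : Euc n) : |chartDeriv n ρ x v| ≤ κ * ‖chartDeriv n X x v‖ := by
  set u := chartAt (Euc n) x x with hu
  have hut : u ∈ (chartAt (Euc n) x).target := mem_chart_target _ x
  by_cases hd : DifferentiableAt ℝ (chartRep n ρ x) u
  swap
  -- Where `ρ` is not differentiable its differential is zero by convention, so the bound holds at
  -- every point.
  · rw [chartDeriv, ← hu, fderiv_zero_of_not_differentiableAt hd]
    simp only [_root_.zero_apply, abs_zero]
    positivity
  -- A strict bound is needed, since only `‖dX v‖ < c` persists on a neighbourhood. The differential
  -- of `ρ` is then bounded by its difference quotients along short coordinate segments.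
  refine le_of_forall_gt_imp_ge_of_dense fun b hb => ?_
  have hlt : ∃ c, ‖chartDeriv n X x v‖ < c ∧ κ * c ≤ b := by
    rcases hκ.eq_or_lt with h0 | h0
    · refine ⟨‖chartDeriv n X x v‖ + 1, by linarith, ?_⟩
      rw [← h0] at hb ⊢
      simp only [zero_mul] at hb ⊢
      exact hb.le
    · refine ⟨b / κ, ?_, (mul_div_cancel₀ _ h0.ne').le⟩
      rwa [lt_div_iff₀ h0, mul_comm]
  obtain ⟨c, hc, hcb⟩ := hlt
  refine le_trans ?_ hcb
  have hc0 : 0 ≤ c := (norm_nonneg _).trans hc.le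
  have hcont : ContinuousAt (fun z => ‖fderiv ℝ (chartRep n X x) z v‖) u :=
    ((contDiffAt_fderiv_chartRep hX hut).continuousAt.clm_apply continuousAt_const).norm
  obtain ⟨r, hr, hball⟩ := Metric.mem_nhds_iff.1
    (inter_mem (hcont.eventually (gt_mem_nhds hc)) (chart_target_mem_nhds' x hut))
  have hl : HasDerivAt (fun s : ℝ => u + s • v) v 0 := by
    simpa using ((hasDerivAt_id (0 : ℝ)).smul_const v).const_add u
  have hder : HasDerivAt (fun s : ℝ => chartRep n ρ x (u + s • v)) (chartDeriv n ρ x v) 0 :=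
    HasFDerivAt.comp_hasDerivAt (l := chartRep n ρ x) (f := fun s : ℝ => u + s • v) (0 : ℝ)
      (by rw [zero_smul, add_zero]; exact hd.hasFDerivAt) hl
  have hslope := (hasDerivAt_iff_tendsto_slope.1 hder).abs
  refine le_of_tendsto hslope ?_
  have hnear : ∀ᶠ s : ℝ in 𝓝 0, u + s • v ∈ Metric.ball u r := by
    have : Metric.ball u r ∈ 𝓝 (u + (0 : ℝ) • v) := by simpa using Metric.ball_mem_nhds u hr
    exact hl.continuousAt.preimage_mem_nhds this
  filter_upwards [nhdsWithin_le_nhds hnear, self_mem_nhdsWithin] with s hs hs0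
  have hs0' : s ≠ 0 := hs0
  have hseg : segment ℝ u (u + s • v) ⊆ Metric.ball u r :=
    (convex_ball u r).segment_subset (Metric.mem_ball_self hr) hs
  have hdist := inducedEDist_le_of_segment hX (p := x) (u := u) (w := u + s • v) (c := |s| * c)
    (fun z hz => (hball (hseg hz)).2) (fun z hz => by
      have h2 : ‖fderiv ℝ (chartRep n X x) z v‖ < c := (hball (hseg hz)).1
      rw [add_sub_cancel_left, map_smul, norm_smul, Real.norm_eq_abs]
      exact mul_le_mul_of_nonneg_left h2.le (abs_nonneg _))
  have hfin := h _ _ _ (by positivity) hdist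
  rw [slope_def_field, sub_zero, abs_div]
  rw [div_le_iff₀ (abs_pos.2 hs0'), abs_sub_comm]
  simp only [zero_smul, add_zero]
  calc _ ≤ κ * (|s| * c) := hfin
    _ = κ * c * |s| := by ring

/-- With `D` the distance from a fixed point, truncate `2 - D/(k+1)` to `[0,1]`. The result is `1`
for `D ≤ k+1`, vanishes for `D ≥ 2(k+1)`, and varies at most `1/(k+1)` times as fast as the
distance. Completeness gives the compact support. -/
theorem exists_cutoff [T2Space M] [ConnectedSpace M] (hX : IsImmersedHypersurface X)
    (hc : IsCompleteHypersurface X) :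
    ∃ ρ : ℕ → M → ℝ, ∀ k, LocallyLipschitzInCharts n (ρ k) ∧ HasCompactSupport (ρ k) ∧
      (∀ x, |ρ k x| ≤ 1) ∧
      (∀ x v, |chartDeriv n (ρ k) x v| ≤ ((k : ℝ) + 1)⁻¹ * ‖chartDeriv n X x v‖) ∧
      ∀ x, Tendsto (fun k => ρ k x) atTop (𝓝 1) := by
  obtain ⟨p⟩ := (inferInstance : Nonempty M)
  set D : M → ℝ := fun x => (inducedEDist X p x).toReal with hD
  have hfin : ∀ x, inducedEDist X p x ≠ ⊤ := inducedEDist_ne_top hX.smooth p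
  set ρ : ℕ → M → ℝ := fun k x => max 0 (min 1 (2 - ((k : ℝ) + 1)⁻¹ * D x)) with hρ
  have hvar : ∀ k x y c, 0 ≤ c → inducedEDist X x y ≤ ENNReal.ofReal c →
      |ρ k x - ρ k y| ≤ ((k : ℝ) + 1)⁻¹ * c := by
    intro k x y c hc hxy
    refine (abs_clamp_sub_le _ _).trans ?_
    have h1 := abs_toReal_inducedEDist_sub_le (hfin x) (hfin y) hc hxy
    have hk : (0 : ℝ) ≤ ((k : ℝ) + 1)⁻¹ := by positivity
    rw [show (2 - ((k : ℝ) + 1)⁻¹ * D x) - (2 - ((k : ℝ) + 1)⁻¹ * D y) =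
      -(((k : ℝ) + 1)⁻¹ * (D x - D y)) by ring, abs_neg, abs_mul, abs_of_nonneg hk]
    exact mul_le_mul_of_nonneg_left h1 hk
  refine ⟨ρ, fun k => ⟨fun q u hu => ?_, ?_, fun x => ?_,
    abs_chartDeriv_le hX.smooth (by positivity) (hvar k), fun x => ?_⟩⟩
  · obtain ⟨C, t, ht, hCt⟩ := exists_inducedEDist_le_mul hX.smooth hu
    refine ⟨C, t, ht, LipschitzOnWith.of_dist_le_mul fun y hy z hz => ?_⟩
    have h1 := hvar k _ _ (C * ‖z - y‖) (by positivity) (hCt y hy z hz)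
    rw [Real.dist_eq, dist_comm, dist_eq_norm]
    refine h1.trans (mul_le_of_le_one_left (by positivity) ?_)
    exact inv_le_one_of_one_le₀ (by linarith [(Nat.cast_nonneg k : (0 : ℝ) ≤ k)])
  · obtain ⟨K, hK, hKs⟩ := exists_isCompact_of_complete hX hc p
      (r := ENNReal.ofReal (2 * ((k : ℝ) + 1))) ENNReal.ofReal_ne_top
    refine HasCompactSupport.intro hK fun x hx => ?_
    have h1 : 2 * ((k : ℝ) + 1) ≤ D x := by
      by_contra! hcon
      refine hx (hKs ?_)
      exact (ENNReal.lt_ofReal_iff_toReal_lt (hfin x)).2 hcon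
    have hk : (0 : ℝ) < (k : ℝ) + 1 := by positivity
    have h2 : 2 ≤ ((k : ℝ) + 1)⁻¹ * D x := by
      rw [le_inv_mul_iff₀ hk]; linarith
    simp only [hρ]
    exact max_eq_left ((min_le_right _ _).trans (by linarith))
  · rw [abs_of_nonneg (le_max_left _ _)]
    exact max_le zero_le_one (min_le_left _ _)
  · have h1 : Tendsto (fun k : ℕ => 2 - ((k : ℝ) + 1)⁻¹ * D x) atTop (𝓝 (2 - 0 * D x)) := by
      refine tendsto_const_nhds.sub (Tendsto.mul_const _ ?_)
      simpa using tendsto_one_div_add_atTop_nhds_zero_nat (𝕜 := ℝ)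
    have h2 := (tendsto_const_nhds (x := (0 : ℝ))).max
      ((tendsto_const_nhds (x := (1 : ℝ))).min h1)
    norm_num at h2
    exact h2

end Cutoff

/-! ### Gaussian weights under polynomial area growth -/

section Gaussian

variable {E : Type*} [NormedAddCommGroup E]

/-- The constant is uniform over bounded centres and bounded scales, so that one function dominates
the Gaussians while both move. The decay comes from `z^m / m! ≤ e^z`. -/
lemma exp_neg_sq_le (m : ℕ) {R τ : ℝ} (hR : 0 ≤ R) (hτ : 0 < τ) :
    ∃ C : ℝ, 0 ≤ C ∧ ∀ x₀ : E, ‖x₀‖ ≤ R → ∀ t : ℝ, 0 < t → t ≤ τ → ∀ y : E,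
      Real.exp (-‖y - x₀‖ ^ 2 / (2 * t)) ≤ C * ((1 + ‖y‖) ^ m)⁻¹ := by
  refine ⟨Real.exp (1 / (2 * τ)) * m.factorial * (4 * τ) ^ m * (1 + R) ^ m, by positivity,
    fun x₀ hx₀ t ht htτ y => ?_⟩
  set r := ‖y - x₀‖ with hr
  have hr0 : 0 ≤ r := norm_nonneg _
  have hy : ‖y‖ ≤ r + R := by
    have := norm_add_le (y - x₀) x₀
    rw [sub_add_cancel] at this
    linarith
  -- The added `1` keeps `z` positive and makes `1 + ‖y‖` at most a constant times `z`. It costs the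
  -- factor `e^{1/(2τ)}`.
  set z := (1 + r ^ 2) / (2 * τ) with hz
  have hz0 : 0 < z := by positivity
  have h1 : Real.exp (-r ^ 2 / (2 * t)) ≤ Real.exp (1 / (2 * τ)) * Real.exp (-z) := by
    rw [← Real.exp_add]
    refine Real.exp_le_exp.2 ?_
    have : 1 / (2 * τ) + -z = -(r ^ 2 / (2 * τ)) := by rw [hz]; field_simp; ring
    rw [this, neg_div]
    refine neg_le_neg ?_
    exact div_le_div_of_nonneg_left (sq_nonneg _) (by positivity) (by linarith)
  have h2 : Real.exp (-z) ≤ m.factorial * (z ^ m)⁻¹ := by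
    have h3 := Real.pow_div_factorial_le_exp z hz0.le m
    rw [Real.exp_neg]
    have h4 : 0 < z ^ m / (m.factorial : ℝ) := by positivity
    refine (inv_anti₀ h4 h3).trans_eq ?_
    rw [inv_div, div_eq_mul_inv]
  have h5 : (1 + ‖y‖) ^ m ≤ (z * (4 * τ * (1 + R))) ^ m := by
    refine pow_le_pow_left₀ (by positivity) ?_ m
    have : z * (4 * τ * (1 + R)) = 2 * (1 + r ^ 2) * (1 + R) := by
      rw [hz]; field_simp; ring
    rw [this]
    nlinarith [sq_nonneg (r - 1), mul_nonneg hR (sq_nonneg r), mul_nonneg hR (sq_nonneg (r - 1))]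
  have h6 : 0 < (1 + ‖y‖) ^ m := by positivity
  rw [← div_eq_mul_inv, le_div_iff₀ h6]
  calc Real.exp (-r ^ 2 / (2 * t)) * (1 + ‖y‖) ^ m
      ≤ (Real.exp (1 / (2 * τ)) * (m.factorial * (z ^ m)⁻¹)) * (z * (4 * τ * (1 + R))) ^ m :=
        mul_le_mul (h1.trans (mul_le_mul_of_nonneg_left h2 (Real.exp_pos _).le)) h5
          h6.le (by positivity)
    _ = _ := by
        have : z ^ m ≠ 0 := by positivity
        rw [mul_pow, mul_pow]
        field_simp

variable {n : ℕ} {M : Type*} [TopologicalSpace M] [ChartedSpace (Euc n) M] [MeasurableSpace M]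
  [BorelSpace M] {X : M → Euc (n + 1)}

/-- Cut into the shells `k ≤ |X| < k+1`, of area at most `|C| (k+1)^d`. On them the integrand is at
most `(k+1)^{-q}`, and `q ≥ d + 2` leaves the summable `(k+1)^{-2}`. -/
lemma HasPolynomialAreaGrowth.exists_integrable (hg : HasPolynomialAreaGrowth X)
    (hX : Continuous X) : ∃ q : ℕ, Integrable (fun x => ((1 + ‖X x‖) ^ q)⁻¹) (area X) := by
  obtain ⟨C, d, hCd⟩ := hg
  obtain ⟨q, hq⟩ := exists_nat_ge (d + 2)
  refine ⟨q, ?_⟩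
  have hcont : Continuous fun x => ((1 + ‖X x‖) ^ q)⁻¹ :=
    Continuous.inv₀ (by fun_prop) fun x => by positivity
  refine ⟨hcont.measurable.aestronglyMeasurable, ?_⟩
  rw [hasFiniteIntegral_iff_ofReal (Eventually.of_forall fun x => by positivity)]
  set S : ℕ → Set M := fun k => X ⁻¹' (Metric.ball 0 ((k : ℝ) + 1) \ Metric.ball 0 k) with hS
  have hSU : ⋃ k, S k = univ := by
    refine eq_univ_of_forall fun x => mem_iUnion.2 ⟨⌊‖X x‖⌋₊, ?_, ?_⟩
    · rw [mem_ball_zero_iff]; exact Nat.lt_floor_add_one _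
    · rw [mem_ball_zero_iff, not_lt]; exact Nat.floor_le (norm_nonneg _)
  have hbound : ∀ k : ℕ, ∫⁻ x in S k, ENNReal.ofReal ((1 + ‖X x‖) ^ q)⁻¹ ∂(area X) ≤
      ENNReal.ofReal (|C| * (1 / ((k + 1 : ℕ) : ℝ) ^ 2)) := by
    intro k
    have hk1 : (1 : ℝ) ≤ (k : ℝ) + 1 := by linarith [(Nat.cast_nonneg k : (0 : ℝ) ≤ k)]
    have hk0 : (0 : ℝ) < (k : ℝ) + 1 := by linarith
    calc ∫⁻ x in S k, ENNReal.ofReal ((1 + ‖X x‖) ^ q)⁻¹ ∂(area X)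
        ≤ ∫⁻ x in S k, ENNReal.ofReal (((k : ℝ) + 1) ^ q)⁻¹ ∂(area X) := by
          refine setLIntegral_mono measurable_const fun x hx => ENNReal.ofReal_le_ofReal ?_
          have h1 : (k : ℝ) ≤ ‖X x‖ := by
            have := hx.2
            rwa [mem_ball_zero_iff, not_lt] at this
          exact inv_anti₀ (by positivity) (pow_le_pow_left₀ hk0.le (by linarith) q)
      _ = ENNReal.ofReal (((k : ℝ) + 1) ^ q)⁻¹ * area X (S k) := by
          rw [setLIntegral_const]
      _ ≤ ENNReal.ofReal (((k : ℝ) + 1) ^ q)⁻¹ * ENNReal.ofReal (|C| * ((k : ℝ) + 1) ^ d) := by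
          refine mul_le_mul_right ?_ _
          refine ((measure_mono (preimage_mono sdiff_subset)).trans (hCd _ hk1)).trans
            (ENNReal.ofReal_le_ofReal ?_)
          exact mul_le_mul_of_nonneg_right (le_abs_self C) (by positivity)
      _ ≤ ENNReal.ofReal (|C| * (1 / ((k + 1 : ℕ) : ℝ) ^ 2)) := by
          rw [← ENNReal.ofReal_mul (by positivity)]
          refine ENNReal.ofReal_le_ofReal ?_
          have h1 : ((k : ℝ) + 1) ^ d * ((k : ℝ) + 1) ^ 2 ≤ ((k : ℝ) + 1) ^ q := by
            rw [← Real.rpow_natCast _ 2, ← Real.rpow_natCast _ q, ← Real.rpow_add hk0]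
            exact Real.rpow_le_rpow_of_exponent_le hk1 (by exact_mod_cast hq)
          have h2 : (((k : ℝ) + 1) ^ q)⁻¹ * ((k : ℝ) + 1) ^ d ≤ 1 / ((k : ℝ) + 1) ^ 2 := by
            rw [le_div_iff₀ (by positivity), mul_assoc, inv_mul_le_iff₀ (by positivity), mul_one]
            exact h1
          push_cast
          calc _ = |C| * ((((k : ℝ) + 1) ^ q)⁻¹ * ((k : ℝ) + 1) ^ d) := by ring
            _ ≤ _ := mul_le_mul_of_nonneg_left h2 (abs_nonneg C)
  have hsum : Summable fun k : ℕ => |C| * (1 / ((k + 1 : ℕ) : ℝ) ^ 2) :=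
    Summable.mul_left _ ((summable_nat_add_iff 1).2 (Real.summable_one_div_nat_pow.2 one_lt_two))
  calc ∫⁻ x, ENNReal.ofReal ((1 + ‖X x‖) ^ q)⁻¹ ∂(area X)
      = ∫⁻ x in ⋃ k, S k, ENNReal.ofReal ((1 + ‖X x‖) ^ q)⁻¹ ∂(area X) := by
        rw [hSU, Measure.restrict_univ]
    _ ≤ ∑' k, ∫⁻ x in S k, ENNReal.ofReal ((1 + ‖X x‖) ^ q)⁻¹ ∂(area X) :=
        lintegral_iUnion_le _ _
    _ ≤ ∑' k : ℕ, ENNReal.ofReal (|C| * (1 / ((k + 1 : ℕ) : ℝ) ^ 2)) :=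
        ENNReal.tsum_le_tsum hbound
    _ < ⊤ := by
        rw [← ENNReal.ofReal_tsum_of_nonneg (fun k => by positivity) hsum]
        exact ENNReal.ofReal_lt_top

/-- A continuous function growing polynomially in `X` is integrable against a Gaussian weight. -/
lemma HasPolynomialAreaGrowth.integrable_gaussian_mul (hg : HasPolynomialAreaGrowth X)
    (hX : Continuous X) (X₀ : Euc (n + 1)) {t : ℝ} (ht : 0 < t) {f : M → ℝ} (hf : Continuous f)
    {B : ℝ} {m : ℕ} (hfB : ∀ x, |f x| ≤ B * (1 + ‖X x‖) ^ m) :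
    Integrable (fun x => Real.exp (-‖X x - X₀‖ ^ 2 / (2 * t)) * f x) (area X) := by
  obtain ⟨q, hq⟩ := hg.exists_integrable hX
  obtain ⟨C, hC0, hC⟩ := exp_neg_sq_le (E := Euc (n + 1)) (q + m) (norm_nonneg X₀) ht
  refine (hq.const_mul (C * B)).mono' (by fun_prop) (Eventually.of_forall fun x => ?_)
  rw [Real.norm_eq_abs, abs_mul, abs_of_pos (Real.exp_pos _)]
  have h1 : (0 : ℝ) < (1 + ‖X x‖) ^ m := by positivity
  have h2 : (0 : ℝ) < (1 + ‖X x‖) ^ q := by positivity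
  calc Real.exp (-‖X x - X₀‖ ^ 2 / (2 * t)) * |f x|
      ≤ (C * ((1 + ‖X x‖) ^ (q + m))⁻¹) * (B * (1 + ‖X x‖) ^ m) :=
        mul_le_mul (hC X₀ le_rfl t ht le_rfl _) (hfB x) (abs_nonneg _) (by positivity)
    _ = C * B * ((1 + ‖X x‖) ^ q)⁻¹ := by
        rw [pow_add]; field_simp

end Gaussian

/-! ### The weighted divergence of translation and dilation fields -/

section GlobalIdentity

variable {n : ℕ} {M : Type*} [TopologicalSpace M] [ChartedSpace (Euc n) M]
  {X N : M → Euc (n + 1)}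

/-- The Gaussian weight `e^{-|X - X₀|²/(2t)}`. -/
def gaussWeight (X : M → Euc (n + 1)) (X₀ : Euc (n + 1)) (t : ℝ) (x : M) : ℝ :=
  Real.exp (-‖X x - X₀‖ ^ 2 / (2 * t))

lemma hasFDerivAt_gauss {k : ℕ} (X₀ : Euc k) (t : ℝ) (y : Euc k) :
    HasFDerivAt (fun y => Real.exp (-‖y - X₀‖ ^ 2 / (2 * t)))
      (Real.exp (-‖y - X₀‖ ^ 2 / (2 * t)) • (-t⁻¹ • innerSL ℝ (y - X₀))) y := by
  have h1 : HasFDerivAt (fun y : Euc k => y - X₀) (ContinuousLinearMap.id ℝ (Euc k)) y :=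
    (hasFDerivAt_id y).sub_const X₀
  have h2 := ((h1.norm_sq.neg.mul_const (2 * t)⁻¹)).exp
  refine h2.congr_fderiv ?_
  ext1 v
  simp [div_eq_mul_inv]
  ring

lemma contDiff_gauss {k : ℕ} (X₀ : Euc k) (t : ℝ) :
    ContDiff ℝ ∞ fun y : Euc k => Real.exp (-‖y - X₀‖ ^ 2 / (2 * t)) :=
  Real.contDiff_exp.comp (((contDiff_id.sub contDiff_const).norm_sq ℝ).neg.div_const _)

lemma contMDiff_gaussWeight (hX : ContMDiff (𝓡 n) 𝓘(ℝ, Euc (n + 1)) ∞ X) (X₀ : Euc (n + 1))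
    (t : ℝ) : ContMDiff (𝓡 n) 𝓘(ℝ, ℝ) ∞ (gaussWeight X X₀ t) :=
  (contDiff_gauss X₀ t).comp_contMDiff hX

variable [IsManifold (𝓡 n) ∞ M]

lemma chartDeriv_gaussWeight (hX : ContMDiff (𝓡 n) 𝓘(ℝ, Euc (n + 1)) ∞ X) (X₀ : Euc (n + 1))
    (t : ℝ) (x : M) (v : Euc n) :
    chartDeriv n (gaussWeight X X₀ t) x v =
      gaussWeight X X₀ t x * (-t⁻¹ * inner ℝ (X x - X₀) (chartDeriv n X x v)) := by
  have h1 := (differentiableAt_chartRep hX (mem_chart_target (Euc n) x)).hasFDerivAt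
  have h2 := (hasFDerivAt_gauss X₀ t _).comp _ h1
  have h3 : chartDeriv n (gaussWeight X X₀ t) x = _ := h2.fderiv
  rw [h3, chartRep_self]
  simp [gaussWeight, chartDeriv, inner_sub_left]

/-- The field `a + c(X-X₀)` has trace `n c`, because `dX` has trace `n`. The weight is
differentiated only along the tangential part of the field, and the missing normal part of `⟨X-X₀,
·⟩` joins the mean curvature to form the left side of the Euler–Lagrange equation. -/
lemma normalDivergence_gaussWeight_smul (hX : IsImmersedHypersurface X) (hN : IsUnitNormal X N)
    (X₀ : Euc (n + 1)) (t : ℝ) (a : Euc (n + 1)) (c : ℝ) (x : M) :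
    normalDivergence X N (fun y => gaussWeight X X₀ t y • (a + c • (X y - X₀))) x =
      gaussWeight X X₀ t x * (n * c - t⁻¹ * inner ℝ (X x - X₀) (a + c • (X x - X₀)) +
        (meanCurvature X N x + inner ℝ (t⁻¹ • (X x - X₀)) (N x)) *
          inner ℝ (a + c • (X x - X₀)) (N x)) := by
  have hxt := mem_chart_target (Euc n) x
  have hXd := differentiableAt_chartRep hX.smooth hxt
  set Z : M → Euc (n + 1) := fun y => a + c • (X y - X₀) with hZ
  have hZd : HasFDerivAt (chartRep n Z x) (c • chartDeriv n X x) (chartAt (Euc n) x x) :=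
    ((hXd.hasFDerivAt.sub_const X₀).const_smul c).const_add a
  have hinj := hX.injective_chartDeriv x
  have hZ' : chartDeriv n Z x = c • chartDeriv n X x := hZd.fderiv
  rw [normalDivergence_smul (differentiableAt_chartRep (contMDiff_gaussWeight hX.smooth X₀ t) hxt)
    hZd.differentiableAt, normalDivergence, hZ', metricTrace_smul, metricTrace_self hinj,
    metricTrace_smulRight, chartDeriv_gaussWeight hX.smooth X₀ t, meanCurvature_eq hX hN]
  have hdec := eq_map_tangPart_add_normal hinj (hN.norm_eq_one x) (hN.inner_chartDeriv hX x) (Z x)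
  have h1 : inner ℝ (X x - X₀) (chartDeriv n X x (tangPart (chartDeriv n X x) (Z x))) =
      inner ℝ (X x - X₀) (Z x) - inner ℝ (Z x) (N x) * inner ℝ (X x - X₀) (N x) := by
    conv_rhs => enter [1]; rw [hdec]
    rw [inner_add_right, inner_smul_right]; ring
  rw [h1, inner_smul_left]
  simp only [conj_trivial]
  change _ = gaussWeight X X₀ t x * (n * c - t⁻¹ * inner ℝ (X x - X₀) (Z x) + _ *
    inner ℝ (Z x) (N x))
  ring

variable [MeasurableSpace M] [BorelSpace M] [SecondCountableTopology M] [T2Space M]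
  [ConnectedSpace M]

/-- On a complete hypersurface the divergence of a smooth field integrates to zero as soon as the
field and the integrand are integrable. -/
theorem integral_normalDivergence_eq_zero_of_complete (hX : IsImmersedHypersurface X)
    (hN : IsUnitNormal X N) (hc : IsCompleteHypersurface X) {V : M → Euc (n + 1)}
    (hV : ContMDiff (𝓡 n) 𝓘(ℝ, Euc (n + 1)) ∞ V) (hVi : Integrable (fun x => ‖V x‖) (area X))
    (hdiv : Integrable (normalDivergence X N V) (area X)) :
    ∫ x, normalDivergence X N V x ∂(area X) = 0 := by
  obtain ⟨ρ, hρ⟩ := exists_cutoff hX hc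
  set G := normalDivergence X N V with hG
  have hρc : ∀ k, Continuous (ρ k) := fun k => continuous_of_charts n fun p =>
    ⟨chartRep n (ρ k) p, ((hρ k).1 p _ (mem_chart_target _ p)).continuousAt, fun u _ => rfl⟩
  have hρG : ∀ k, Integrable (fun x => ρ k x * G x) (area X) := fun k =>
    hdiv.norm.mono' ((hρc k).aestronglyMeasurable.mul hdiv.aestronglyMeasurable)
      (Eventually.of_forall fun x => by
        rw [norm_mul]
        exact mul_le_of_le_one_left (norm_nonneg _) ((hρ k).2.2.1 x))
  have hbound : ∀ k : ℕ, ‖∫ x, ρ k x * G x ∂(area X)‖ ≤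
      ((k : ℝ) + 1)⁻¹ * ∫ x, ‖V x‖ ∂(area X) := by
    intro k
    obtain ⟨hlip, hcs, -, hgrad, -⟩ := hρ k
    obtain ⟨hint, hzero⟩ := integral_normalDivergence hX hN hV hlip hcs
    -- The divergence of `ρ V` is `ρ G + T`, and the gradient term `T` is at most `‖V‖/(k+1)`.
    set T : M → ℝ := fun x => metricTrace (chartDeriv n X x)
      ((chartDeriv n (ρ k) x).smulRight (V x)) with hT
    have hae : normalDivergence X N (fun x => ρ k x • V x) =ᵐ[area X]
        fun x => ρ k x * G x + T x := by
      filter_upwards [ae_differentiableAt_chartRep hX hlip] with x hx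
      exact normalDivergence_smul hx (differentiableAt_chartRep hV (mem_chart_target _ x))
    have hTi : Integrable T (area X) := by
      refine ((hint.congr hae).sub (hρG k)).congr (Eventually.of_forall fun x => ?_)
      simp
    rw [integral_congr_ae hae, integral_add (hρG k) hTi] at hzero
    rw [eq_neg_of_add_eq_zero_left hzero, norm_neg, ← integral_const_mul]
    refine (norm_integral_le_integral_norm _).trans
      (integral_mono hTi.norm (hVi.const_mul _) fun x => ?_)
    exact abs_metricTrace_smulRight_le (hX.injective_chartDeriv x) (by positivity) (hgrad x) (V x)
  have hlim0 : Tendsto (fun k : ℕ => ∫ x, ρ k x * G x ∂(area X)) atTop (𝓝 0) := by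
    refine squeeze_zero_norm hbound ?_
    have h1 : Tendsto (fun k : ℕ => ((k : ℝ) + 1)⁻¹) atTop (𝓝 0) := by
      simpa using tendsto_one_div_add_atTop_nhds_zero_nat (𝕜 := ℝ)
    simpa using h1.mul_const (∫ x, ‖V x‖ ∂(area X))
  have hlim1 : Tendsto (fun k : ℕ => ∫ x, ρ k x * G x ∂(area X)) atTop
      (𝓝 (∫ x, G x ∂(area X))) := by
    refine tendsto_integral_of_dominated_convergence (fun x => ‖G x‖)
      (fun k => (hρG k).aestronglyMeasurable) hdiv.norm
      (fun k => Eventually.of_forall fun x => ?_) (Eventually.of_forall fun x => ?_)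
    · rw [norm_mul]
      exact mul_le_of_le_one_left (norm_nonneg _) ((hρ k).2.2.1 x)
    · simpa using ((hρ 0).2.2.2.2 x).mul_const (G x)
  exact tendsto_nhds_unique hlim1 hlim0

/-- For a `λ`-hypersurface, translations and dilations of the weighted area and of the weighted
volume balance each other. -/
theorem integral_gaussWeight_mul_eq_zero (hX : IsImmersedHypersurface X) (hN : IsUnitNormal X N)
    (hc : IsCompleteHypersurface X) (hg : HasPolynomialAreaGrowth X) (X₀ : Euc (n + 1)) {t₀ : ℝ}
    (ht₀ : 0 < t₀) {lam : ℝ}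
    (heq : ∀ p : M, meanCurvature X N p + inner ℝ (t₀⁻¹ • (X p - X₀)) (N p) = lam)
    (a : Euc (n + 1)) (c : ℝ) :
    ∫ x, gaussWeight X X₀ t₀ x * (n * c - t₀⁻¹ * inner ℝ (X x - X₀) (a + c • (X x - X₀)) +
        lam * inner ℝ (a + c • (X x - X₀)) (N x)) ∂(area X) = 0 := by
  have hXc := hX.smooth.continuous
  have hNc := hN.smooth.continuous
  set Z : M → Euc (n + 1) := fun y => a + c • (X y - X₀) with hZ
  set A : ℝ := ‖a‖ + |c| * (1 + ‖X₀‖) with hA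
  have hA0 : 0 ≤ A := by positivity
  have hsub : ∀ x, ‖X x - X₀‖ ≤ (1 + ‖X₀‖) * (1 + ‖X x‖) := fun x => by
    refine (norm_sub_le _ _).trans ?_
    nlinarith [norm_nonneg (X x), norm_nonneg X₀]
  have hZb : ∀ x, ‖Z x‖ ≤ A * (1 + ‖X x‖) := fun x => by
    calc ‖Z x‖ ≤ ‖a‖ + |c| * ‖X x - X₀‖ := by
          refine (norm_add_le _ _).trans ?_
          rw [norm_smul, Real.norm_eq_abs]
      _ ≤ ‖a‖ * (1 + ‖X x‖) + |c| * ((1 + ‖X₀‖) * (1 + ‖X x‖)) := by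
          refine add_le_add ?_ (mul_le_mul_of_nonneg_left (hsub x) (abs_nonneg c))
          exact le_mul_of_one_le_right (norm_nonneg a) (by linarith [norm_nonneg (X x)])
      _ = A * (1 + ‖X x‖) := by rw [hA]; ring
  have hZc : Continuous Z := by fun_prop
  set V : M → Euc (n + 1) := fun y => gaussWeight X X₀ t₀ y • Z y with hV
  have hVs : ContMDiff (𝓡 n) 𝓘(ℝ, Euc (n + 1)) ∞ V := by
    have h1 : ContDiff ℝ ∞ fun y : Euc (n + 1) =>
        Real.exp (-‖y - X₀‖ ^ 2 / (2 * t₀)) • (a + c • (y - X₀)) :=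
      (contDiff_gauss X₀ t₀).smul (contDiff_const.add
        ((contDiff_id.sub contDiff_const).const_smul c))
    exact h1.comp_contMDiff hX.smooth
  -- The Euler–Lagrange equation replaces the curvature factor by `λ`, so this divergence is the
  -- integrand of the claim. The rest checks integrability.
  have hnd : normalDivergence X N V = fun x => gaussWeight X X₀ t₀ x *
      (n * c - t₀⁻¹ * inner ℝ (X x - X₀) (Z x) + lam * inner ℝ (Z x) (N x)) := by
    ext x
    rw [hV, normalDivergence_gaussWeight_smul hX hN X₀ t₀ a c x, heq x]
  have hVi : Integrable (fun x => ‖V x‖) (area X) := by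
    have := hg.integrable_gaussian_mul hXc X₀ ht₀ (f := fun x => ‖Z x‖) hZc.norm (B := A) (m := 1)
      fun x => by rw [abs_of_nonneg (norm_nonneg _), pow_one]; exact hZb x
    refine this.congr (Eventually.of_forall fun x => ?_)
    simp only [hV, norm_smul, gaussWeight, Real.norm_eq_abs, abs_of_pos (Real.exp_pos _)]
  have hdiv : Integrable (normalDivergence X N V) (area X) := by
    rw [hnd]
    refine hg.integrable_gaussian_mul hXc X₀ ht₀ (m := 2)
      (B := n * |c| + t₀⁻¹ * ((1 + ‖X₀‖) * A) + |lam| * A) (by fun_prop) fun x => ?_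
    have hx1 : 1 ≤ 1 + ‖X x‖ := by linarith [norm_nonneg (X x)]
    have hx2 : 1 ≤ (1 + ‖X x‖) ^ 2 := one_le_pow₀ hx1
    have hx3 : 1 + ‖X x‖ ≤ (1 + ‖X x‖) ^ 2 := by nlinarith
    have e1 : |inner ℝ (X x - X₀) (Z x)| ≤ (1 + ‖X₀‖) * A * (1 + ‖X x‖) ^ 2 := by
      refine (abs_real_inner_le_norm _ _).trans ?_
      calc ‖X x - X₀‖ * ‖Z x‖ ≤ ((1 + ‖X₀‖) * (1 + ‖X x‖)) * (A * (1 + ‖X x‖)) :=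
            mul_le_mul (hsub x) (hZb x) (norm_nonneg _) (by positivity)
        _ = _ := by ring
    have e2 : |inner ℝ (Z x) (N x)| ≤ A * (1 + ‖X x‖) ^ 2 := by
      refine (abs_real_inner_le_norm _ _).trans ?_
      rw [hN.norm_eq_one, mul_one]
      exact (hZb x).trans (mul_le_mul_of_nonneg_left hx3 hA0)
    calc |n * c - t₀⁻¹ * inner ℝ (X x - X₀) (Z x) + lam * inner ℝ (Z x) (N x)|
        ≤ |n * c| + |t₀⁻¹ * inner ℝ (X x - X₀) (Z x)| + |lam * inner ℝ (Z x) (N x)| :=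
          (abs_add_le _ _).trans (add_le_add (abs_sub _ _) le_rfl)
      _ = n * |c| + t₀⁻¹ * |inner ℝ (X x - X₀) (Z x)| + |lam| * |inner ℝ (Z x) (N x)| := by
          rw [abs_mul, abs_mul, abs_mul, Nat.abs_cast, abs_of_pos (inv_pos.2 ht₀)]
      _ ≤ n * |c| * (1 + ‖X x‖) ^ 2 + t₀⁻¹ * ((1 + ‖X₀‖) * A * (1 + ‖X x‖) ^ 2) +
          |lam| * (A * (1 + ‖X x‖) ^ 2) := by
          have hn : (0 : ℝ) ≤ n * |c| := by positivity
          have ht : 0 ≤ t₀⁻¹ := (inv_pos.2 ht₀).le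
          have h0 : n * |c| ≤ n * |c| * (1 + ‖X x‖) ^ 2 := le_mul_of_one_le_right hn hx2
          gcongr
      _ = _ := by ring
  have := integral_normalDivergence_eq_zero_of_complete hX hN hc hVs hVi hdiv
  rwa [hnd] at this

end GlobalIdentity

/-! ### Differentiation under the integral sign -/

section Parametric

variable {n : ℕ} {M : Type*} [TopologicalSpace M] [ChartedSpace (Euc n) M]

/-- A family of functions on the manifold, read in the preferred chart at `p`. -/
def familyRep {F : Type*} (n : ℕ) [ChartedSpace (Euc n) M] (Q : ℝ → M → F) (p : M) :
    ℝ × Euc n → F :=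
  fun z => chartRep n (Q z.1) p z.2

lemma hasDerivAt_familyRep {F : Type*} [NormedAddCommGroup F] [NormedSpace ℝ F] {Q : ℝ → M → F}
    {p x : M} (hx : x ∈ (chartAt (Euc n) p).source) {s : ℝ}
    (h : DifferentiableAt ℝ (familyRep n Q p) (s, chartAt (Euc n) p x)) :
    HasDerivAt (fun τ => Q τ x)
      (fderiv ℝ (familyRep n Q p) (s, chartAt (Euc n) p x) (1, 0)) s := by
  have h1 : HasDerivAt (fun τ : ℝ => (τ, chartAt (Euc n) p x)) ((1 : ℝ), (0 : Euc n)) s :=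
    (hasDerivAt_id s).prodMk (hasDerivAt_const s _)
  have h2 := HasFDerivAt.comp_hasDerivAt (l := familyRep n Q p)
    (f := fun τ : ℝ => (τ, chartAt (Euc n) p x)) s h.hasFDerivAt h1
  refine h2.congr_of_eventuallyEq (Eventually.of_forall fun τ => ?_)
  exact (chartRep_chartAt (Q τ) hx).symm

lemma tendsto_family_coord (p : M) :
    Tendsto (fun z : ℝ × M => (z.1, chartAt (Euc n) p z.2)) (𝓝 (0, p))
      (𝓝 (0, chartAt (Euc n) p p)) := by
  have h1 : ContinuousAt (chartAt (Euc n) p) p :=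
    (chartAt (Euc n) p).continuousAt (mem_chart_source _ p)
  exact (continuousAt_fst.prodMk (ContinuousAt.comp (f := fun z : ℝ × M => z.2)
    (x := ((0 : ℝ), p)) h1 continuousAt_snd)).tendsto

/-- Local bounds for the parameter derivative of a jointly `C¹` family. -/
lemma eventually_hasDerivAt_bound {Q : ℝ → M → ℝ} {p : M}
    (hQ : ContDiffAt ℝ 1 (familyRep n Q p) (0, chartAt (Euc n) p p)) :
    ∃ C : ℝ, ∀ᶠ z : ℝ × M in 𝓝 (0, p),
      DifferentiableAt ℝ (fun τ => Q τ z.2) z.1 ∧ |deriv (fun τ => Q τ z.2) z.1| ≤ C := by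
  set z₀ : ℝ × Euc n := (0, chartAt (Euc n) p p) with hz₀
  have hcont : ContinuousAt (fun z => fderiv ℝ (familyRep n Q p) z (1, 0)) z₀ :=
    (hQ.fderiv_right (m := 0) (by norm_num)).continuousAt.clm_apply continuousAt_const
  have h1 : ∀ᶠ z in 𝓝 z₀, DifferentiableAt ℝ (familyRep n Q p) z :=
    (hQ.eventually (by simp)).mono fun z hz => hz.differentiableAt one_ne_zero
  have h2 := hcont.abs.eventually (gt_mem_nhds (lt_add_one _))
  refine ⟨|fderiv ℝ (familyRep n Q p) z₀ (1, 0)| + 1, ?_⟩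
  filter_upwards [(tendsto_family_coord p).eventually (h1.and h2),
    continuousAt_snd.preimage_mem_nhds ((chartAt (Euc n) p).open_source.mem_nhds
      (mem_chart_source (Euc n) p))] with z hz hzs
  have h3 := hasDerivAt_familyRep hzs hz.1
  refine ⟨h3.differentiableAt, ?_⟩
  rw [h3.deriv]
  exact hz.2.le

lemma continuous_deriv_family {Q : ℝ → M → ℝ}
    (hQ : ∀ p, ContDiffAt ℝ 1 (familyRep n Q p) (0, chartAt (Euc n) p p)) :
    Continuous fun x => deriv (fun τ => Q τ x) 0 := by
  refine continuous_iff_continuousAt.2 fun p => ?_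
  set z₀ : ℝ × Euc n := (0, chartAt (Euc n) p p) with hz₀
  have hcont : ContinuousAt (fun z => fderiv ℝ (familyRep n Q p) z (1, 0)) z₀ :=
    ((hQ p).fderiv_right (m := 0) (by norm_num)).continuousAt.clm_apply continuousAt_const
  have h1 : ∀ᶠ z in 𝓝 z₀, DifferentiableAt ℝ (familyRep n Q p) z :=
    ((hQ p).eventually (by simp)).mono fun z hz => hz.differentiableAt one_ne_zero
  have hlim : Tendsto (fun x : M => ((0 : ℝ), chartAt (Euc n) p x)) (𝓝 p) (𝓝 z₀) :=
    (tendsto_family_coord p).comp (Continuous.tendsto (f := fun x : M => ((0 : ℝ), x))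
      (by fun_prop) p)
  refine ContinuousAt.congr (f := fun x => fderiv ℝ (familyRep n Q p)
    (0, chartAt (Euc n) p x) (1, 0)) (hcont.tendsto.comp hlim) ?_
  filter_upwards [hlim.eventually h1, (chartAt (Euc n) p).open_source.mem_nhds
    (mem_chart_source (Euc n) p)] with x hx hxs
  exact (hasDerivAt_familyRep hxs hx).deriv.symm

/-- Differentiation under the integral sign for a jointly `C¹` family whose derivative is dominated
outside a compact set. -/
lemma hasDerivAt_integral_family [MeasurableSpace M] [BorelSpace M] [T2Space M]
    [SecondCountableTopology M] {μ : Measure M} {Q : ℝ → M → ℝ} {K : Set M}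
    (hQ : ∀ p, ContDiffAt ℝ 1 (familyRep n Q p) (0, chartAt (Euc n) p p))
    (hK : IsCompact K) (hμK : μ K ≠ ⊤) (hcont : ∀ᶠ s in 𝓝 (0 : ℝ), Continuous (Q s))
    (hint : Integrable (Q 0) μ) {bound : M → ℝ} (hbound : Integrable bound μ)
    (hb0 : ∀ x, 0 ≤ bound x)
    (hoff : ∀ᶠ s in 𝓝 (0 : ℝ), ∀ x ∉ K, DifferentiableAt ℝ (fun τ => Q τ x) s ∧
      |deriv (fun τ => Q τ x) s| ≤ bound x) :
    Integrable (fun x => deriv (fun τ => Q τ x) 0) μ ∧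
      HasDerivAt (fun s => ∫ x, Q s x ∂μ) (∫ x, deriv (fun τ => Q τ x) 0 ∂μ) 0 := by
  -- Joint `C¹` regularity bounds the parameter derivative near each point `(0, p)`. Compactness of
  -- `K` makes the bound and the range of `s` uniform, and a constant is integrable on `K`.
  have hcompact : ∃ C : ℝ, ∀ᶠ s in 𝓝 (0 : ℝ), ∀ x ∈ K, DifferentiableAt ℝ (fun τ => Q τ x) s ∧
      |deriv (fun τ => Q τ x) s| ≤ C := by
    refine hK.induction_on (p := fun S => ∃ C : ℝ, ∀ᶠ s in 𝓝 (0 : ℝ), ∀ x ∈ S,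
      DifferentiableAt ℝ (fun τ => Q τ x) s ∧ |deriv (fun τ => Q τ x) s| ≤ C) ?_ ?_ ?_ ?_
    · exact ⟨0, by simp⟩
    · rintro S S' hSS' ⟨C, hC⟩
      exact ⟨C, hC.mono fun s hs x hx => hs x (hSS' hx)⟩
    · rintro S S' ⟨C, hC⟩ ⟨C', hC'⟩
      refine ⟨max C C', ?_⟩
      filter_upwards [hC, hC'] with s hs hs' x hx
      rcases hx with hx | hx
      · exact ⟨(hs x hx).1, (hs x hx).2.trans (le_max_left _ _)⟩
      · exact ⟨(hs' x hx).1, (hs' x hx).2.trans (le_max_right _ _)⟩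
    · intro p _
      obtain ⟨C, hC⟩ := eventually_hasDerivAt_bound (hQ p)
      rw [nhds_prod_eq, eventually_prod_iff] at hC
      obtain ⟨P, hP, P', hP', hPP'⟩ := hC
      exact ⟨{x | P' x}, mem_nhdsWithin_of_mem_nhds hP', C, hP.mono fun s hs x hx => hPP' hs hx⟩
  obtain ⟨C, hC⟩ := hcompact
  have hmain : ∀ᶠ s in 𝓝 (0 : ℝ), ∀ x, DifferentiableAt ℝ (fun τ => Q τ x) s ∧
      |deriv (fun τ => Q τ x) s| ≤ K.indicator (fun _ => |C|) x + bound x := by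
    filter_upwards [hC, hoff] with s h1 h2 x
    by_cases hx : x ∈ K
    · refine ⟨(h1 x hx).1, ?_⟩
      rw [indicator_of_mem hx]
      linarith [(h1 x hx).2, le_abs_self C, hb0 x]
    · refine ⟨(h2 x hx).1, ?_⟩
      rw [indicator_of_notMem hx, zero_add]
      exact (h2 x hx).2
  have hbi : Integrable (fun x => K.indicator (fun _ => |C|) x + bound x) μ :=
    (IntegrableOn.integrable_indicator (integrableOn_const hμK) hK.measurableSet).add hbound
  exact hasDerivAt_integral_of_dominated_loc_of_deriv_le (F' := fun s x => deriv (fun τ => Q τ x) s)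
    hmain (hcont.mono fun s hs => hs.aestronglyMeasurable) hint
    (continuous_deriv_family hQ).aestronglyMeasurable
    (Eventually.of_forall fun x s hs => (hs x).2) hbi
    (Eventually.of_forall fun x s hs => (hs x).1.hasDerivAt)

/-- The parameter derivative of the spatial differential is the differential of the parameter
derivative. -/
lemma hasDerivAt_fderiv_param {E F : Type*} [NormedAddCommGroup E] [NormedSpace ℝ E]
    [NormedAddCommGroup F] [NormedSpace ℝ F] {G : ℝ × E → F} {s₀ : ℝ} {u₀ : E}
    (hG : ContDiffAt ℝ 2 G (s₀, u₀)) :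
    HasDerivAt (fun s => fderiv ℝ (fun u => G (s, u)) u₀)
      (fderiv ℝ (fun u => fderiv ℝ G (s₀, u) (1, 0)) u₀) s₀ := by
  have hdG : DifferentiableAt ℝ (fderiv ℝ G) (s₀, u₀) :=
    (hG.fderiv_right (m := 1) le_rfl).differentiableAt one_ne_zero
  have hinr : ∀ s, HasFDerivAt (fun u : E => (s, u)) (ContinuousLinearMap.inr ℝ ℝ E) u₀ :=
    fun s => hasFDerivAt_prodMk_right s u₀
  have h1 : (fun s => fderiv ℝ (fun u => G (s, u)) u₀) =ᶠ[𝓝 s₀]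
      fun s => fderiv ℝ G (s, u₀) ∘L ContinuousLinearMap.inr ℝ ℝ E := by
    have h2 : ∀ᶠ z in 𝓝 (s₀, u₀), DifferentiableAt ℝ G z :=
      (hG.eventually (by simp)).mono fun z hz => hz.differentiableAt (by simp)
    have h3 : Tendsto (fun s : ℝ => (s, u₀)) (𝓝 s₀) (𝓝 (s₀, u₀)) :=
      (Continuous.tendsto (f := fun s : ℝ => (s, u₀)) (by fun_prop) s₀)
    filter_upwards [h3.eventually h2] with s hs
    exact (hs.hasFDerivAt.comp u₀ (hinr s)).fderiv
  have h4 : HasDerivAt (fun s : ℝ => (s, u₀)) ((1 : ℝ), (0 : E)) s₀ :=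
    (hasDerivAt_id s₀).prodMk (hasDerivAt_const s₀ _)
  have h5 : HasDerivAt (fun s => fderiv ℝ G (s, u₀)) (fderiv ℝ (fderiv ℝ G) (s₀, u₀) (1, 0)) s₀ :=
    HasFDerivAt.comp_hasDerivAt (l := fderiv ℝ G) (f := fun s : ℝ => (s, u₀)) s₀
      hdG.hasFDerivAt h4
  have h6 := ((ContinuousLinearMap.compL ℝ E (ℝ × E) F).flip
    (ContinuousLinearMap.inr ℝ ℝ E)).hasFDerivAt.comp_hasDerivAt s₀ h5
  have h7 := h6.congr_of_eventuallyEq h1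
  refine h7.congr_deriv ?_
  have h8 : HasFDerivAt (fun u => fderiv ℝ G (s₀, u))
      (fderiv ℝ (fderiv ℝ G) (s₀, u₀) ∘L ContinuousLinearMap.inr ℝ ℝ E) u₀ :=
    HasFDerivAt.comp u₀ (g := fderiv ℝ G) hdG.hasFDerivAt (hinr s₀)
  have h9 := (h8.clm_apply (hasFDerivAt_const ((1 : ℝ), (0 : E)) u₀)).fderiv
  rw [h9]
  ext1 v
  -- The interchange of the two derivatives is the symmetry of the second derivative of `G`.
  have hs := hG.isSymmSndFDerivAt (by simp) (1, 0) (0, v)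
  simpa using hs

end Parametric

/-! ### The first variation of the functional -/

section Variation

variable {n : ℕ} {M : Type*} [TopologicalSpace M] [ChartedSpace (Euc n) M]
  {X N : M → Euc (n + 1)} {ε : ℝ} {Y : ℝ → M → Euc (n + 1)}

/-- The logarithmic derivative of a moving Gaussian. -/
lemma hasDerivAt_exp_neg_norm_sq {k : ℕ} {y x : ℝ → Euc k} {t : ℝ → ℝ} {y' x' : Euc k} {t' s : ℝ}
    (hy : HasDerivAt y y' s) (hx : HasDerivAt x x' s) (ht : HasDerivAt t t' s) (hts : t s ≠ 0) :
    HasDerivAt (fun τ => Real.exp (-‖y τ - x τ‖ ^ 2 / (2 * t τ)))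
      (Real.exp (-‖y s - x s‖ ^ 2 / (2 * t s)) *
        (-(t s)⁻¹ * inner ℝ (y s - x s) (y' - x') + ‖y s - x s‖ ^ 2 * t' / (2 * t s ^ 2))) s := by
  have h1 := ((hy.sub hx).norm_sq.neg.div (ht.const_mul 2) (by positivity)).exp
  refine h1.congr_deriv ?_
  simp only [Pi.sub_apply, Pi.neg_apply]
  congr 1
  field_simp
  ring

variable [IsManifold (𝓡 n) ∞ M]

lemma IsNormalVariation.contDiffAt_familyRep (h : IsNormalVariation X N ε Y) {p : M} {u : Euc n}
    (hu : u ∈ (chartAt (Euc n) p).target) {s : ℝ} (hs : s ∈ Ioo (-ε) ε) :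
    ContDiffAt ℝ ∞ (familyRep n Y p) (s, u) := by
  have h1 : ContMDiffAt (𝓡 n) (𝓡 n) ∞ (chartAt (Euc n) p).symm u :=
    (contMDiffOn_chart_symm (I := 𝓡 n) (x := p)).contMDiffAt (chart_target_mem_nhds' p hu)
  have h2 : ContMDiffAt (𝓘(ℝ, ℝ).prod (𝓡 n)) 𝓘(ℝ, Euc (n + 1)) ∞
      (fun q : ℝ × M => Y q.1 q.2) (s, (chartAt (Euc n) p).symm u) :=
    h.smooth.contMDiffAt (prod_mem_nhds (isOpen_Ioo.mem_nhds hs) univ_mem)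
  have h3 : ContMDiffAt 𝓘(ℝ, ℝ × Euc n) (𝓘(ℝ, ℝ).prod (𝓡 n)) ∞
      (fun z : ℝ × Euc n => (z.1, (chartAt (Euc n) p).symm z.2)) (s, u) := by
    refine ContMDiffAt.prodMk contDiffAt_fst.contMDiffAt ?_
    exact ContMDiffAt.comp (s, u) (g := (chartAt (Euc n) p).symm) (f := fun z : ℝ × Euc n => z.2)
      h1 contDiffAt_snd.contMDiffAt
  exact contMDiffAt_iff_contDiffAt.1 (ContMDiffAt.comp (s, u) h2 h3)

/-- The spatial differential is the full differential of the joint family restricted to the second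
factor, hence smooth in both variables. -/
lemma IsNormalVariation.contDiffAt_fderiv (h : IsNormalVariation X N ε Y) {p : M} {u : Euc n}
    (hu : u ∈ (chartAt (Euc n) p).target) {s : ℝ} (hs : s ∈ Ioo (-ε) ε) :
    ContDiffAt ℝ ∞ (fun z : ℝ × Euc n => fderiv ℝ (chartRep n (Y z.1) p) z.2) (s, u) := by
  have hG := h.contDiffAt_familyRep hu hs
  have h1 : ContDiffAt ℝ ∞ (fun z => fderiv ℝ (familyRep n Y p) z ∘L
      ContinuousLinearMap.inr ℝ ℝ (Euc n)) (s, u) :=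
    (hG.fderiv_right (m := ∞) (by norm_cast)).clm_comp contDiffAt_const
  refine h1.congr_of_eventuallyEq ?_
  have h2 : ∀ᶠ z in 𝓝 (s, u), z.1 ∈ Ioo (-ε) ε ∧ z.2 ∈ (chartAt (Euc n) p).target :=
    prod_mem_nhds (isOpen_Ioo.mem_nhds hs) (chart_target_mem_nhds' p hu)
  filter_upwards [h2] with z hz
  exact (((h.contDiffAt_familyRep hz.2 hz.1).differentiableAt (by simp)).hasFDerivAt.comp z.2
    (hasFDerivAt_prodMk_right z.1 z.2)).fderiv

omit [IsManifold (𝓡 n) ∞ M] in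
lemma IsNormalVariation.zero_mem (h : IsNormalVariation X N ε Y) : (0 : ℝ) ∈ Ioo (-ε) ε :=
  ⟨neg_lt_zero.2 h.pos, h.pos⟩

omit [IsManifold (𝓡 n) ∞ M] in
lemma IsNormalVariation.Ioo_mem_nhds (h : IsNormalVariation X N ε Y) : Ioo (-ε) ε ∈ 𝓝 (0 : ℝ) :=
  isOpen_Ioo.mem_nhds h.zero_mem

/-- The first variation of the area element under a normal variation. -/
lemma IsNormalVariation.hasDerivAt_areaRatio (h : IsNormalVariation X N ε Y)
    (hX : IsImmersedHypersurface X) (hN : IsUnitNormal X N) {f : M → ℝ}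
    (hf : ∀ p : M, HasDerivAt (fun s => Y s p) (f p • N p) 0) (x : M) :
    HasDerivAt (fun s => areaRatio X (Y s) x) (-meanCurvature X N x * f x) 0 := by
  have hut := mem_chart_target (Euc n) x
  set u₀ := chartAt (Euc n) x x with hu₀
  have hG := h.contDiffAt_familyRep hut h.zero_mem
  have hinj := hX.injective_chartDeriv x
  have h0 : chartDeriv n (Y 0) x = chartDeriv n X x := by rw [h.initial]
  have hfN : ∀ u ∈ (chartAt (Euc n) x).target, fderiv ℝ (familyRep n Y x) (0, u) (1, 0) =
      chartRep n (fun y => f y • N y) x u := by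
    intro u hu
    have h1 := hasDerivAt_familyRep (Q := Y) (p := x) ((chartAt (Euc n) x).map_target hu) (s := 0)
      (by rw [(chartAt (Euc n) x).right_inv hu]
          exact (h.contDiffAt_familyRep hu h.zero_mem).differentiableAt (by simp))
    rw [(chartAt (Euc n) x).right_inv hu] at h1
    exact h1.unique (hf _)
  have heq : (fun u => fderiv ℝ (familyRep n Y x) (0, u) (1, 0)) =ᶠ[𝓝 u₀]
      chartRep n (fun y => f y • N y) x :=
    Filter.mem_of_superset (chart_target_mem_nhds' x hut) hfN
  -- No regularity of `f` is assumed. The field `f N` is differentiable as the parameter derivative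
  -- of a smooth family, and then so is `f = ⟨f N, N⟩`.
  have hfNd : DifferentiableAt ℝ (chartRep n (fun y => f y • N y) x) u₀ := by
    refine DifferentiableAt.congr_of_eventuallyEq ?_ heq.symm
    have h1 : DifferentiableAt ℝ (fderiv ℝ (familyRep n Y x)) (0, u₀) :=
      (hG.fderiv_right (m := 1) (by norm_cast)).differentiableAt one_ne_zero
    exact (DifferentiableAt.comp u₀ (g := fderiv ℝ (familyRep n Y x)) h1
      (hasFDerivAt_prodMk_right 0 u₀).differentiableAt).clm_apply (differentiableAt_const _)
  have hNd := differentiableAt_chartRep hN.smooth hut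
  have hfd : DifferentiableAt ℝ (chartRep n f x) u₀ := by
    refine (hfNd.inner ℝ hNd).congr_of_eventuallyEq (Eventually.of_forall fun u => ?_)
    simp [chartRep, inner_smul_left, hN.norm_eq_one]
  -- Of the two terms of `d(f N)`, the one with `df` is normal and has zero trace; the one with `dN`
  -- gives `-H f`.
  have hB : fderiv ℝ (fun u => fderiv ℝ (familyRep n Y x) (0, u) (1, 0)) u₀ =
      f x • chartDeriv n N x + (chartDeriv n f x).smulRight (N x) := by
    rw [heq.fderiv_eq]
    have h1 := (hfd.hasFDerivAt.smul hNd.hasFDerivAt).fderiv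
    rw [hu₀, chartRep_self, chartRep_self] at h1
    exact h1
  have h2 := hasDerivAt_fderiv_param (hG.of_le (m := 2) (WithTop.coe_le_coe.2 le_top))
  rw [hB] at h2
  change HasDerivAt (fun s => chartDeriv n (Y s) x) _ 0 at h2
  have h3 := (hasDerivAt_areaFactor (A := fun s => chartDeriv n (Y s) x)
    (by simpa only [h0] using hinj) h2).div_const (areaFactor (chartDeriv n X x))
  refine h3.congr_deriv ?_
  have hpos := (areaFactor_pos hinj).ne'
  rw [h0, metricTrace_add, metricTrace_smul, metricTrace_smulRight,
    tangPart_eq_zero (hN.inner_chartDeriv hX x), map_zero, add_zero, mul_div_cancel_left₀ _ hpos,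
    meanCurvature_eq hX hN]
  ring

omit [IsManifold (𝓡 n) ∞ M] in
lemma areaRatio_self (hX : IsImmersedHypersurface X) (x : M) : areaRatio X X x = 1 :=
  div_self (areaFactor_pos (hX.injective_chartDeriv x)).ne'

omit [IsManifold (𝓡 n) ∞ M] in
lemma areaRatio_eq_one_of_eventuallyEq (hX : IsImmersedHypersurface X) {Z : M → Euc (n + 1)} {x : M}
    (h : Z =ᶠ[𝓝 x] X) : areaRatio X Z x = 1 := by
  rw [areaRatio, chartDeriv_congr h]
  exact areaRatio_self hX x

end Variation
-- Derivatives of the weighted area, the weighted volume and the functional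
section FirstVariation

variable {n : ℕ} {M : Type*} [TopologicalSpace M] [ChartedSpace (Euc n) M]
  [IsManifold (𝓡 n) ∞ M] {X N : M → Euc (n + 1)} {ε : ℝ} {Y : ℝ → M → Euc (n + 1)}
  {x : ℝ → Euc (n + 1)} {t : ℝ → ℝ}

/-- The integrand of the weighted area of a variation, with respect to the initial area. -/
def areaIntegrand (X : M → Euc (n + 1)) (Y : ℝ → M → Euc (n + 1)) (x : ℝ → Euc (n + 1)) (t : ℝ → ℝ)
    (s : ℝ) (p : M) : ℝ :=
  areaRatio X (Y s) p * gaussWeight (Y s) (x s) (t s) p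

/-- The integrand of the weighted volume of a variation. -/
def volumeIntegrand (X N : M → Euc (n + 1)) (X₀ : Euc (n + 1)) (t₀ : ℝ) (Y : ℝ → M → Euc (n + 1))
    (x : ℝ → Euc (n + 1)) (s : ℝ) (p : M) : ℝ :=
  inner ℝ (Y s p - x s) (N p) * gaussWeight X X₀ t₀ p

lemma IsNormalVariation.contDiffAt_areaIntegrand (h : IsNormalVariation X N ε Y)
    (hX : IsImmersedHypersurface X) (hx : ContDiffOn ℝ ∞ x (Ioo (-ε) ε))
    (ht : ContDiffOn ℝ ∞ t (Ioo (-ε) ε)) (ht0 : 0 < t 0) (p : M) :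
    ContDiffAt ℝ 1 (familyRep n (areaIntegrand X Y x t) p) (0, chartAt (Euc n) p p) := by
  set u₀ := chartAt (Euc n) p p with hu₀
  have hu : u₀ ∈ (chartAt (Euc n) p).target := mem_chart_target _ p
  have hx0 : ContDiffAt ℝ ∞ x 0 := hx.contDiffAt h.Ioo_mem_nhds
  have htd : ContDiffAt ℝ ∞ t 0 := ht.contDiffAt h.Ioo_mem_nhds
  have hfst : ContDiffAt ℝ ∞ (fun z : ℝ × Euc n => z.1) (0, u₀) := contDiffAt_fst
  have hsnd : ContDiffAt ℝ ∞ (fun z : ℝ × Euc n => z.2) (0, u₀) := contDiffAt_snd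
  have hxz : ContDiffAt ℝ ∞ (fun z : ℝ × Euc n => x z.1) (0, u₀) :=
    ContDiffAt.comp (0, u₀) (g := x) hx0 hfst
  have htz : ContDiffAt ℝ ∞ (fun z : ℝ × Euc n => t z.1) (0, u₀) :=
    ContDiffAt.comp (0, u₀) (g := t) htd hfst
  have hinj := hX.injective_fderiv hu
  have h1 : ContDiffAt ℝ ∞ (fun z : ℝ × Euc n =>
      areaFactor (fderiv ℝ (chartRep n (Y z.1) p) z.2)) (0, u₀) :=
    contDiffAt_areaFactor (h.contDiffAt_fderiv hu h.zero_mem) (by simpa only [h.initial] using hinj)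
  have h2 : ContDiffAt ℝ ∞ (fun z : ℝ × Euc n =>
      areaFactor (fderiv ℝ (chartRep n X p) z.2)) (0, u₀) :=
    contDiffAt_areaFactor (ContDiffAt.comp (0, u₀) (g := fderiv ℝ (chartRep n X p))
      (contDiffAt_fderiv_chartRep hX.smooth hu) hsnd) hinj
  have h3 : ContDiffAt ℝ ∞ (fun z : ℝ × Euc n =>
      Real.exp (-‖familyRep n Y p z - x z.1‖ ^ 2 / (2 * t z.1))) (0, u₀) :=
    ((((h.contDiffAt_familyRep hu h.zero_mem).sub hxz).norm_sq ℝ).neg.div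
      (contDiffAt_const.mul htz) (by positivity)).exp
  refine (((h1.div h2 (areaFactor_pos hinj).ne').mul h3).of_le
    (by exact_mod_cast le_top)).congr_of_eventuallyEq ?_
  -- `areaRatio` uses a different chart at each point. The Jacobians of the transitions cancel in
  -- the quotient, so one fixed chart may be used nearby.
  filter_upwards [continuousAt_snd.preimage_mem_nhds (chart_target_mem_nhds' p hu)] with z hz
  exact congrArg (· * Real.exp (-‖familyRep n Y p z - x z.1‖ ^ 2 / (2 * t z.1)))
    (areaRatio_symm X (Y z.1) hz)

lemma IsNormalVariation.contDiffAt_volumeIntegrand (h : IsNormalVariation X N ε Y)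
    (hX : IsImmersedHypersurface X) (hN : IsUnitNormal X N) (X₀ : Euc (n + 1)) (t₀ : ℝ)
    (hx : ContDiffOn ℝ ∞ x (Ioo (-ε) ε)) (p : M) :
    ContDiffAt ℝ 1 (familyRep n (volumeIntegrand X N X₀ t₀ Y x) p) (0, chartAt (Euc n) p p) := by
  set u₀ := chartAt (Euc n) p p with hu₀
  have hu : u₀ ∈ (chartAt (Euc n) p).target := mem_chart_target _ p
  have hfst : ContDiffAt ℝ ∞ (fun z : ℝ × Euc n => z.1) (0, u₀) := contDiffAt_fst
  have hsnd : ContDiffAt ℝ ∞ (fun z : ℝ × Euc n => z.2) (0, u₀) := contDiffAt_snd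
  have hxz : ContDiffAt ℝ ∞ (fun z : ℝ × Euc n => x z.1) (0, u₀) :=
    ContDiffAt.comp (0, u₀) (g := x) (hx.contDiffAt h.Ioo_mem_nhds) hfst
  have h1 : ContDiffAt ℝ ∞ (fun z : ℝ × Euc n => chartRep n N p z.2) (0, u₀) :=
    ContDiffAt.comp (0, u₀) (g := chartRep n N p) (contDiffAt_chartRep hN.smooth hu) hsnd
  have h2 : ContDiffAt ℝ ∞ (fun z : ℝ × Euc n =>
      chartRep n (gaussWeight X X₀ t₀) p z.2) (0, u₀) :=
    ContDiffAt.comp (0, u₀) (g := chartRep n (gaussWeight X X₀ t₀) p)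
      (contDiffAt_chartRep (contMDiff_gaussWeight hX.smooth X₀ t₀) hu) hsnd
  exact ((((h.contDiffAt_familyRep hu h.zero_mem).sub hxz).inner ℝ h1).mul h2).of_le
    (by exact_mod_cast le_top)

variable [MeasurableSpace M] [BorelSpace M] [SecondCountableTopology M] [T2Space M] [Nonempty M]

omit [IsManifold (𝓡 n) ∞ M] [BorelSpace M] [SecondCountableTopology M] [T2Space M]
  [Nonempty M] in
lemma HasPolynomialAreaGrowth.area_ne_top_of_isCompact (hg : HasPolynomialAreaGrowth X)
    (hX : Continuous X) {K : Set M} (hK : IsCompact K) : area X K ≠ ⊤ := by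
  obtain ⟨C, d, hCd⟩ := hg
  obtain ⟨R, hR⟩ := (hK.image hX).isBounded.subset_ball_lt 1 0
  refine ne_top_of_le_ne_top ENNReal.ofReal_ne_top ((measure_mono ?_).trans (hCd R hR.1.le))
  exact image_subset_iff.1 hR.2

omit [IsManifold (𝓡 n) ∞ M] [MeasurableSpace M] [BorelSpace M] [SecondCountableTopology M]
  [Nonempty M] [ChartedSpace (Euc n) M] in
lemma eventuallyEq_of_notMem_of_isCompact {K : Set M} (hK : IsCompact K) {A B : M → Euc (n + 1)}
    (h : ∀ p ∉ K, A p = B p) {p : M} (hp : p ∉ K) : A =ᶠ[𝓝 p] B :=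
  Filter.mem_of_superset (hK.isClosed.isOpen_compl.mem_nhds hp) h

omit [Nonempty M] in
-- Off the compact set `K` only the centre and the scale move, so the integrand is an explicit
-- Gaussian. Its parameter derivative grows at most quadratically in `|X|` before weighting and is
-- dominated uniformly for small `s`.
lemma IsNormalVariation.hasDerivAt_integral_areaIntegrand (h : IsNormalVariation X N ε Y)
    (hX : IsImmersedHypersurface X) (hN : IsUnitNormal X N) (hg : HasPolynomialAreaGrowth X)
    {f : M → ℝ} (hf : ∀ p : M, HasDerivAt (fun s => Y s p) (f p • N p) 0)
    (hx : ContDiffOn ℝ ∞ x (Ioo (-ε) ε)) (ht : ContDiffOn ℝ ∞ t (Ioo (-ε) ε)) (ht0 : 0 < t 0) :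
    Integrable (fun p => gaussWeight X (x 0) (t 0) p * (-meanCurvature X N p * f p -
        (t 0)⁻¹ * inner ℝ (X p - x 0) (f p • N p - deriv x 0) +
        ‖X p - x 0‖ ^ 2 * deriv t 0 / (2 * t 0 ^ 2))) (area X) ∧
      HasDerivAt (fun s => ∫ p, areaIntegrand X Y x t s p ∂(area X))
        (∫ p, gaussWeight X (x 0) (t 0) p * (-meanCurvature X N p * f p -
          (t 0)⁻¹ * inner ℝ (X p - x 0) (f p • N p - deriv x 0) +
          ‖X p - x 0‖ ^ 2 * deriv t 0 / (2 * t 0 ^ 2)) ∂(area X)) 0 := by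
  have hXc := hX.smooth.continuous
  obtain ⟨K, hK, hKY⟩ := h.compact_support
  obtain ⟨q, hq⟩ := hg.exists_integrable hXc
  have hI := h.Ioo_mem_nhds
  have hIe : ∀ᶠ s in 𝓝 (0 : ℝ), s ∈ Ioo (-ε) ε := hI
  have hxd : ∀ s ∈ Ioo (-ε) ε, HasDerivAt x (deriv x s) s := fun s hs =>
    ((hx.contDiffAt (isOpen_Ioo.mem_nhds hs)).differentiableAt (by simp)).hasDerivAt
  have htd : ∀ s ∈ Ioo (-ε) ε, HasDerivAt t (deriv t s) s := fun s hs =>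
    ((ht.contDiffAt (isOpen_Ioo.mem_nhds hs)).differentiableAt (by simp)).hasDerivAt
  have hxc : ContinuousAt x 0 := (hxd 0 h.zero_mem).continuousAt
  have htc : ContinuousAt t 0 := (htd 0 h.zero_mem).continuousAt
  have hx'c : ContinuousAt (deriv x) 0 :=
    ((hx.deriv_of_isOpen (m := 0) isOpen_Ioo (by simp)).continuousOn).continuousAt hI
  have ht'c : ContinuousAt (deriv t) 0 :=
    ((ht.deriv_of_isOpen (m := 0) isOpen_Ioo (by simp)).continuousOn).continuousAt hI
  set R : ℝ := ‖x 0‖ + ‖deriv x 0‖ + |deriv t 0| + 1 with hR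
  have hR0 : 0 ≤ R := by positivity
  have e1 : ∀ᶠ s in 𝓝 (0 : ℝ), ‖x s‖ < R :=
    hxc.norm.eventually_lt_const (by
      rw [hR]; linarith [norm_nonneg (deriv x 0), abs_nonneg (deriv t 0)])
  have e2 : ∀ᶠ s in 𝓝 (0 : ℝ), ‖deriv x s‖ < R :=
    hx'c.norm.eventually_lt_const (by
      rw [hR]; linarith [norm_nonneg (x 0), abs_nonneg (deriv t 0)])
  have e3 : ∀ᶠ s in 𝓝 (0 : ℝ), |deriv t s| < R :=
    ht'c.abs.eventually_lt_const (by
      rw [hR]; linarith [norm_nonneg (deriv x 0), norm_nonneg (x 0)])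
  have e4 : ∀ᶠ s in 𝓝 (0 : ℝ), t s < 2 * t 0 := htc.eventually_lt_const (by linarith)
  have e5 : ∀ᶠ s in 𝓝 (0 : ℝ), t 0 / 2 < t s := htc.eventually_const_lt (by linarith)
  -- Two powers of `1 + |X|` absorb the quadratic factor, and the remaining `q` give integrability.
  obtain ⟨C, hC0, hC⟩ := exp_neg_sq_le (q + 2) hR0 (show 0 < 2 * t 0 by linarith)
    (E := Euc (n + 1))
  set B : ℝ := 2 / t 0 * ((1 + R) * R) + (1 + R) ^ 2 * R * (2 / t 0 ^ 2) with hB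
  have hB0 : 0 ≤ B := by positivity
  have hoff : ∀ᶠ s in 𝓝 (0 : ℝ), ∀ p ∉ K,
      DifferentiableAt ℝ (fun τ => areaIntegrand X Y x t τ p) s ∧
      |deriv (fun τ => areaIntegrand X Y x t τ p) s| ≤ C * B * ((1 + ‖X p‖) ^ q)⁻¹ := by
    filter_upwards [hIe, e1, e2, e3, e4, e5] with s hs h1 h2 h3 h4 h5 p hp
    have hts : 0 < t s := lt_trans (by linarith) h5
    have hev : (fun τ => areaIntegrand X Y x t τ p) =ᶠ[𝓝 s]
        fun τ => Real.exp (-‖X p - x τ‖ ^ 2 / (2 * t τ)) := by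
      filter_upwards [isOpen_Ioo.mem_nhds hs] with τ hτ
      rw [areaIntegrand, areaRatio_eq_one_of_eventuallyEq hX
        (eventuallyEq_of_notMem_of_isCompact hK (hKY τ hτ) hp), one_mul, gaussWeight, hKY τ hτ p hp]
    have hd := (hasDerivAt_exp_neg_norm_sq (hasDerivAt_const s (X p)) (hxd s hs) (htd s hs)
      hts.ne').congr_of_eventuallyEq hev
    refine ⟨hd.differentiableAt, ?_⟩
    rw [hd.deriv, abs_mul, abs_of_pos (Real.exp_pos _)]
    have hP : 1 ≤ 1 + ‖X p‖ := by linarith [norm_nonneg (X p)]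
    have hsub : ‖X p - x s‖ ≤ (1 + R) * (1 + ‖X p‖) := by
      refine (norm_sub_le _ _).trans ?_
      nlinarith [norm_nonneg (X p)]
    have hinv : (t s)⁻¹ ≤ 2 / t 0 := by
      rw [inv_le_comm₀ hts (by positivity), inv_div]; exact h5.le
    have hinv2 : 1 / (2 * t s ^ 2) ≤ 2 / t 0 ^ 2 := by
      rw [div_le_div_iff₀ (by positivity) (by positivity)]
      nlinarith
    have b1 : |-(t s)⁻¹ * inner ℝ (X p - x s) (0 - deriv x s)| ≤
        2 / t 0 * ((1 + R) * R) * (1 + ‖X p‖) ^ 2 := by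
      rw [abs_mul, abs_neg, abs_of_pos (inv_pos.2 hts)]
      have := abs_real_inner_le_norm (X p - x s) (0 - deriv x s)
      rw [zero_sub, norm_neg] at this
      calc (t s)⁻¹ * |inner ℝ (X p - x s) (0 - deriv x s)|
          ≤ 2 / t 0 * (((1 + R) * (1 + ‖X p‖)) * R) := by
            rw [zero_sub]
            exact mul_le_mul hinv (this.trans (mul_le_mul hsub h2.le (norm_nonneg _)
              (by positivity))) (abs_nonneg _) (by positivity)
        _ = 2 / t 0 * ((1 + R) * R) * (1 + ‖X p‖) := by ring
        _ ≤ _ := mul_le_mul_of_nonneg_left (by nlinarith) (by positivity)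
    have b2 : |‖X p - x s‖ ^ 2 * deriv t s / (2 * t s ^ 2)| ≤
        (1 + R) ^ 2 * R * (2 / t 0 ^ 2) * (1 + ‖X p‖) ^ 2 := by
      rw [div_eq_mul_one_div, abs_mul, abs_mul, abs_of_nonneg (sq_nonneg ‖X p - x s‖),
        abs_of_nonneg (show 0 ≤ 1 / (2 * t s ^ 2) by positivity)]
      calc ‖X p - x s‖ ^ 2 * |deriv t s| * (1 / (2 * t s ^ 2))
          ≤ ((1 + R) * (1 + ‖X p‖)) ^ 2 * R * (2 / t 0 ^ 2) := by gcongr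
        _ = _ := by ring
    calc Real.exp (-‖X p - x s‖ ^ 2 / (2 * t s)) *
          |-(t s)⁻¹ * inner ℝ (X p - x s) (0 - deriv x s) +
            ‖X p - x s‖ ^ 2 * deriv t s / (2 * t s ^ 2)|
        ≤ C * ((1 + ‖X p‖) ^ (q + 2))⁻¹ * (B * (1 + ‖X p‖) ^ 2) := by
          refine mul_le_mul (hC _ h1.le _ hts h4.le _) ?_ (abs_nonneg _) (by positivity)
          refine (abs_add_le _ _).trans ((add_le_add b1 b2).trans_eq ?_)
          rw [hB]; ring
      _ = C * B * ((1 + ‖X p‖) ^ q)⁻¹ := by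
          have : (1 + ‖X p‖) ≠ 0 := by positivity
          rw [pow_add]; field_simp
  have hcont : ∀ᶠ s in 𝓝 (0 : ℝ), Continuous (areaIntegrand X Y x t s) := by
    filter_upwards [hIe] with s hs
    exact (continuous_areaRatio hX (h.immersed s hs)).mul
      (contMDiff_gaussWeight (h.immersed s hs).smooth _ _).continuous
  have hint : Integrable (areaIntegrand X Y x t 0) (area X) := by
    refine (hg.integrable_gaussian_mul hXc (x 0) ht0 (f := fun _ => 1) continuous_const (B := 1)
      (m := 0) (by simp)).congr (Eventually.of_forall fun p => ?_)
    simp [areaIntegrand, h.initial, areaRatio_self hX, gaussWeight]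
  have hmain := hasDerivAt_integral_family
    (fun p => h.contDiffAt_areaIntegrand hX hx ht ht0 p) hK
    (hg.area_ne_top_of_isCompact hXc hK) hcont hint (hq.const_mul (C * B))
    (fun p => by positivity) hoff
  have hder : ∀ p, deriv (fun τ => areaIntegrand X Y x t τ p) 0 =
      gaussWeight X (x 0) (t 0) p * (-meanCurvature X N p * f p -
        (t 0)⁻¹ * inner ℝ (X p - x 0) (f p • N p - deriv x 0) +
        ‖X p - x 0‖ ^ 2 * deriv t 0 / (2 * t 0 ^ 2)) := by
    intro p
    have h1 := (h.hasDerivAt_areaRatio hX hN hf p).mul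
      (hasDerivAt_exp_neg_norm_sq (hf p) (hxd 0 h.zero_mem) (htd 0 h.zero_mem) ht0.ne')
    refine (h1.deriv.trans ?_)
    rw [h.initial, areaRatio_self hX, gaussWeight]
    ring
  simpa only [hder] using hmain

omit [Nonempty M] in
lemma IsNormalVariation.hasDerivAt_integral_volumeIntegrand (h : IsNormalVariation X N ε Y)
    (hX : IsImmersedHypersurface X) (hN : IsUnitNormal X N) (hg : HasPolynomialAreaGrowth X)
    {f : M → ℝ} (hf : ∀ p : M, HasDerivAt (fun s => Y s p) (f p • N p) 0) (X₀ : Euc (n + 1))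
    {t₀ : ℝ} (ht₀ : 0 < t₀) (hx : ContDiffOn ℝ ∞ x (Ioo (-ε) ε)) :
    Integrable (fun p => gaussWeight X X₀ t₀ p * (f p - inner ℝ (deriv x 0) (N p))) (area X) ∧
      HasDerivAt (fun s => ∫ p, volumeIntegrand X N X₀ t₀ Y x s p ∂(area X))
        (∫ p, gaussWeight X X₀ t₀ p * (f p - inner ℝ (deriv x 0) (N p)) ∂(area X)) 0 := by
  have hXc := hX.smooth.continuous
  have hNc := hN.smooth.continuous
  obtain ⟨K, hK, hKY⟩ := h.compact_support
  have hI := h.Ioo_mem_nhds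
  have hIe : ∀ᶠ s in 𝓝 (0 : ℝ), s ∈ Ioo (-ε) ε := hI
  have hxd : ∀ s ∈ Ioo (-ε) ε, HasDerivAt x (deriv x s) s := fun s hs =>
    ((hx.contDiffAt (isOpen_Ioo.mem_nhds hs)).differentiableAt (by simp)).hasDerivAt
  have hx'c : ContinuousAt (deriv x) 0 :=
    ((hx.deriv_of_isOpen (m := 0) isOpen_Ioo (by simp)).continuousOn).continuousAt hI
  set R : ℝ := ‖deriv x 0‖ + 1 with hR
  have hR0 : 0 ≤ R := by positivity
  have e2 : ∀ᶠ s in 𝓝 (0 : ℝ), ‖deriv x s‖ < R := hx'c.norm.eventually_lt_const (by linarith)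
  have hw0 : ∀ p, 0 ≤ gaussWeight X X₀ t₀ p := fun p => (Real.exp_pos _).le
  have hwi : Integrable (gaussWeight X X₀ t₀) (area X) := by
    refine (hg.integrable_gaussian_mul hXc X₀ ht₀ (f := fun _ => 1) continuous_const (B := 1)
      (m := 0) (by simp)).congr (Eventually.of_forall fun p => ?_)
    simp [gaussWeight]
  have hoff : ∀ᶠ s in 𝓝 (0 : ℝ), ∀ p ∉ K,
      DifferentiableAt ℝ (fun τ => volumeIntegrand X N X₀ t₀ Y x τ p) s ∧
      |deriv (fun τ => volumeIntegrand X N X₀ t₀ Y x τ p) s| ≤ R * gaussWeight X X₀ t₀ p := by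
    filter_upwards [hIe, e2] with s hs h2 p hp
    have hev : (fun τ => volumeIntegrand X N X₀ t₀ Y x τ p) =ᶠ[𝓝 s]
        fun τ => inner ℝ (X p - x τ) (N p) * gaussWeight X X₀ t₀ p := by
      filter_upwards [isOpen_Ioo.mem_nhds hs] with τ hτ
      rw [volumeIntegrand, hKY τ hτ p hp]
    have hd := ((((hxd s hs).const_sub (X p)).inner ℝ (hasDerivAt_const s (N p))).mul_const
      (gaussWeight X X₀ t₀ p)).congr_of_eventuallyEq hev
    refine ⟨hd.differentiableAt, ?_⟩
    rw [hd.deriv, abs_mul, abs_of_nonneg (hw0 p), inner_zero_right, zero_add]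
    refine mul_le_mul_of_nonneg_right ?_ (hw0 p)
    refine (abs_real_inner_le_norm _ _).trans ?_
    rw [hN.norm_eq_one, mul_one, norm_neg]
    exact h2.le
  have hcont : ∀ᶠ s in 𝓝 (0 : ℝ), Continuous (volumeIntegrand X N X₀ t₀ Y x s) := by
    filter_upwards [hIe] with s hs
    exact (((h.immersed s hs).smooth.continuous.sub continuous_const).inner hNc).mul
      (contMDiff_gaussWeight hX.smooth _ _).continuous
  have hint : Integrable (volumeIntegrand X N X₀ t₀ Y x 0) (area X) := by
    refine (hg.integrable_gaussian_mul hXc X₀ ht₀ (f := fun p => inner ℝ (X p - x 0) (N p))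
      (by fun_prop) (B := 1 + ‖x 0‖) (m := 1) fun p => ?_).congr (Eventually.of_forall fun p => ?_)
    · refine (abs_real_inner_le_norm _ _).trans ?_
      rw [hN.norm_eq_one, mul_one, pow_one]
      refine (norm_sub_le _ _).trans ?_
      nlinarith [norm_nonneg (X p), norm_nonneg (x 0)]
    · simp [volumeIntegrand, h.initial, gaussWeight, mul_comm]
  have hmain := hasDerivAt_integral_family
    (fun p => h.contDiffAt_volumeIntegrand hX hN X₀ t₀ hx p) hK
    (hg.area_ne_top_of_isCompact hXc hK) hcont hint (hwi.const_mul R)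
    (fun p => mul_nonneg hR0 (hw0 p)) hoff
  have hder : ∀ p, deriv (fun τ => volumeIntegrand X N X₀ t₀ Y x τ p) 0 =
      gaussWeight X X₀ t₀ p * (f p - inner ℝ (deriv x 0) (N p)) := by
    intro p
    have h1 := (((hf p).sub (hxd 0 h.zero_mem)).inner ℝ (hasDerivAt_const 0 (N p))).mul_const
      (gaussWeight X X₀ t₀ p)
    refine (h1.deriv.trans ?_)
    simp only [inner_zero_right, zero_add, inner_sub_left, inner_smul_left,
      real_inner_self_eq_norm_sq, hN.norm_eq_one]
    simp
    ring
  simpa only [hder] using hmain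

lemma integral_linearCombination {Ω : Type*} [MeasurableSpace Ω] {μ : Measure Ω}
    {f₁ f₂ f₃ f₄ : Ω → ℝ} (h₁ : Integrable f₁ μ) (h₂ : Integrable f₂ μ) (h₃ : Integrable f₃ μ)
    (h₄ : Integrable f₄ μ) {a b c : ℝ} :
    ∫ p, (a * f₁ p + f₂ p) + (b * f₃ p + c * f₄ p) ∂μ =
      (a * ∫ p, f₁ p ∂μ + ∫ p, f₂ p ∂μ) + (b * ∫ p, f₃ p ∂μ + c * ∫ p, f₄ p ∂μ) := by
  rw [integral_add (f := fun p => a * f₁ p + f₂ p) (g := fun p => b * f₃ p + c * f₄ p)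
    ((h₁.const_mul a).add h₂) ((h₃.const_mul b).add (h₄.const_mul c)),
    integral_add (h₁.const_mul a) h₂, integral_add (h₃.const_mul b) (h₄.const_mul c),
    integral_const_mul, integral_const_mul, integral_const_mul]

/-- The first variation formula for the functional. -/
theorem IsNormalVariation.hasDerivAt_functionalF (h : IsNormalVariation X N ε Y)
    (hX : IsImmersedHypersurface X) (hN : IsUnitNormal X N) (hg : HasPolynomialAreaGrowth X)
    {f : M → ℝ} (hf : ∀ p : M, HasDerivAt (fun s => Y s p) (f p • N p) 0) {X₀ : Euc (n + 1)}
    {t₀ : ℝ} (ht₀ : 0 < t₀) (lam : ℝ) (hx : ContDiffOn ℝ ∞ x (Ioo (-ε) ε)) (hx0 : x 0 = X₀)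
    (ht : ContDiffOn ℝ ∞ t (Ioo (-ε) ε)) (ht0 : t 0 = t₀) {a : Euc (n + 1)} {c : ℝ}
    (ha : a = -deriv x 0) (hc : c = -deriv t 0 / (2 * t₀)) :
    HasDerivAt (fun s => functionalF lam X N X₀ t₀ (Y s) (x s) (t s))
      ((4 * Real.pi * t₀) ^ (-(n : ℝ) / 2) * ∫ p, gaussWeight X X₀ t₀ p *
        (f p * (lam - (meanCurvature X N p + inner ℝ (t₀⁻¹ • (X p - X₀)) (N p))) +
          (n * c - t₀⁻¹ * inner ℝ (X p - X₀) (a + c • (X p - X₀)) +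
            lam * inner ℝ (a + c • (X p - X₀)) (N p))) ∂(area X)) 0 := by
  subst hx0 ht0
  obtain ⟨i1, d1⟩ := h.hasDerivAt_integral_areaIntegrand hX hN hg hf hx ht ht₀
  obtain ⟨i2, d2⟩ := h.hasDerivAt_integral_volumeIntegrand hX hN hg hf (x 0) ht₀ hx
  have hXc := hX.smooth.continuous
  have hNc := hN.smooth.continuous
  have htd : HasDerivAt t (deriv t 0) 0 :=
    ((ht.contDiffAt h.Ioo_mem_nhds).differentiableAt (by simp)).hasDerivAt
  have i3 : Integrable (gaussWeight X (x 0) (t 0)) (area X) := by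
    refine (hg.integrable_gaussian_mul hXc (x 0) ht₀ (f := fun _ => 1) continuous_const (B := 1)
      (m := 0) (by simp)).congr (Eventually.of_forall fun p => ?_)
    simp [gaussWeight]
  have i4 : Integrable (fun p => inner ℝ (X p - x 0) (N p) * gaussWeight X (x 0) (t 0) p)
      (area X) := by
    refine (hg.integrable_gaussian_mul hXc (x 0) ht₀ (f := fun p => inner ℝ (X p - x 0) (N p))
      (by fun_prop) (B := 1 + ‖x 0‖) (m := 1) fun p => ?_).congr (Eventually.of_forall fun p => ?_)
    · refine (abs_real_inner_le_norm _ _).trans ?_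
      rw [hN.norm_eq_one, mul_one, pow_one]
      refine (norm_sub_le _ _).trans ?_
      nlinarith [norm_nonneg (X p), norm_nonneg (x 0)]
    · simp [gaussWeight, mul_comm]
  have hpi : 0 < 4 * Real.pi * t 0 := by positivity
  set κ : ℝ := (4 * Real.pi * t 0) ^ (-(n : ℝ) / 2) with hκ
  have d3 : HasDerivAt (fun s => (4 * Real.pi * t s) ^ (-(n : ℝ) / 2))
      (κ * (-(n : ℝ) * deriv t 0 / (2 * t 0))) 0 := by
    refine ((htd.const_mul (4 * Real.pi)).rpow_const (Or.inl hpi.ne')).congr_deriv ?_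
    rw [Real.rpow_sub_one hpi.ne', ← hκ]
    field_simp
  have d4 : HasDerivAt (fun s => (t 0 / t s) ^ (1 / 2 : ℝ)) (-deriv t 0 / (2 * t 0)) 0 := by
    refine (((hasDerivAt_const 0 (t 0)).div htd ht₀.ne').rpow_const
      (Or.inl (by simp [ht₀.ne']))).congr_deriv ?_
    rw [Pi.div_apply, div_self ht₀.ne', Real.one_rpow]
    field_simp
    ring
  have d5 := (d3.mul d1).add (((d4.const_mul (lam * κ))).mul d2)
  have hev : (fun s => functionalF lam X N (x 0) (t 0) (Y s) (x s) (t s)) =ᶠ[𝓝 0]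
      fun s => (4 * Real.pi * t s) ^ (-(n : ℝ) / 2) * ∫ p, areaIntegrand X Y x t s p ∂(area X) +
        lam * κ * (t 0 / t s) ^ (1 / 2 : ℝ) *
          ∫ p, volumeIntegrand X N (x 0) (t 0) Y x s p ∂(area X) := by
    filter_upwards [h.Ioo_mem_nhds] with s hs
    rw [functionalF, integral_area hX (h.immersed s hs)]
    rfl
  refine (d5.congr_of_eventuallyEq hev).congr_deriv ?_
  have hA0 : ∀ p, areaIntegrand X Y x t 0 p = gaussWeight X (x 0) (t 0) p := fun p => by
    simp [areaIntegrand, h.initial, areaRatio_self hX]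
  have hV0 : ∀ p, volumeIntegrand X N (x 0) (t 0) Y x 0 p =
      inner ℝ (X p - x 0) (N p) * gaussWeight X (x 0) (t 0) p := fun p => by
    simp [volumeIntegrand, h.initial]
  simp only [hA0, hV0, div_self ht₀.ne', Real.one_rpow, ← hκ]
  -- A pointwise identity: the definitions of `a` and `c` collect the contributions of the moving
  -- centre and scale into the field `a + c(X-X₀)`.
  have hsum : ∫ p, gaussWeight X (x 0) (t 0) p *
        (f p * (lam - (meanCurvature X N p + inner ℝ ((t 0)⁻¹ • (X p - x 0)) (N p))) +
          (n * c - (t 0)⁻¹ * inner ℝ (X p - x 0) (a + c • (X p - x 0)) +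
            lam * inner ℝ (a + c • (X p - x 0)) (N p))) ∂(area X) =
      ∫ p, ((-(n : ℝ) * deriv t 0 / (2 * t 0)) * gaussWeight X (x 0) (t 0) p +
        gaussWeight X (x 0) (t 0) p * (-meanCurvature X N p * f p -
          (t 0)⁻¹ * inner ℝ (X p - x 0) (f p • N p - deriv x 0) +
          ‖X p - x 0‖ ^ 2 * deriv t 0 / (2 * t 0 ^ 2))) +
        (lam * (-deriv t 0 / (2 * t 0)) * (inner ℝ (X p - x 0) (N p) * gaussWeight X (x 0) (t 0) p) +
          lam * (gaussWeight X (x 0) (t 0) p * (f p - inner ℝ (deriv x 0) (N p)))) ∂(area X) := by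
    refine integral_congr_ae (Eventually.of_forall fun p => ?_)
    simp only [ha, hc, ← real_inner_self_eq_norm_sq, inner_add_left, inner_add_right, inner_sub_right, inner_smul_left,
      inner_smul_right, inner_neg_left, inner_neg_right, conj_trivial]
    field_simp
    ring
  rw [hsum, integral_linearCombination i3 i1 i4 i2]
  ring

end FirstVariation
/-! ### Criticality -/

section Criticality

variable {n : ℕ} {M : Type*} [TopologicalSpace M] [ChartedSpace (Euc n) M]
  [IsManifold (𝓡 n) ∞ M] {X N : M → Euc (n + 1)}

lemma injective_chartDeriv_of_injective_fderiv {F : Type*} [NormedAddCommGroup F] [NormedSpace ℝ F]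
    {V : M → F} {p x : M} (hx : x ∈ (chartAt (Euc n) p).source)
    (h : Function.Injective (fderiv ℝ (chartRep n V p) (chartAt (Euc n) p x))) :
    Function.Injective (chartDeriv n V x) := by
  have hu := (chartAt (Euc n) p).map_source hx
  have h1 := fderiv_chartRep V hu
  rw [(chartAt (Euc n) p).left_inv hx] at h1
  rw [h1] at h
  intro v w hvw
  obtain ⟨v', rfl⟩ := exists_map_eq_of_det_ne_zero (det_transDeriv_ne_zero hu) v
  obtain ⟨w', rfl⟩ := exists_map_eq_of_det_ne_zero (det_transDeriv_ne_zero hu) w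
  rw [h hvw]

/-- Stated on a neighbourhood in time and space together, so that compactness can make the
admissible range of `s` uniform. -/
lemma chartRep_add_smul_eventually_injective (hX : IsImmersedHypersurface X) {V : M → Euc (n + 1)}
    (hV : ContMDiff (𝓡 n) 𝓘(ℝ, Euc (n + 1)) ∞ V) (p : M) :
    ∀ᶠ z : ℝ × M in 𝓝 (0, p),
      Function.Injective (chartDeriv n (fun y => X y + z.1 • V y) z.2) := by
  have hu := mem_chart_target (Euc n) p
  set u₀ := chartAt (Euc n) p p with hu₀
  have hc : ContinuousAt (fun z : ℝ × Euc n => fderiv ℝ (chartRep n X p) z.2 +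
      z.1 • fderiv ℝ (chartRep n V p) z.2) (0, u₀) := by
    have h1 : ContinuousAt (fun z : ℝ × Euc n => fderiv ℝ (chartRep n X p) z.2) (0, u₀) :=
      ContinuousAt.comp (g := fderiv ℝ (chartRep n X p)) (f := fun z : ℝ × Euc n => z.2)
        (x := ((0 : ℝ), u₀)) (contDiffAt_fderiv_chartRep hX.smooth hu).continuousAt continuousAt_snd
    have h2 : ContinuousAt (fun z : ℝ × Euc n => fderiv ℝ (chartRep n V p) z.2) (0, u₀) :=
      ContinuousAt.comp (g := fderiv ℝ (chartRep n V p)) (f := fun z : ℝ × Euc n => z.2)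
        (x := ((0 : ℝ), u₀)) (contDiffAt_fderiv_chartRep hV hu).continuousAt continuousAt_snd
    exact h1.add (continuousAt_fst.smul h2)
  have hinj := eventually_injective hc (by simpa using hX.injective_fderiv hu)
  filter_upwards [(tendsto_family_coord p).eventually hinj,
    continuousAt_snd.preimage_mem_nhds ((chartAt (Euc n) p).open_source.mem_nhds
      (mem_chart_source (Euc n) p))] with z hz hzs
  refine injective_chartDeriv_of_injective_fderiv hzs ?_
  have hzt := (chartAt (Euc n) p).map_source hzs
  have h3 := ((differentiableAt_chartRep hX.smooth hzt).hasFDerivAt.add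
    ((differentiableAt_chartRep hV hzt).hasFDerivAt.const_smul z.1)).fderiv
  change fderiv ℝ (chartRep n (fun y => X y + z.1 • V y) p) _ = _ at h3
  rw [h3]
  exact hz

/-- Every compactly supported smooth function is the speed of a normal variation. -/
theorem exists_isNormalVariation [T2Space M] (hX : IsImmersedHypersurface X)
    (hN : IsUnitNormal X N) {f : M → ℝ} (hf : ContMDiff (𝓡 n) 𝓘(ℝ, ℝ) ∞ f)
    (hfc : HasCompactSupport f) :
    ∃ ε : ℝ, IsNormalVariation X N ε (fun s p => X p + s • (f p • N p)) := by
  set V : M → Euc (n + 1) := fun p => f p • N p with hVdef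
  have hV : ContMDiff (𝓡 n) 𝓘(ℝ, Euc (n + 1)) ∞ V := hf.smul hN.smooth
  -- Only the support of `f` matters for the choice of `ε`: near every other point the varied map
  -- equals `X`.
  have hcompact : ∀ᶠ s in 𝓝 (0 : ℝ), ∀ x ∈ tsupport f,
      Function.Injective (chartDeriv n (fun y => X y + s • V y) x) := by
    refine hfc.isCompact.induction_on (p := fun S => ∀ᶠ s in 𝓝 (0 : ℝ), ∀ x ∈ S,
      Function.Injective (chartDeriv n (fun y => X y + s • V y) x)) (by simp) ?_ ?_ ?_
    · exact fun S S' hSS' h => h.mono fun s hs x hx => hs x (hSS' hx)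
    · intro S S' h h'
      filter_upwards [h, h'] with s hs hs' x hx
      exact hx.elim (hs x) (hs' x)
    · intro p _
      have hp := chartRep_add_smul_eventually_injective hX hV p
      rw [nhds_prod_eq, eventually_prod_iff] at hp
      obtain ⟨P, hP, P', hP', hPP'⟩ := hp
      exact ⟨{x | P' x}, mem_nhdsWithin_of_mem_nhds hP', hP.mono fun s hs x hx => hPP' hs hx⟩
  obtain ⟨ε, hε, hball⟩ := Metric.eventually_nhds_iff.1 hcompact
  have hsm : ContMDiff (𝓘(ℝ, ℝ).prod (𝓡 n)) 𝓘(ℝ, Euc (n + 1)) ∞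
      (fun q : ℝ × M => X q.2 + q.1 • V q.2) :=
    (hX.smooth.comp contMDiff_snd).add (contMDiff_fst.smul (hV.comp contMDiff_snd))
  have hs : ∀ s : ℝ, ContMDiff (𝓡 n) 𝓘(ℝ, Euc (n + 1)) ∞ (fun p => X p + s • V p) := fun s =>
    hX.smooth.add ((contDiff_const_smul s).comp_contMDiff hV)
  have hoff : ∀ p ∉ tsupport f, ∀ s : ℝ, (fun y => X y + s • V y) =ᶠ[𝓝 p] X := by
    intro p hp s
    filter_upwards [notMem_tsupport_iff_eventuallyEq.1 hp] with y hy
    simp [hVdef, hy]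
  refine ⟨ε, hε, hsm.contMDiffOn, fun s hsε => ⟨hs s, fun p => ?_⟩, by simp,
    ⟨tsupport f, hfc, fun s _ p hp => (hoff p hp s).self_of_nhds⟩, f, fun p => ?_⟩
  · rw [mfderiv_eq_chartDeriv (hs s) p]
    by_cases hp : p ∈ tsupport f
    · refine hball ?_ p hp
      rw [Real.dist_eq, sub_zero]
      exact abs_lt.2 hsε
    · rw [chartDeriv_congr (hoff p hp s)]
      exact hX.injective_chartDeriv p
  · simpa using ((hasDerivAt_id (0 : ℝ)).smul_const (V p)).const_add (X p)

lemma continuous_meanCurvature (hX : IsImmersedHypersurface X) (hN : IsUnitNormal X N) :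
    Continuous (meanCurvature X N) := by
  rw [show meanCurvature X N = fun p => -metricTrace (chartDeriv n X p) (chartDeriv n N p) from
    funext (meanCurvature_eq hX hN)]
  exact (continuous_metricTrace hX hN.smooth).neg

variable [MeasurableSpace M] [BorelSpace M] [SecondCountableTopology M] [T2Space M]

/-- A critical point with respect to fixed centre and scale solves the Euler-Lagrange equation. -/
theorem IsCriticalPointFixed.meanCurvature_add_eq [Nonempty M] (hX : IsImmersedHypersurface X)
    (hN : IsUnitNormal X N) (hg : HasPolynomialAreaGrowth X) {X₀ : Euc (n + 1)} {t₀ : ℝ}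
    (ht₀ : 0 < t₀) {lam : ℝ} (h : IsCriticalPointFixed lam X N X₀ t₀) (p : M) :
    meanCurvature X N p + inner ℝ (t₀⁻¹ • (X p - X₀)) (N p) = lam := by
  have hXc := hX.smooth.continuous
  have hNc := hN.smooth.continuous
  have : LocallyCompactSpace M := ChartedSpace.locallyCompactSpace (Euc n) M
  have : IsFiniteMeasureOnCompacts (area X) :=
    ⟨fun K hK => (hg.area_ne_top_of_isCompact hXc hK).lt_top⟩
  have : (area X).IsOpenPosMeasure := ⟨fun U hU hne => area_pos_of_isOpen hX hU hne⟩
  set G : M → ℝ := fun p => gaussWeight X X₀ t₀ p *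
    (lam - (meanCurvature X N p + inner ℝ (t₀⁻¹ • (X p - X₀)) (N p))) with hG
  have hGc : Continuous G := by
    have h1 := continuous_meanCurvature hX hN
    have h2 := (contMDiff_gaussWeight hX.smooth X₀ t₀).continuous
    fun_prop
  have hzero : ∀ f : M → ℝ, ContMDiff (𝓡 n) 𝓘(ℝ, ℝ) ∞ f → HasCompactSupport f →
      ∫ x, f x • G x ∂(area X) = 0 := by
    intro f hf hfc
    obtain ⟨ε, hY⟩ := exists_isNormalVariation hX hN hf hfc
    have hfd : ∀ q : M, HasDerivAt (fun s : ℝ => X q + s • (f q • N q)) (f q • N q) 0 := fun q => by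
      simpa using ((hasDerivAt_id (0 : ℝ)).smul_const (f q • N q)).const_add (X q)
    have h1 := hY.hasDerivAt_functionalF hX hN hg hfd ht₀ lam (x := fun _ => X₀) contDiffOn_const
      rfl (t := fun _ => t₀) contDiffOn_const rfl rfl rfl
    have h2 := h1.unique (h ε _ hY)
    have h3 : (0 : ℝ) < (4 * Real.pi * t₀) ^ (-(n : ℝ) / 2) := by positivity
    rw [mul_eq_zero, or_iff_right h3.ne'] at h2
    rw [← h2]
    refine integral_congr_ae (Eventually.of_forall fun q => ?_)
    simp [hG]
    ring
  -- The fundamental lemma gives `G = 0` almost everywhere. Since `G` is continuous and `area X`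
  -- charges every nonempty open set, `G` vanishes identically.
  have hae := ae_eq_zero_of_integral_contMDiff_smul_eq_zero (𝓡 n) hGc.locallyIntegrable hzero
  have h0 : G = fun _ => 0 := (hGc.ae_eq_iff_eq (area X) continuous_const).1 hae
  have h1 := congrFun h0 p
  have h2 : gaussWeight X X₀ t₀ p ≠ 0 := (Real.exp_pos _).ne'
  simp only [hG, mul_eq_zero, h2, false_or] at h1
  linarith

/-- A complete solution of the Euler-Lagrange equation is critical for all variations. -/
theorem isCriticalPoint_of_meanCurvature_add_eq [ConnectedSpace M] (hX : IsImmersedHypersurface X)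
    (hN : IsUnitNormal X N) (hc : IsCompleteHypersurface X) (hg : HasPolynomialAreaGrowth X)
    {X₀ : Euc (n + 1)} {t₀ : ℝ} (ht₀ : 0 < t₀) {lam : ℝ}
    (heq : ∀ p : M, meanCurvature X N p + inner ℝ (t₀⁻¹ • (X p - X₀)) (N p) = lam) :
    IsCriticalPoint lam X N X₀ t₀ := by
  intro ε Y x t hY hx hx0 ht ht0 _
  obtain ⟨f, hf⟩ := hY.normal
  refine (hY.hasDerivAt_functionalF hX hN hg hf ht₀ lam hx hx0 ht ht0 rfl rfl).congr_deriv ?_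
  -- The equation removes the contribution of `f`, and what remains is the balanced translation and
  -- dilation term.
  simp only [heq, sub_self, mul_zero, zero_add]
  rw [integral_gaussWeight_mul_eq_zero hX hN hc hg X₀ ht₀ heq, mul_zero]

omit [IsManifold (𝓡 n) ∞ M] [BorelSpace M] [SecondCountableTopology M] [T2Space M] in
lemma IsCriticalPoint.isCriticalPointFixed {X₀ : Euc (n + 1)} {t₀ : ℝ} (ht₀ : 0 < t₀) {lam : ℝ}
    (h : IsCriticalPoint lam X N X₀ t₀) : IsCriticalPointFixed lam X N X₀ t₀ := fun ε Y hY =>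
  h ε Y (fun _ => X₀) (fun _ => t₀) hY contDiffOn_const rfl contDiffOn_const rfl fun _ _ => ht₀

end Criticality
end LambdaHypersurface

end

theorem theorem5p1 {n : ℕ} (hn : 1 ≤ n) {M : Type*} [TopologicalSpace M] [T2Space M]
    [SecondCountableTopology M] [ConnectedSpace M] [ChartedSpace (Euc n) M]
    [IsManifold (𝓡 n) ∞ M] [MeasurableSpace M] [BorelSpace M]
    (X N : M → Euc (n + 1)) (hX : IsImmersedHypersurface X) (hN : IsUnitNormal X N)
    (hcomplete : IsCompleteHypersurface X) (hgrowth : HasPolynomialAreaGrowth X)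
    (X₀ : Euc (n + 1)) (t₀ : ℝ) (ht₀ : 0 < t₀) (lam : ℝ) :
    (IsCriticalPoint lam X N X₀ t₀ ↔
      ∀ p : M, meanCurvature X N p + inner ℝ (t₀⁻¹ • (X p - X₀)) (N p) = lam) ∧
    (IsCriticalPoint lam X N X₀ t₀ ↔ IsCriticalPointFixed lam X N X₀ t₀) := by
  have h1 : IsCriticalPoint lam X N X₀ t₀ → IsCriticalPointFixed lam X N X₀ t₀ :=
    fun h => h.isCriticalPointFixed ht₀
  have h2 : IsCriticalPointFixed lam X N X₀ t₀ →
      ∀ p : M, meanCurvature X N p + inner ℝ (t₀⁻¹ • (X p - X₀)) (N p) = lam :=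
    fun h => h.meanCurvature_add_eq hX hN hgrowth ht₀
  have h3 : (∀ p : M, meanCurvature X N p + inner ℝ (t₀⁻¹ • (X p - X₀)) (N p) = lam) →
      IsCriticalPoint lam X N X₀ t₀ :=
    isCriticalPoint_of_meanCurvature_add_eq hX hN hcomplete hgrowth ht₀
  exact ⟨⟨fun h => h2 (h1 h), h3⟩, h1, fun h => h3 (h2 h)⟩
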